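/- **Setting.** Let $\alpha\in\mathbb R$, let $R(x)=x+\alpha \bmod 1$ on $[0,1)$, let $0<z<1$ and $J=[0,z)$, and assume that $x\in[0,1)\setminus J$ implies $Rx\in J$. Let $T:J\to J$ be the first return map of $R$ to $J$; it is an exchange of three intervals (a 3-IET). Let $a_0,a_1,\dots$ be the partial quotients of the continued fraction expansion of $\alpha$ and $p_k/q_k$ its convergents. Write $\lambda$ for Lebesgue measure on $[0,1)$, $\|x\|=\operatorname{dist}(x,\mathbb Z)$, $d(x,y)=\min\{|x-y|,1-|x-y|\}$ and $\psi_r(x)=\sum_{j=0}^{r-1}\chi_J(R^jx)$ for $x\in[0,1)$. Let $\mathcal M_{1,2}$ be the space of flat tori $\mathbb R^2/M\mathbb Z^2$, $M\in SL(2,\mathbb R)$, with two distinct (ordered) marked points, up to translation, where $M$ and $M\gamma$ define the same torus for $\gamma\in SL(2,\mathbb Z)$; it carries the quotient topology, and $SL(2,\mathbb R)$ acts on it linearly. Let $g_t=\begin{pmatrix}e^t&0\\0&e^{-t}\end{pmatrix}$. The point $X\in\mathcal M_{1,2}$ corresponding to $T$ is the torus $\mathbb R^2/\begin{pmatrix}1&-\alpha\\0&1\end{pmatrix}\mathbb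 Z^2$ with marked points $(0,0)$ and $(z,0)$. For $S>0$ let $\nu_S$ be the measure on $\mathcal M_{1,2}$ with $\int f\,d\nu_S=\frac1S\int_0^S f(g_tX)\,dt$ for all $f\in C_c(\mathcal M_{1,2})$. **Proposition.** Suppose that some weak-* limit of $\nu_S$ along a sequence of times $S\to\infty$ (tested against $C_c(\mathcal M_{1,2})$) is not the zero measure. Then $T$ satisfies the following assumptions (A0)–(A9). There exist constants $C_1,C_2,C_3,C_4>1$ such that for every $\ell\in\mathbb N$ and every sufficiently small $\eta>0$ there exist $\hat c_\eta>0$ depending only on $\eta$ and $c_\ell>0$ depending only on $\ell$ such that for every $0<c<c_\ell$ there are a constant $k_c\in\mathbb N$ depending only on $c$ and infinite (strictly increasing) sequences of natural numbers $L_i$ and $k_i\ge1$ such that, for all $i$: - (A0) $q_{k_i-1}<cL_i<q_{k_i}$; - (A1) $a_{k_i}<C_1$; (A2) $a_{k_i+1}<C_2$; (A3) $a_{k_i+2}<C_3$; - (A4) every vertical trajectory on the torus $X$ from one marked point to the $\|q_{k_i}\alpha\|$-neighborhood of the other has length at least $q_{k_i}/C_4$; - (A5) there is an integer $u_i$ such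 that $\lambda(\psi_{L_i}^{-1}(u_i))>\hat c_\eta$ and either $\lambda(\psi_{L_i}^{-1}((-\infty,u_i)))<\eta\hat c_\eta$ or $\lambda(\psi_{L_i}^{-1}((u_i,\infty)))<\eta\hat c_\eta$; - (A6) $\lim_{i\to\infty}\int_0^1 d(R^{L_i}x,x)\,d\lambda(x)=0$; - (A7) $L_i>q_{k_i+\ell}$; - (A8) $\max\{j:\psi_{L_i}^{-1}(j)\ne\emptyset\}-\min\{j:\psi_{L_i}^{-1}(j)\neq\emptyset\}<k_c$; - (A9) there is $v_i$ with $q_{v_i}\le L_i<q_{v_i+1}$ such that either $L_i=q_{v_i}$, or $a_{v_i+1}>4$ and $L_i=p\,q_{v_i}$ for some natural number $p\le\lfloor a_{v_i+1}/4\rfloor$. -/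

import Mathlib

open MeasureTheory Filter Topology
open scoped MatrixGroups Matrix CompactlySupported

noncomputable section

namespace MarkedTorus

/-! ### Tori with two marked points -/

/-- The lattice `M ℤ²` spanned by the two columns of `M`. -/
def lattice (M : SL(2, ℝ)) : AddSubgroup (Fin 2 → ℝ) where
  carrier := {v | ∃ n : Fin 2 → ℤ, v = M.1 *ᵥ (fun i => (n i : ℝ))}
  zero_mem' := ⟨0, by ext i; simp [Matrix.mulVec, dotProduct]⟩
  add_mem' := by
    rintro _ _ ⟨m, rfl⟩ ⟨n, rfl⟩
    refine ⟨m + n, ?_⟩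
    rw [← Matrix.mulVec_add]
    congr 1
    ext i
    simp
  neg_mem' := by
    rintro _ ⟨n, rfl⟩
    refine ⟨-n, ?_⟩
    rw [← Matrix.mulVec_neg]
    congr 1
    ext i
    simp

/-- A unit-area torus `ℝ² / M ℤ²`, given by a positively oriented basis of its lattice (the columns
of `M`), together with two marked points `p₁, p₂`, given by representatives in `ℝ²`, that are
distinct on the torus. A triple `(M, p₁, p₂)` is stored as `x.1`. -/
def Frame : Type :=
  {x : SL(2, ℝ) × (Fin 2 → ℝ) × (Fin 2 → ℝ) // x.2.2 - x.2.1 ∉ lattice x.1}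

instance : TopologicalSpace Frame := inferInstanceAs (TopologicalSpace (Subtype _))

/-- The matrix whose columns span the lattice. -/
def Frame.basis (x : Frame) : SL(2, ℝ) := x.1.1

/-- The first marked point. -/
def Frame.p₁ (x : Frame) : Fin 2 → ℝ := x.1.2.1

/-- The second marked point. -/
def Frame.p₂ (x : Frame) : Fin 2 → ℝ := x.1.2.2

/-- The inclusion of `SL(2, ℤ)` in `SL(2, ℝ)`. -/
def ofInt (γ : SL(2, ℤ)) : SL(2, ℝ) := Matrix.SpecialLinearGroup.map (Int.castRingHom ℝ) γ

theorem mulVec_ofInt_mem (M : SL(2, ℝ)) (γ : SL(2, ℤ)) {v : Fin 2 → ℝ}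
    (hv : v ∈ lattice (M * ofInt γ)) : v ∈ lattice M := by
  obtain ⟨n, rfl⟩ := hv
  refine ⟨γ.1 *ᵥ n, ?_⟩
  rw [Matrix.SpecialLinearGroup.coe_mul, ← Matrix.mulVec_mulVec]
  congr 1
  ext i
  simp [ofInt, Matrix.mulVec, dotProduct]

theorem lattice_mul_ofInt (M : SL(2, ℝ)) (γ : SL(2, ℤ)) :
    lattice (M * ofInt γ) = lattice M := by
  refine le_antisymm (fun v hv => mulVec_ofInt_mem M γ hv) (fun v hv => ?_)
  refine mulVec_ofInt_mem (M * ofInt γ) γ⁻¹ ?_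
  have h : M * ofInt γ * ofInt γ⁻¹ = M := by simp [ofInt]
  rwa [h]

/-- Two triples define the same torus with two (ordered) marked points if the bases generate the
same lattice, i.e. differ by an element of `SL(2, ℤ)`, and some translation of the torus takes
the marked points of the first to those of the second. -/
def Frame.Equiv (x y : Frame) : Prop :=
  (∃ γ : SL(2, ℤ), y.basis = x.basis * ofInt γ) ∧
    ∃ w : Fin 2 → ℝ, y.p₁ - (x.p₁ + w) ∈ lattice x.basis ∧ y.p₂ - (x.p₂ + w) ∈ lattice x.basis

theorem Frame.Equiv.lattice_eq {x y : Frame} (h : x.Equiv y) :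
    lattice y.basis = lattice x.basis := by
  obtain ⟨⟨γ, hγ⟩, -⟩ := h
  rw [hγ, lattice_mul_ofInt]

instance frameSetoid : Setoid Frame where
  r := Frame.Equiv
  iseqv :=
    { refl := fun x => ⟨⟨1, by simp [ofInt]⟩, 0, by simp [zero_mem], by simp [zero_mem]⟩
      symm := by
        intro x y h
        have hl := h.lattice_eq
        obtain ⟨⟨γ, hγ⟩, w, h₁, h₂⟩ := h
        refine ⟨⟨γ⁻¹, by rw [hγ]; simp [ofInt]⟩, -w, ?_, ?_⟩
        · rw [hl]
          convert neg_mem h₁ using 1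
          abel
        · rw [hl]
          convert neg_mem h₂ using 1
          abel
      trans := by
        intro x y z h h'
        have hl := h.lattice_eq
        obtain ⟨⟨γ, hγ⟩, w, h₁, h₂⟩ := h
        obtain ⟨⟨γ', hγ'⟩, w', h₁', h₂'⟩ := h'
        rw [hl] at h₁' h₂'
        refine ⟨⟨γ * γ', by rw [hγ', hγ]; simp [ofInt, mul_assoc]⟩, w + w', ?_, ?_⟩
        · convert add_mem h₁ h₁' using 1
          abel
        · convert add_mem h₂ h₂' using 1
          abel }

/-- The space `𝓜_{1,2}` of unit-area flat tori with two distinct marked points. -/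
def M12 : Type := Quotient frameSetoid

instance : TopologicalSpace M12 := inferInstanceAs (TopologicalSpace (Quotient frameSetoid))

instance : MeasurableSpace M12 := borel M12

instance : BorelSpace M12 := ⟨rfl⟩

theorem mulVec_mem_lattice_iff (g M : SL(2, ℝ)) (v : Fin 2 → ℝ) :
    g.1 *ᵥ v ∈ lattice (g * M) ↔ v ∈ lattice M := by
  have hinv : (g⁻¹).1 * g.1 = 1 := by
    rw [← Matrix.SpecialLinearGroup.coe_mul, inv_mul_cancel, Matrix.SpecialLinearGroup.coe_one]
  have hmul : (g * M).1 = g.1 * M.1 := Matrix.SpecialLinearGroup.coe_mul g M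
  constructor
  · rintro ⟨n, hn⟩
    refine ⟨n, ?_⟩
    have h := congrArg (fun u => (g⁻¹).1 *ᵥ u) hn
    simp only [hmul, Matrix.mulVec_mulVec, ← Matrix.mul_assoc] at h
    rwa [hinv, Matrix.one_mul, Matrix.one_mulVec] at h
  · rintro ⟨n, rfl⟩
    exact ⟨n, by rw [hmul, Matrix.mulVec_mulVec]⟩

/-- The linear action of `SL(2, ℝ)` on bases and marked points. -/
def Frame.act (g : SL(2, ℝ)) (x : Frame) : Frame :=
  ⟨(g * x.basis, g.1 *ᵥ x.p₁, g.1 *ᵥ x.p₂), by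
    simp only [← Matrix.mulVec_sub]
    rw [mulVec_mem_lattice_iff]
    exact x.2⟩

theorem Frame.Equiv.act (g : SL(2, ℝ)) {x y : Frame} (h : x.Equiv y) :
    (x.act g).Equiv (y.act g) := by
  obtain ⟨⟨γ, hγ⟩, w, h₁, h₂⟩ := h
  refine ⟨⟨γ, ?_⟩, g.1 *ᵥ w, ?_, ?_⟩
  · change g * y.basis = g * x.basis * ofInt γ
    rw [hγ, mul_assoc]
  · change g.1 *ᵥ y.p₁ - (g.1 *ᵥ x.p₁ + g.1 *ᵥ w) ∈ lattice (g * x.basis)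
    rw [← Matrix.mulVec_add, ← Matrix.mulVec_sub, mulVec_mem_lattice_iff]
    exact h₁
  · change g.1 *ᵥ y.p₂ - (g.1 *ᵥ x.p₂ + g.1 *ᵥ w) ∈ lattice (g * x.basis)
    rw [← Matrix.mulVec_add, ← Matrix.mulVec_sub, mulVec_mem_lattice_iff]
    exact h₂

/-- The action of `SL(2, ℝ)` on `𝓜_{1,2}`. -/
def M12.act (g : SL(2, ℝ)) : M12 → M12 :=
  Quotient.map (Frame.act g) (fun _ _ h => Frame.Equiv.act g h)

/-- The diagonal matrix `g_t = diag(e^t, e^{-t})`. -/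
def geodesic (t : ℝ) : SL(2, ℝ) :=
  ⟨!![Real.exp t, 0; 0, Real.exp (-t)], by simp [Matrix.det_fin_two, ← Real.exp_add]⟩

/-- The empirical measure `ν_T`: the image of the normalized Lebesgue measure on `(0, T]` under
`t ↦ g_t X`. -/
def empiricalMeasure (X : M12) (T : ℝ) : Measure M12 :=
  (ENNReal.ofReal T)⁻¹ •
    Measure.map (fun t => M12.act (geodesic t) X) (volume.restrict (Set.Ioc 0 T))

theorem continuous_geodesic_act (X : M12) : Continuous fun t => M12.act (geodesic t) X := by
  induction X using Quotient.inductionOn with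
  | h x =>
    have hg : Continuous geodesic := by
      refine Continuous.subtype_mk (continuous_matrix fun i j => ?_) _
      fin_cases i <;> fin_cases j <;> simp <;> fun_prop
    have hv : ∀ v : Fin 2 → ℝ, Continuous fun t => (geodesic t).1 *ᵥ v := fun v =>
      (continuous_subtype_val.comp hg).matrix_mulVec continuous_const
    have hx : Continuous fun t => Frame.act (geodesic t) x :=
      Continuous.subtype_mk
        ((hg.mul continuous_const).prodMk ((hv _).prodMk (hv _))) _
    exact continuous_quotient_mk'.comp hx

theorem integral_empiricalMeasure (X : M12) {T : ℝ} (hT : 0 < T) (f : C_c(M12, ℝ)) :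
    ∫ Y, f Y ∂(empiricalMeasure X T) = 1 / T * ∫ t in (0)..T, f (M12.act (geodesic t) X) := by
  have hf : Continuous (fun Y => f Y) := f.continuous
  rw [empiricalMeasure, integral_smul_measure,
    integral_map (f := fun Y => f Y) (continuous_geodesic_act X).measurable.aemeasurable
      hf.measurable.aestronglyMeasurable,
    intervalIntegral.integral_of_le hT.le]
  simp [ENNReal.toReal_ofReal hT.le]

/-- `ν` is a weak-* limit of the measures `ν_T` as `T → ∞`, along some sequence of times. -/
def IsWeakStarLimit (X : M12) (ν : Measure M12) : Prop :=
  ∃ s : ℕ → ℝ, Tendsto s atTop atTop ∧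
    ∀ f : C_c(M12, ℝ),
      Tendsto (fun n => ∫ Y, f Y ∂(empiricalMeasure X (s n))) atTop (𝓝 (∫ Y, f Y ∂ν))

/-! ### Rotations and three-interval exchanges -/

/-- The rotation `x ↦ x + α mod 1` of `[0, 1)`. -/
def rotation (α x : ℝ) : ℝ := Int.fract (x + α)

/-- The data of a 3-IET as the map induced by the rotation `R` by `α` on `J = [0, z)`, where
`x ∉ J` implies `R x ∈ J`. -/
structure ThreeIET where
  α : ℝ
  z : ℝ
  z_pos : 0 < z
  z_lt_one : z < 1
  rotation_mem : ∀ x ∈ Set.Ico (0 : ℝ) 1, x ∉ Set.Ico 0 z → rotation α x ∈ Set.Ico 0 z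

namespace ThreeIET

variable (I : ThreeIET)

/-- The rotation `R`. -/
def R : ℝ → ℝ := rotation I.α

/-- The interval `J = [0, z)`. -/
def J : Set ℝ := Set.Ico 0 I.z

open Classical in
/-- The 3-IET itself: the first return map of `R` to `J`. -/
def T (x : ℝ) : ℝ := if I.R x ∈ I.J then I.R x else I.R (I.R x)

/-- `T` exchanges three consecutive intervals of lengths `z - β`, `1 - z`, `z + β - 1`, where `β` is
the fractional part of `α`, in reversed order. -/
theorem T_eq {x : ℝ} (hx : x ∈ I.J) :
    1 - I.z ≤ Int.fract I.α ∧ Int.fract I.α ≤ I.z ∧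
      I.T x = if x < I.z - Int.fract I.α then x + Int.fract I.α
        else if x < 1 - Int.fract I.α then x + 2 * Int.fract I.α - 1
        else x + Int.fract I.α - 1 := by
  have hz := I.z_pos
  have hz1 := I.z_lt_one
  set β := Int.fract I.α with hβ
  have hβ0 : 0 ≤ β := Int.fract_nonneg _
  have hβ1 : β < 1 := Int.fract_lt_one _
  have hlow : ∀ y : ℝ, 0 ≤ y → y + β < 1 → rotation I.α y = y + β := by
    intro y h0 h1
    rw [rotation, Int.fract_eq_iff]
    exact ⟨by linarith, h1, ⌊I.α⌋, by rw [hβ, Int.fract]; ring⟩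
  have hhigh : ∀ y : ℝ, y < 1 → 1 ≤ y + β → rotation I.α y = y + β - 1 := by
    intro y h0 h1
    rw [rotation, Int.fract_eq_iff]
    exact ⟨by linarith, by linarith, ⌊I.α⌋ + 1, by rw [hβ, Int.fract]; push_cast; ring⟩
  have h1 : 1 - I.z ≤ β := by
    by_contra! h
    have hm := I.rotation_mem I.z ⟨hz.le, hz1⟩ (by simp)
    rw [hlow _ hz.le (by linarith)] at hm
    have := hm.2
    linarith
  have h2 : β ≤ I.z := by
    by_contra! h
    set y := max I.z (1 - (β - I.z) / 2) with hy
    have hyz : I.z ≤ y := le_max_left _ _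
    have hyb : 1 - (β - I.z) / 2 ≤ y := le_max_right _ _
    have hy1 : y < 1 := max_lt hz1 (by linarith)
    have hm := I.rotation_mem y ⟨by linarith, hy1⟩ (fun hh => by have := hh.2; linarith)
    rw [hhigh _ hy1 (by linarith)] at hm
    have := hm.2
    linarith
  refine ⟨h1, h2, ?_⟩
  obtain ⟨hx0, hxz⟩ := hx
  have hR : I.R = rotation I.α := rfl
  have hJ : I.J = Set.Ico 0 I.z := rfl
  rw [T, hR, hJ]
  by_cases c1 : x < I.z - β
  · rw [if_pos c1, hlow x hx0 (by linarith), if_pos ⟨by linarith, by linarith⟩]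
  · rw [if_neg c1]
    by_cases c2 : x < 1 - β
    · rw [if_pos c2, hlow x hx0 (by linarith),
        if_neg (fun hh => by have := hh.2; linarith), hhigh _ (by linarith) (by linarith)]
      ring
    · rw [if_neg c2, hhigh x (by linarith) (by linarith), if_pos ⟨by linarith, by linarith⟩]

/-- The torus with fundamental parallelogram spanned by `(1, 0)` and `(-α, 1)`, on which the first
return of the upward vertical flow to the horizontal side is `R`, with the two endpoints of the
horizontal segment `J` marked. -/
def frame : Frame :=
  ⟨(⟨!![1, -I.α; 0, 1], by simp [Matrix.det_fin_two]⟩, ![0, 0], ![I.z, 0]), by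
    rintro ⟨n, hn⟩
    have h₀ := congrFun hn 0
    have h₁ := congrFun hn 1
    simp [Matrix.mulVec, dotProduct, Fin.sum_univ_two] at h₀ h₁
    have h₂ : (n 1 : ℝ) = 0 := by exact_mod_cast h₁.symm
    rw [h₂] at h₀
    have hp := I.z_pos
    have hl := I.z_lt_one
    simp at h₀
    rw [h₀] at hp hl
    have hp' : 0 < n 0 := by exact_mod_cast hp
    have hl' : n 0 < 1 := by exact_mod_cast hl
    omega⟩

/-- The point of `𝓜_{1,2}` corresponding to the 3-IET. -/
def torus : M12 := Quotient.mk frameSetoid I.frame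

/-- The partial quotients `a_0, a_1, …` of `α` (with value `0` past the end of a finite
expansion). -/
def a : ℕ → ℝ
  | 0 => (GenContFract.of I.α).h
  | k + 1 => ((GenContFract.of I.α).partDens.get? k).getD 0

/-- The denominators `q_k` of the convergents of `α`. -/
def q (k : ℕ) : ℝ := (GenContFract.of I.α).dens k

/-- `ψ_r(x)`, the number of `0 ≤ j < r` with `R^j x ∈ J`. -/
def ψ (r : ℕ) (x : ℝ) : ℕ :=
  ∑ j ∈ Finset.range r, Set.indicator I.J (fun _ => 1) (I.R^[j] x)

/-- The set of points of `[0, 1)` at which `ψ_r` takes a value in `S`. -/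
def ψPreimage (r : ℕ) (S : Set ℕ) : Set ℝ := {x ∈ Set.Ico (0 : ℝ) 1 | I.ψ r x ∈ S}

end ThreeIET

/-- The distance of a real number to the nearest integer. -/
def distInt (x : ℝ) : ℝ := |x - round x|

/-- The distance on the circle `[0, 1)`. -/
def circleDist (x y : ℝ) : ℝ := min |x - y| (1 - |x - y|)

/-- On the torus `ℝ² / M ℤ²`, the vertical trajectory of signed length `τ` starting at `p` ends in
the (closed) `ρ`-neighborhood of `p'`. -/
def VerticalReaches (M : SL(2, ℝ)) (p p' : Fin 2 → ℝ) (ρ τ : ℝ) : Prop :=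
  ∃ v ∈ lattice M, ‖WithLp.toLp 2 (p + ![0, τ] - (p' + v))‖ ≤ ρ

/-- Every vertical trajectory from one of the marked points to the `ρ`-neighborhood of the other
has length at least `len`. -/
def VerticalGap (x : Frame) (ρ len : ℝ) : Prop :=
  ∀ τ : ℝ, (VerticalReaches x.basis x.p₁ x.p₂ ρ τ ∨ VerticalReaches x.basis x.p₂ x.p₁ ρ τ) →
    len ≤ |τ|

namespace ThreeIET

variable (I : ThreeIET)

/-- The condition (A5) for one value `L` of the sequence. -/
def A5 (η chat : ℝ) (L : ℕ) : Prop :=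
  ∃ u : ℕ,
    (chat < volume.real (I.ψPreimage L {u}) ∧ volume.real (I.ψPreimage L (Set.Iio u)) < η * chat) ∨
    (chat < volume.real (I.ψPreimage L {u}) ∧ volume.real (I.ψPreimage L (Set.Ioi u)) < η * chat)

/-- The condition (A9) for one value `L` of the sequence. -/
def A9 (L : ℕ) : Prop :=
  ∃ v : ℕ, I.q v ≤ L ∧ (L : ℝ) < I.q (v + 1) ∧
    ((L : ℝ) = I.q v ∨
      (4 < I.a (v + 1) ∧ ∃ p : ℕ, p ≤ ⌊I.a (v + 1) / 4⌋₊ ∧ (L : ℝ) = p * I.q v))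

/-- The conditions (A0)-(A9) on infinite sequences `L_i, k_i`, for given constants. -/
structure Conditions (C₁ C₂ C₃ C₄ : ℝ) (ℓ : ℕ) (η chat c : ℝ) (kc : ℕ) (L k : ℕ → ℕ) :
    Prop where
  L_strictMono : StrictMono L
  k_strictMono : StrictMono k
  k_pos : ∀ i, 1 ≤ k i
  A0 : ∀ i, I.q (k i - 1) < c * L i ∧ c * L i < I.q (k i)
  A1 : ∀ i, I.a (k i) < C₁
  A2 : ∀ i, I.a (k i + 1) < C₂
  A3 : ∀ i, I.a (k i + 2) < C₃
  A4 : ∀ i, VerticalGap I.frame (distInt (I.q (k i) * I.α)) (I.q (k i) / C₄)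
  A5 : ∀ i, I.A5 η chat (L i)
  A6 : Tendsto (fun i => ∫ x in (0 : ℝ)..1, circleDist (I.R^[L i] x) x) atTop (𝓝 0)
  A7 : ∀ i, I.q (k i + ℓ) < L i
  A8 : ∀ i, ∀ j ∈ I.ψ (L i) '' Set.Ico 0 1, ∀ j' ∈ I.ψ (L i) '' Set.Ico 0 1, (j : ℤ) - j' < kc
  A9 : ∀ i, I.A9 (L i)

/-- The 3-IET satisfies the assumptions (A0)-(A9): there are constants `C₁, …, C₄`, constants
`chat η`, `cbound ℓ` and `kc c` depending only on `η`, `ℓ` and `c` respectively, and sequences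
`L_i, k_i` for each choice of `ℓ`, of (small) `η`, and of `c < cbound ℓ`. -/
def SatisfiesAssumptions : Prop :=
  ∃ C₁ C₂ C₃ C₄ : ℝ, 1 < C₁ ∧ 1 < C₂ ∧ 1 < C₃ ∧ 1 < C₄ ∧
    ∃ (η₀ : ℝ) (chat : ℝ → ℝ) (cbound : ℕ → ℝ) (kc : ℝ → ℕ),
      0 < η₀ ∧ (∀ η, 0 < η → 0 < chat η) ∧ (∀ ℓ, 0 < cbound ℓ) ∧
      ∀ (ℓ : ℕ) (η : ℝ), 0 < η → η < η₀ → ∀ c : ℝ, 0 < c → c < cbound ℓ →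
        ∃ L k : ℕ → ℕ, I.Conditions C₁ C₂ C₃ C₄ ℓ η (chat η) c (kc c) L k

end ThreeIET

end MarkedTorus

end

noncomputable section

namespace MarkedTorus

/-! ### The systole of a torus with two marked points -/

/-- The holonomies of the closed loops and of the paths between the two marked points. -/
def holonomies (x : Frame) : Set (Fin 2 → ℝ) :=
  {w | w ∈ lattice x.basis ∧ w ≠ 0} ∪ {w | w - (x.p₂ - x.p₁) ∈ lattice x.basis}

theorem holonomies_eq_of_equiv {x y : Frame} (h : x.Equiv y) : holonomies y = holonomies x := by
  have hl := h.lattice_eq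
  obtain ⟨-, w, h₁, h₂⟩ := h
  have hd : (y.p₂ - y.p₁) - (x.p₂ - x.p₁) ∈ lattice x.basis := by
    convert sub_mem h₂ h₁ using 1
    abel
  unfold holonomies
  rw [hl]
  congr 1
  ext u
  simp only [Set.mem_ofPred_eq]
  constructor
  · intro hu
    convert add_mem hu hd using 1
    abel
  · intro hu
    convert sub_mem hu hd using 1
    abel

theorem holonomies_nonempty (x : Frame) : (holonomies x).Nonempty :=
  ⟨x.p₂ - x.p₁, Or.inr (by simp [zero_mem])⟩

/-- The length of the shortest holonomy, in the sup norm. -/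
def Frame.systole (x : Frame) : ℝ := Metric.infDist 0 (holonomies x)

/-- The length of the shortest holonomy, in the sup norm. -/
def M12.systole : M12 → ℝ :=
  Quotient.lift Frame.systole fun _ _ h => by
    unfold Frame.systole
    rw [holonomies_eq_of_equiv h]

theorem Frame.systole_le_norm {x : Frame} {w : Fin 2 → ℝ} (hw : w ∈ holonomies x) :
    x.systole ≤ ‖w‖ := by
  have := Metric.infDist_le_dist_of_mem (x := (0 : Fin 2 → ℝ)) hw
  rwa [dist_zero_left] at this

theorem Frame.le_systole {x : Frame} {r : ℝ} (h : ∀ w ∈ holonomies x, r ≤ ‖w‖) :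
    r ≤ x.systole := by
  refine (Metric.le_infDist (holonomies_nonempty x)).2 fun w hw => ?_
  rw [dist_zero_left]
  exact h w hw

/-- An upper bound, at least `1`, for the operator norm of a matrix in the sup norm. -/
def supBound (B : Matrix (Fin 2) (Fin 2) ℝ) : ℝ :=
  max 1 (max (|B 0 0| + |B 0 1|) (|B 1 0| + |B 1 1|))

theorem one_le_supBound (B : Matrix (Fin 2) (Fin 2) ℝ) : 1 ≤ supBound B := le_max_left _ _

theorem norm_mulVec_le (B : Matrix (Fin 2) (Fin 2) ℝ) (v : Fin 2 → ℝ) :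
    ‖B *ᵥ v‖ ≤ supBound B * ‖v‖ := by
  have h0 : ∀ i, |v i| ≤ ‖v‖ := fun i => norm_le_pi_norm v i
  have hv := norm_nonneg v
  rw [pi_norm_le_iff_of_nonneg (mul_nonneg (zero_le_one.trans (one_le_supBound B)) hv)]
  have hrow : ∀ i, ‖(B *ᵥ v) i‖ ≤ (|B i 0| + |B i 1|) * ‖v‖ := by
    intro i
    simp only [Matrix.mulVec, dotProduct, Fin.sum_univ_two, Real.norm_eq_abs]
    refine (abs_add_le _ _).trans ?_
    rw [abs_mul, abs_mul, add_mul]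
    gcongr <;> exact h0 _
  intro i
  refine (hrow i).trans (mul_le_mul_of_nonneg_right ?_ hv)
  fin_cases i
  · exact (le_max_left _ _).trans (le_max_right _ _)
  · exact (le_max_right _ _).trans (le_max_right _ _)

theorem supBound_one : supBound 1 = 1 := by simp [supBound]

theorem continuous_supBound : Continuous supBound := by
  unfold supBound
  fun_prop

theorem mulVec_intCast_ne_zero (M : SL(2, ℝ)) {n : Fin 2 → ℤ} (hn : n ≠ 0) :
    M.1 *ᵥ (fun i => (n i : ℝ)) ≠ 0 := by
  intro h
  have h1 := congrArg (fun u => (M⁻¹).1 *ᵥ u) h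
  simp only [Matrix.mulVec_mulVec, Matrix.mulVec_zero] at h1
  rw [← Matrix.SpecialLinearGroup.coe_mul, inv_mul_cancel, Matrix.SpecialLinearGroup.coe_one,
    Matrix.one_mulVec] at h1
  apply hn
  ext i
  have := congrFun h1 i
  simpa using this

theorem Frame.systole_le (x y : Frame) :
    y.systole ≤ supBound (y.basis * x.basis⁻¹).1 * x.systole +
      ‖(y.p₂ - y.p₁) - (y.basis * x.basis⁻¹).1 *ᵥ (x.p₂ - x.p₁)‖ := by
  set B := (y.basis * x.basis⁻¹).1 with hB
  set e := ‖(y.p₂ - y.p₁) - B *ᵥ (x.p₂ - x.p₁)‖ with he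
  have he0 : 0 ≤ e := norm_nonneg _
  have hc : 0 < supBound B := zero_lt_one.trans_le (one_le_supBound B)
  have hBM : B * x.basis.1 = y.basis.1 := by
    rw [hB, ← Matrix.SpecialLinearGroup.coe_mul, inv_mul_cancel_right]
  have key : ∀ w ∈ holonomies x, y.systole ≤ supBound B * ‖w‖ + e := by
    rintro w (⟨⟨n, rfl⟩, hw⟩ | ⟨n, hn⟩)
    · have hn0 : n ≠ 0 := by
        rintro rfl
        apply hw
        ext i
        simp [Matrix.mulVec, dotProduct]
      have hmem : y.basis.1 *ᵥ (fun i => (n i : ℝ)) ∈ holonomies y :=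
        Or.inl ⟨⟨n, rfl⟩, mulVec_intCast_ne_zero _ hn0⟩
      refine (Frame.systole_le_norm hmem).trans ?_
      rw [← hBM, ← Matrix.mulVec_mulVec]
      exact (norm_mulVec_le _ _).trans (le_add_of_nonneg_right he0)
    · have hmem : y.basis.1 *ᵥ (fun i => (n i : ℝ)) + (y.p₂ - y.p₁) ∈ holonomies y :=
        Or.inr ⟨n, by simp⟩
      refine (Frame.systole_le_norm hmem).trans ?_
      have : y.basis.1 *ᵥ (fun i => (n i : ℝ)) + (y.p₂ - y.p₁) =
          B *ᵥ w + ((y.p₂ - y.p₁) - B *ᵥ (x.p₂ - x.p₁)) := by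
        rw [← hBM, ← Matrix.mulVec_mulVec, ← hn, Matrix.mulVec_sub]
        abel
      rw [this]
      exact (norm_add_le _ _).trans (add_le_add_left (norm_mulVec_le _ _) _)
  have h1 : (y.systole - e) / supBound B ≤ x.systole := by
    refine Frame.le_systole fun w hw => ?_
    rw [div_le_iff₀ hc]
    have := key w hw
    linarith
  rw [div_le_iff₀ hc] at h1
  linarith

theorem Frame.continuous_basis : Continuous Frame.basis :=
  continuous_fst.comp continuous_subtype_val

theorem Frame.continuous_sub : Continuous fun x : Frame => x.p₂ - x.p₁ :=
  (continuous_snd.comp (continuous_snd.comp continuous_subtype_val)).sub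
    (continuous_fst.comp (continuous_snd.comp continuous_subtype_val))

theorem Frame.continuous_systole : Continuous Frame.systole := by
  rw [continuous_iff_continuousAt]
  intro x₀
  have hval : Continuous fun M : SL(2, ℝ) => M.1 := continuous_subtype_val
  have hB : Continuous fun x : Frame => (x.basis * x₀.basis⁻¹).1 :=
    hval.comp (Frame.continuous_basis.mul continuous_const)
  have hB' : Continuous fun x : Frame => (x₀.basis * x.basis⁻¹).1 :=
    hval.comp (continuous_const.mul Frame.continuous_basis.inv)
  have hcont : Continuous fun x : Frame => supBound (x.basis * x₀.basis⁻¹).1 * x₀.systole +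
      ‖(x.p₂ - x.p₁) - (x.basis * x₀.basis⁻¹).1 *ᵥ (x₀.p₂ - x₀.p₁)‖ :=
    ((continuous_supBound.comp hB).mul continuous_const).add
      (Frame.continuous_sub.sub (hB.matrix_mulVec continuous_const)).norm
  have hcont' : Continuous fun x : Frame => (x₀.systole -
      ‖(x₀.p₂ - x₀.p₁) - (x₀.basis * x.basis⁻¹).1 *ᵥ (x.p₂ - x.p₁)‖) /
        supBound (x₀.basis * x.basis⁻¹).1 :=
    (continuous_const.sub
      (continuous_const.sub (hB'.matrix_mulVec Frame.continuous_sub)).norm).div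
      (continuous_supBound.comp hB') fun x => (zero_lt_one.trans_le (one_le_supBound _)).ne'
  have h1 := hcont.tendsto x₀
  have h2 := hcont'.tendsto x₀
  simp only [mul_inv_cancel, Matrix.SpecialLinearGroup.coe_one, Matrix.one_mulVec, sub_self,
    norm_zero, supBound_one, one_mul, add_zero, sub_zero, div_one] at h1 h2
  refine tendsto_of_tendsto_of_tendsto_of_le_of_le h2 h1 (fun x => ?_) fun x => ?_
  · simp only
    rw [div_le_iff₀ (zero_lt_one.trans_le (one_le_supBound _))]
    have := Frame.systole_le x x₀
    linarith
  · exact Frame.systole_le x₀ x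

theorem M12.continuous_systole : Continuous M12.systole :=
  Frame.continuous_systole.quotient_lift _

theorem Frame.systole_pos (x : Frame) : 0 < x.systole := by
  set M := x.basis with hM
  set u := (M⁻¹).1 *ᵥ (x.p₂ - x.p₁) with hu
  have hMinv : M.1 * (M⁻¹).1 = 1 := by
    rw [← Matrix.SpecialLinearGroup.coe_mul, mul_inv_cancel, Matrix.SpecialLinearGroup.coe_one]
  have hinvM : (M⁻¹).1 * M.1 = 1 := by
    rw [← Matrix.SpecialLinearGroup.coe_mul, inv_mul_cancel, Matrix.SpecialLinearGroup.coe_one]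
  have hMu : M.1 *ᵥ u = x.p₂ - x.p₁ := by
    rw [hu, Matrix.mulVec_mulVec, hMinv, Matrix.one_mulVec]
  obtain ⟨i, hi⟩ : ∃ i, u i - round (u i) ≠ 0 := by
    by_contra! hall
    refine x.2 ⟨fun i => round (u i), ?_⟩
    have : u = fun i => (round (u i) : ℝ) := by
      ext i
      linarith [hall i]
    change x.p₂ - x.p₁ = M.1 *ᵥ _
    rw [← hMu]
    exact congrArg _ this
  set r := min 1 |u i - round (u i)| with hr
  have hr0 : 0 < r := lt_min one_pos (abs_pos.2 hi)
  set c := supBound (M⁻¹).1 with hc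
  have hc0 : 0 < c := zero_lt_one.trans_le (one_le_supBound _)
  refine (div_pos hr0 hc0).trans_le (Frame.le_systole fun w hw => ?_)
  rw [div_le_iff₀' hc0]
  refine le_trans ?_ (norm_mulVec_le _ _)
  rcases hw with ⟨⟨n, rfl⟩, hw⟩ | ⟨n, hn⟩
  · rw [Matrix.mulVec_mulVec, hinvM, Matrix.one_mulVec]
    obtain ⟨j, hj⟩ : ∃ j, n j ≠ 0 := by
      by_contra! hall
      apply hw
      have : (fun i => (n i : ℝ)) = 0 := by ext i; simp [hall i]
      rw [this, Matrix.mulVec_zero]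
    refine (min_le_left _ _).trans (le_trans ?_ (norm_le_pi_norm _ j))
    rw [Real.norm_eq_abs]
    exact_mod_cast Int.one_le_abs hj
  · have hw : w = M.1 *ᵥ (fun i => (n i : ℝ)) + (x.p₂ - x.p₁) := by
      rw [← hn]; abel
    rw [hw, ← hMu, ← Matrix.mulVec_add, Matrix.mulVec_mulVec, hinvM, Matrix.one_mulVec]
    refine (min_le_right _ _).trans (le_trans ?_ (norm_le_pi_norm _ i))
    rw [Real.norm_eq_abs, Pi.add_apply]
    have := round_le (u i) (-n i)
    push_cast at this
    rwa [sub_neg_eq_add, add_comm (u i)] at this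

theorem M12.systole_pos (Y : M12) : 0 < Y.systole :=
  Quotient.inductionOn Y fun x => x.systole_pos

/-! ### Compactness -/

/-- Reduction theory: a lattice without short vectors has a basis of bounded vectors. -/
theorem exists_reduced_basis (M : SL(2, ℝ)) {ε : ℝ} (hε : 0 < ε)
    (h : ∀ n : Fin 2 → ℤ, n ≠ 0 → ε ≤ ‖M.1 *ᵥ (fun i => (n i : ℝ))‖) :
    ∃ γ : SL(2, ℤ), ∀ i j, |(M * ofInt γ).1 i j| ≤ 2 + 2 / ε ^ 4 := by
  have hdet := M.2
  rw [Matrix.det_fin_two] at hdet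
  set w₁ : ℂ := ⟨M.1 1 0, M.1 0 0⟩ with hw₁
  set w₂ : ℂ := ⟨M.1 1 1, M.1 0 1⟩ with hw₂
  have hw₂0 : w₂ ≠ 0 := by
    intro h0
    have h1 := congrArg Complex.re h0
    have h2 := congrArg Complex.im h0
    simp [hw₂] at h1 h2
    rw [h1, h2] at hdet
    simp at hdet
  have him : 0 < (w₁ / w₂).im := by
    rw [Complex.div_im]
    have hns : 0 < Complex.normSq w₂ := Complex.normSq_pos.2 hw₂0
    rw [← sub_div]
    refine div_pos ?_ hns
    simp [hw₁, hw₂]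
    linarith
  obtain ⟨g, hg⟩ := ModularGroup.exists_smul_mem_fd ⟨w₁ / w₂, him⟩
  obtain ⟨hg1, hg2⟩ := hg
  refine ⟨⟨g.1.transpose, by rw [Matrix.det_transpose]; exact g.2⟩, ?_⟩
  set γ : SL(2, ℤ) := ⟨g.1.transpose, by rw [Matrix.det_transpose]; exact g.2⟩ with hγ
  set N := M * ofInt γ with hN
  have hNdet := N.2
  rw [Matrix.det_fin_two] at hNdet
  have hN0 : ∀ i, N.1 i 0 = g 0 0 * M.1 i 0 + g 0 1 * M.1 i 1 := by
    intro i
    simp [hN, hγ, ofInt, Matrix.mul_apply, Fin.sum_univ_two, mul_comm]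
    rfl
  have hN1 : ∀ i, N.1 i 1 = g 1 0 * M.1 i 0 + g 1 1 * M.1 i 1 := by
    intro i
    simp [hN, hγ, ofInt, Matrix.mul_apply, Fin.sum_univ_two, mul_comm]
    rfl
  set v₁ : ℂ := ⟨N.1 1 0, N.1 0 0⟩ with hv₁
  set v₂ : ℂ := ⟨N.1 1 1, N.1 0 1⟩ with hv₂
  have hv₁' : v₁ = g 0 0 * w₁ + g 0 1 * w₂ := by
    apply Complex.ext <;> simp [hv₁, hw₁, hw₂, hN0]
  have hv₂' : v₂ = g 1 0 * w₁ + g 1 1 * w₂ := by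
    apply Complex.ext <;> simp [hv₂, hw₁, hw₂, hN1]
  have hcoe : ((g • (⟨w₁ / w₂, him⟩ : UpperHalfPlane) : UpperHalfPlane) : ℂ) = v₁ / v₂ := by
    rw [UpperHalfPlane.coe_specialLinearGroup_apply, hv₁', hv₂']
    simp only [algebraMap_int_eq, eq_intCast]
    have e1 : ((g 0 0 : ℝ) : ℂ) * (w₁ / w₂) + ((g 0 1 : ℝ) : ℂ) =
        (g 0 0 * w₁ + g 0 1 * w₂) / w₂ := by
      push_cast
      field_simp
    have e2 : ((g 1 0 : ℝ) : ℂ) * (w₁ / w₂) + ((g 1 1 : ℝ) : ℂ) =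
        (g 1 0 * w₁ + g 1 1 * w₂) / w₂ := by
      push_cast
      field_simp
    rw [e1, e2, div_div_div_cancel_right₀ hw₂0]
  rw [← UpperHalfPlane.coe_re, hcoe] at hg2
  rw [hcoe, map_div₀] at hg1
  -- the second column
  have hlow : ε ^ 2 ≤ Complex.normSq v₂ := by
    have hne : (γ.1 *ᵥ ![0, 1]) ≠ 0 := by
      intro h0
      have h1 := congrArg (fun u => (γ⁻¹).1 *ᵥ u) h0
      simp only [Matrix.mulVec_mulVec, Matrix.mulVec_zero] at h1
      rw [← Matrix.SpecialLinearGroup.coe_mul, inv_mul_cancel, Matrix.SpecialLinearGroup.coe_one,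
        Matrix.one_mulVec] at h1
      simpa using congrFun h1 1
    have h1 := h _ hne
    have h2 : M.1 *ᵥ (fun i => ((γ.1 *ᵥ ![0, 1]) i : ℝ)) = ![N.1 0 1, N.1 1 1] := by
      ext i
      fin_cases i <;>
        simp [hN1, hγ, Matrix.mulVec, dotProduct, Fin.sum_univ_two, mul_comm]
    rw [h2] at h1
    have h3 : ‖(![N.1 0 1, N.1 1 1] : Fin 2 → ℝ)‖ ^ 2 ≤ N.1 0 1 ^ 2 + N.1 1 1 ^ 2 := by
      have : ‖(![N.1 0 1, N.1 1 1] : Fin 2 → ℝ)‖ ≤ √(N.1 0 1 ^ 2 + N.1 1 1 ^ 2) := by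
        rw [pi_norm_le_iff_of_nonneg (Real.sqrt_nonneg _)]
        intro i
        fin_cases i <;> simp only [Real.norm_eq_abs] <;> apply Real.abs_le_sqrt <;> simp <;>
          positivity
      calc _ ≤ √(N.1 0 1 ^ 2 + N.1 1 1 ^ 2) ^ 2 := by gcongr
        _ = _ := Real.sq_sqrt (by positivity)
    have h4 : Complex.normSq v₂ = N.1 0 1 ^ 2 + N.1 1 1 ^ 2 := by
      simp [hv₂, Complex.normSq_apply]; ring
    rw [h4]
    exact (pow_le_pow_left₀ hε.le h1 2).trans h3
  have hv₂pos : 0 < Complex.normSq v₂ := lt_of_lt_of_le (by positivity) hlow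
  have him' : (v₁ / v₂).im = 1 / Complex.normSq v₂ := by
    rw [Complex.div_im, ← sub_div]
    congr 1
    simp [hv₁, hv₂]
    linarith
  have hsq : Complex.normSq v₁ / Complex.normSq v₂ =
      (v₁ / v₂).re ^ 2 + (1 / Complex.normSq v₂) ^ 2 := by
    rw [← map_div₀, Complex.normSq_apply, ← him']
    ring
  have hre : (v₁ / v₂).re ^ 2 ≤ 1 / 4 := by
    have := sq_le_sq' (abs_le.1 hg2).1 (abs_le.1 hg2).2
    linarith
  set A := Complex.normSq v₁ with hA
  set D := Complex.normSq v₂ with hD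
  have hDup : D ≤ 2 := by
    by_contra! hlt
    have : (1 / D) ^ 2 ≤ 1 / 4 := by
      have : 1 / D ≤ 1 / 2 := one_div_le_one_div_of_le (by norm_num) hlt.le
      have h0 : 0 ≤ 1 / D := by positivity
      nlinarith
    rw [hsq] at hg1
    linarith
  have hinv : (1 / D) ^ 2 ≤ 1 / ε ^ 4 := by
    have : 1 / D ≤ 1 / ε ^ 2 := one_div_le_one_div_of_le (by positivity) hlow
    calc (1 / D) ^ 2 ≤ (1 / ε ^ 2) ^ 2 := by gcongr
      _ = 1 / ε ^ 4 := by rw [div_pow, ← pow_mul]; norm_num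
  have hAup : A ≤ 2 + 2 / ε ^ 4 := by
    have h1 : A = D * (A / D) := by field_simp
    have h2 : A / D ≤ 1 + 1 / ε ^ 4 := by rw [hsq]; linarith
    have h3 : 0 ≤ A / D := by rw [hsq]; positivity
    calc A = D * (A / D) := h1
      _ ≤ 2 * (1 + 1 / ε ^ 4) := by gcongr
      _ = _ := by ring
  have hpos : 0 < 2 / ε ^ 4 := by positivity
  have habs : ∀ t : ℝ, t ^ 2 ≤ 2 + 2 / ε ^ 4 → |t| ≤ 2 + 2 / ε ^ 4 := by
    intro t ht
    refine abs_le_of_sq_le_sq (ht.trans ?_) (by positivity)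
    nlinarith
  have hA' : A = N.1 0 0 ^ 2 + N.1 1 0 ^ 2 := by
    simp [hA, hv₁, Complex.normSq_apply]; ring
  have hD' : D = N.1 0 1 ^ 2 + N.1 1 1 ^ 2 := by
    simp [hD, hv₂, Complex.normSq_apply]; ring
  intro i j
  apply habs
  fin_cases i <;> fin_cases j <;> simp only [Fin.zero_eta, Fin.mk_one, Fin.isValue]
  · nlinarith [sq_nonneg (N.1 1 0)]
  · nlinarith [sq_nonneg (N.1 1 1)]
  · nlinarith [sq_nonneg (N.1 0 0)]
  · nlinarith [sq_nonneg (N.1 0 1)]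

theorem isCompact_bounded_entries (B : ℝ) :
    IsCompact {M : SL(2, ℝ) | ∀ i j, |M.1 i j| ≤ B} := by
  refine Subtype.isCompact_iff.2 ?_
  have hK : IsCompact (Set.pi Set.univ fun _ : Fin 2 => Set.pi Set.univ fun _ : Fin 2 =>
      Set.Icc (-B) B) := isCompact_univ_pi fun _ => isCompact_univ_pi fun _ => isCompact_Icc
  refine IsCompact.of_isClosed_subset hK ?_ ?_
  · have : (Subtype.val '' {M : SL(2, ℝ) | ∀ i j, |M.1 i j| ≤ B}) =
        {A : Matrix (Fin 2) (Fin 2) ℝ | A.det = 1} ∩ ⋂ i, ⋂ j, {A | |A i j| ≤ B} := by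
      ext A
      simp only [Set.mem_image, Set.mem_ofPred_eq, Set.mem_inter_iff, Set.mem_iInter]
      constructor
      · rintro ⟨M, hM, rfl⟩
        exact ⟨M.2, hM⟩
      · rintro ⟨hdet, hA⟩
        exact ⟨⟨A, hdet⟩, hA, rfl⟩
    refine Eq.subst (motive := IsClosed) this.symm ?_
    refine (isClosed_eq (continuous_id.matrix_det) continuous_const).inter ?_
    refine isClosed_iInter fun i => isClosed_iInter fun j => ?_
    exact isClosed_le (continuous_abs.comp (continuous_id.matrix_elem i j)) continuous_const
  · rintro _ ⟨M, hM, rfl⟩ i - j -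
    exact abs_le.1 (hM i j)

/-- The frames with bounded basis and marked points at the origin and at a bounded vector, such
that the marked points are uniformly apart. -/
def boundedFrames (B ε : ℝ) : Set Frame :=
  {x | (∀ i j, |x.basis.1 i j| ≤ B) ∧ x.p₁ = 0 ∧ ‖x.p₂‖ ≤ 2 * B ∧
    ∀ n : Fin 2 → ℤ, ε ≤ ‖x.p₂ - x.p₁ - x.basis.1 *ᵥ (fun i => (n i : ℝ))‖}

theorem isCompact_boundedFrames (B : ℝ) {ε : ℝ} (hε : 0 < ε) :
    IsCompact (boundedFrames B ε) := by
  refine Subtype.isCompact_iff.2 ?_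
  have hK : IsCompact ({M : SL(2, ℝ) | ∀ i j, |M.1 i j| ≤ B} ×ˢ
      (({0} : Set (Fin 2 → ℝ)) ×ˢ Metric.closedBall (0 : Fin 2 → ℝ) (2 * B))) :=
    (isCompact_bounded_entries B).prod (isCompact_singleton.prod (isCompact_closedBall _ _))
  have himg : Subtype.val '' boundedFrames B ε =
      ({M : SL(2, ℝ) | ∀ i j, |M.1 i j| ≤ B} ×ˢ
        (({0} : Set (Fin 2 → ℝ)) ×ˢ Metric.closedBall (0 : Fin 2 → ℝ) (2 * B))) ∩
      ⋂ n : Fin 2 → ℤ, {y : SL(2, ℝ) × (Fin 2 → ℝ) × (Fin 2 → ℝ) |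
        ε ≤ ‖y.2.2 - y.2.1 - y.1.1 *ᵥ (fun i => (n i : ℝ))‖} := by
    ext y
    simp only [Set.mem_inter_iff, Set.mem_prod, Set.mem_ofPred_eq,
      Set.mem_singleton_iff, mem_closedBall_zero_iff, Set.mem_iInter]
    constructor
    · rintro ⟨x, ⟨h1, h2, h3, h4⟩, rfl⟩
      exact ⟨⟨h1, h2, h3⟩, h4⟩
    · rintro ⟨⟨h1, h2, h3⟩, h4⟩
      refine ⟨⟨y, ?_⟩, ⟨h1, h2, h3, h4⟩, rfl⟩
      rintro ⟨n, hn⟩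
      have := h4 n
      rw [hn, sub_self, norm_zero] at this
      linarith
  rw [himg]
  refine hK.inter_right (isClosed_iInter fun n => isClosed_le continuous_const ?_)
  have h1 : Continuous fun y : SL(2, ℝ) × (Fin 2 → ℝ) × (Fin 2 → ℝ) => y.1.1 :=
    continuous_subtype_val.comp continuous_fst
  exact (((continuous_snd.comp continuous_snd).sub (continuous_fst.comp continuous_snd)).sub
    (h1.matrix_mulVec continuous_const)).norm

theorem exists_isCompact_systole_ge {ε : ℝ} (hε : 0 < ε) :
    ∃ K : Set M12, IsCompact K ∧ {Y : M12 | ε ≤ Y.systole} ⊆ K := by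
  set B := 2 + 2 / ε ^ 4 with hB
  have hB0 : 0 < B := by positivity
  refine ⟨Quotient.mk frameSetoid '' boundedFrames B ε,
    (isCompact_boundedFrames B hε).image continuous_quotient_mk', fun Y hY => ?_⟩
  induction Y using Quotient.inductionOn with
  | h x =>
    have hx : ε ≤ x.systole := hY
    obtain ⟨γ, hγ⟩ := exists_reduced_basis x.basis hε fun n hn =>
      hx.trans (Frame.systole_le_norm (Or.inl ⟨⟨n, rfl⟩, mulVec_intCast_ne_zero _ hn⟩))
    set N := x.basis * ofInt γ with hN
    set u := (N⁻¹).1 *ᵥ (x.p₂ - x.p₁) with hu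
    have hNu : N.1 *ᵥ u = x.p₂ - x.p₁ := by
      rw [hu, Matrix.mulVec_mulVec, ← Matrix.SpecialLinearGroup.coe_mul, mul_inv_cancel,
        Matrix.SpecialLinearGroup.coe_one, Matrix.one_mulVec]
    set p : Fin 2 → ℝ := N.1 *ᵥ (fun i => Int.fract (u i)) with hp
    have hl : lattice N = lattice x.basis := lattice_mul_ofInt _ _
    have hpx : p - (x.p₂ - x.p₁) ∈ lattice x.basis := by
      rw [← hl]
      refine ⟨fun i => -⌊u i⌋, ?_⟩
      rw [hp, ← hNu, ← Matrix.mulVec_sub]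
      congr 1
      ext i
      have := Int.self_sub_floor (u i)
      simp only [Pi.sub_apply, Int.cast_neg]
      linarith
    have hpN : p - 0 ∉ lattice N := by
      rw [sub_zero, hl]
      intro hmem
      apply x.2
      have := sub_mem hmem hpx
      rwa [sub_sub_cancel] at this
    let y : Frame := ⟨(N, 0, p), hpN⟩
    have hequiv : x.Equiv y := by
      refine ⟨⟨γ, rfl⟩, -x.p₁, ?_, ?_⟩
      · change (0 : Fin 2 → ℝ) - (x.p₁ + -x.p₁) ∈ _
        simp [zero_mem]
      · change p - (x.p₂ + -x.p₁) ∈ _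
        rwa [← sub_eq_add_neg]
    refine ⟨y, ⟨hγ, rfl, ?_, fun n => ?_⟩, (Quotient.sound hequiv).symm⟩
    · change ‖p‖ ≤ 2 * B
      rw [pi_norm_le_iff_of_nonneg (by positivity)]
      intro i
      simp only [hp, Matrix.mulVec, dotProduct, Fin.sum_univ_two, Real.norm_eq_abs]
      refine (abs_add_le _ _).trans ?_
      rw [abs_mul, abs_mul, abs_of_nonneg (Int.fract_nonneg (u 0)),
        abs_of_nonneg (Int.fract_nonneg (u 1))]
      have h0 := hγ i 0
      have h1 := hγ i 1
      have f0 := (Int.fract_lt_one (u 0)).le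
      have f1 := (Int.fract_lt_one (u 1)).le
      have g0 := mul_le_of_le_one_right (abs_nonneg (N.1 i 0)) f0
      have g1 := mul_le_of_le_one_right (abs_nonneg (N.1 i 1)) f1
      linarith
    · refine hx.trans (Frame.systole_le_norm ?_)
      rw [← holonomies_eq_of_equiv hequiv]
      refine Or.inr ⟨-n, ?_⟩
      change y.p₂ - y.p₁ - N.1 *ᵥ _ - (y.p₂ - y.p₁) = N.1 *ᵥ _
      have : (fun i => ((-n) i : ℝ)) = -(fun i => (n i : ℝ)) := by ext i; simp
      rw [this, Matrix.mulVec_neg]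
      abel

/-! ### Recurrence -/

/-- The excess of the systole over `ε`, a compactly supported function. -/
def systoleExcess {ε : ℝ} (hε : 0 < ε) : C_c(M12, ℝ) where
  toFun Y := max 0 (Y.systole - ε)
  continuous_toFun := continuous_const.max (M12.continuous_systole.sub continuous_const)
  hasCompactSupport' := by
    obtain ⟨K, hK, hsub⟩ := exists_isCompact_systole_ge hε
    refine hK.of_isClosed_subset (isClosed_tsupport _) (Set.Subset.trans ?_ hsub)
    refine closure_minimal (fun Y hY => ?_) (isClosed_le continuous_const M12.continuous_systole)
    by_contra hlt
    apply hY
    simp only [Set.mem_ofPred_eq, not_le] at hlt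
    exact max_eq_left (by linarith)

theorem systoleExcess_apply {ε : ℝ} (hε : 0 < ε) (Y : M12) :
    systoleExcess hε Y = max 0 (Y.systole - ε) := rfl

theorem exists_integral_systoleExcess_pos {ν : Measure M12} [IsFiniteMeasureOnCompacts ν]
    (hν : ν ≠ 0) : ∃ (ε : ℝ) (hε : 0 < ε), 0 < ∫ Y, systoleExcess hε Y ∂ν := by
  have hcover : (Set.univ : Set M12) = ⋃ n : ℕ, {Y : M12 | 1 / ((n : ℝ) + 1) < Y.systole} := by
    refine (Set.eq_univ_of_forall fun Y => ?_).symm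
    obtain ⟨n, hn⟩ := exists_nat_one_div_lt Y.systole_pos
    exact Set.mem_iUnion.2 ⟨n, hn⟩
  have hne : ν Set.univ ≠ 0 := by simpa using hν
  obtain ⟨n, hn⟩ : ∃ n : ℕ, ν {Y : M12 | 1 / ((n : ℝ) + 1) < Y.systole} ≠ 0 := by
    by_contra! hall
    rw [hcover] at hne
    exact hne (measure_iUnion_null hall)
  have hε : (0 : ℝ) < 1 / ((n : ℝ) + 1) := by positivity
  refine ⟨_, hε, ?_⟩
  rw [integral_pos_iff_support_of_nonneg (f := fun Y => systoleExcess hε Y)]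
  · refine lt_of_lt_of_le (pos_iff_ne_zero.2 hn) (measure_mono fun Y hY => ?_)
    rw [Function.mem_support, systoleExcess_apply]
    have : 0 < Y.systole - 1 / ((n : ℝ) + 1) := sub_pos.2 hY
    rw [max_eq_right this.le]
    exact this.ne'
  · exact fun Y => le_max_left _ _
  · exact (systoleExcess hε).continuous.integrable_of_hasCompactSupport
      (systoleExcess hε).hasCompactSupport

theorem exists_recurrence {X : M12} {ν : Measure M12} [IsFiniteMeasureOnCompacts ν]
    (hlim : IsWeakStarLimit X ν) (hν : ν ≠ 0) :
    ∃ ε > 0, ∃ δ > 0, ∀ T₀ : ℝ, ∃ S > T₀,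
      δ * S ≤ volume.real {t ∈ Set.Ioc 0 S | ε ≤ (M12.act (geodesic t) X).systole} := by
  obtain ⟨ε, hε, hpos⟩ := exists_integral_systoleExcess_pos hν
  set f := systoleExcess hε with hf
  obtain ⟨F, hF⟩ := f.continuous.bounded_above_of_compact_support f.hasCompactSupport
  have hF0 : 0 < max F 1 := lt_max_of_lt_right one_pos
  obtain ⟨s, hs, hconv⟩ := hlim
  set J := ∫ Y, f Y ∂ν with hJ
  refine ⟨ε, hε, J / 2 / max F 1, by positivity, fun T₀ => ?_⟩
  obtain ⟨n, hn1, hn2⟩ := ((hs.eventually_gt_atTop (max T₀ 0)).and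
    ((hconv f).eventually_const_lt (show J / 2 < J by linarith))).exists
  have hS : 0 < s n := (le_max_right _ _).trans_lt hn1
  refine ⟨s n, (le_max_left _ _).trans_lt hn1, ?_⟩
  rw [integral_empiricalMeasure X hS, intervalIntegral.integral_of_le hS.le] at hn2
  set E : Set ℝ := {t | ε ≤ (M12.act (geodesic t) X).systole} with hE
  have hcont := M12.continuous_systole.comp (continuous_geodesic_act X)
  have hEm : MeasurableSet E := (isClosed_le continuous_const hcont).measurableSet
  have hle : ∫ t in Set.Ioc 0 (s n), f (M12.act (geodesic t) X) ≤
      ∫ t in Set.Ioc 0 (s n), E.indicator (fun _ => max F 1) t := by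
    refine integral_mono ?_ ?_ fun t => ?_
    · exact ((f.continuous.comp (continuous_geodesic_act X)).integrableOn_Icc).mono_set
        Set.Ioc_subset_Icc_self
    · exact (integrable_const _).indicator hEm
    · by_cases ht : t ∈ E
      · rw [Set.indicator_of_mem ht]
        exact (le_abs_self _).trans ((hF _).trans (le_max_left _ _))
      · rw [Set.indicator_of_notMem ht]
        simp only [hE, Set.mem_ofPred_eq, not_le] at ht
        exact (max_eq_left (by linarith)).le
  rw [setIntegral_indicator hEm, setIntegral_const, smul_eq_mul] at hle
  have hset : {t ∈ Set.Ioc 0 (s n) | ε ≤ (M12.act (geodesic t) X).systole} =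
      Set.Ioc 0 (s n) ∩ E := rfl
  rw [hset, div_mul_eq_mul_div, div_le_iff₀ hF0]
  rw [one_div, inv_mul_eq_div, lt_div_iff₀ hS] at hn2
  exact hn2.le.trans hle

/-! ### The holonomies along the geodesic -/

theorem loop_mem_holonomies (I : ThreeIET) (t : ℝ) {m n : ℤ} (h : m ≠ 0 ∨ n ≠ 0) :
    ![Real.exp t * (m - n * I.α), Real.exp (-t) * n] ∈
      holonomies (Frame.act (geodesic t) I.frame) := by
  have hv : ![Real.exp t * (m - n * I.α), Real.exp (-t) * n] =
      (Frame.act (geodesic t) I.frame).basis.1 *ᵥ (fun i => ((![m, n] : Fin 2 → ℤ) i : ℝ)) := by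
    change _ = ((geodesic t).1 * I.frame.basis.1) *ᵥ _
    ext i
    fin_cases i <;>
      simp [geodesic, ThreeIET.frame, Frame.basis, Matrix.mulVec, dotProduct, Fin.sum_univ_two,
        Matrix.mul_apply] <;> ring
  left
  refine ⟨⟨_, hv⟩, ?_⟩
  rw [hv]
  refine mulVec_intCast_ne_zero _ fun h0 => ?_
  have h1 := congrFun h0 0
  have h2 := congrFun h0 1
  simp at h1 h2
  rcases h with h | h
  · exact h h1
  · exact h h2

theorem path_mem_holonomies (I : ThreeIET) (t : ℝ) (m n : ℤ) :
    ![Real.exp t * (I.z + m - n * I.α), Real.exp (-t) * n] ∈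
      holonomies (Frame.act (geodesic t) I.frame) := by
  right
  refine ⟨![m, n], ?_⟩
  change _ - ((geodesic t).1 *ᵥ I.frame.p₂ - (geodesic t).1 *ᵥ I.frame.p₁) =
    ((geodesic t).1 * I.frame.basis.1) *ᵥ _
  ext i
  fin_cases i <;>
    simp [geodesic, ThreeIET.frame, Frame.basis, Frame.p₁, Frame.p₂, Matrix.mulVec, dotProduct,
      Fin.sum_univ_two, Matrix.mul_apply] <;> ring

theorem norm_vecCons (a b : ℝ) : ‖![a, b]‖ = max |a| |b| := by
  simp [Pi.norm_def, Fin.univ_succ]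

/-- `t` is a time at which the loops and the paths between the marked points have length at least
`ε`. -/
def IsThick (I : ThreeIET) (ε t : ℝ) : Prop :=
  (∀ m n : ℤ, (m ≠ 0 ∨ n ≠ 0) → ε ≤ max (Real.exp t * |m - n * I.α|) (Real.exp (-t) * |(n : ℝ)|)) ∧
  ∀ m n : ℤ, ε ≤ max (Real.exp t * |I.z + m - n * I.α|) (Real.exp (-t) * |(n : ℝ)|)

theorem isThick_of_le_systole (I : ThreeIET) {ε t : ℝ}
    (h : ε ≤ (M12.act (geodesic t) I.torus).systole) : IsThick I ε t := by
  have h' : ε ≤ (Frame.act (geodesic t) I.frame).systole := h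
  refine ⟨fun m n hmn => ?_, fun m n => ?_⟩
  · have := h'.trans (Frame.systole_le_norm (loop_mem_holonomies I t hmn))
    rwa [norm_vecCons, abs_mul, abs_mul, Real.abs_exp, Real.abs_exp] at this
  · have := h'.trans (Frame.systole_le_norm (path_mem_holonomies I t m n))
    rwa [norm_vecCons, abs_mul, abs_mul, Real.abs_exp, Real.abs_exp] at this

theorem irrational_of_isThick (I : ThreeIET) {ε : ℝ} (hε : 0 < ε)
    (h : ∀ T₀ : ℝ, ∃ t > T₀, IsThick I ε t) : Irrational I.α := by
  rintro ⟨r, hr⟩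
  have hd : (0 : ℝ) < r.den := by exact_mod_cast r.den_pos
  obtain ⟨t, ht, hthick⟩ := h (Real.log (r.den / ε))
  have h1 := hthick.1 r.num r.den (Or.inr (by exact_mod_cast r.den_ne_zero))
  have h2 : ((r.num : ℤ) : ℝ) - ((r.den : ℤ) : ℝ) * I.α = 0 := by
    rw [← hr, Int.cast_natCast]
    have := Rat.den_mul_eq_num r
    have h3 : ((r.den : ℝ)) * (r : ℝ) = r.num := by exact_mod_cast this
    linarith
  rw [h2, abs_zero, mul_zero, max_eq_right (by positivity), Int.cast_natCast,
    abs_of_pos hd] at h1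
  rw [gt_iff_lt, Real.log_lt_iff_lt_exp (by positivity), div_lt_iff₀ hε] at ht
  rw [Real.exp_neg, inv_mul_eq_div, le_div_iff₀ (Real.exp_pos t)] at h1
  linarith

section

/-- The arithmetic of the convergents `P k / q k` of an irrational number `α`, with partial
quotients `a k` and errors `d k = |q k * α - P k|`. -/
structure ContFracData (α : ℝ) (q a : ℕ → ℕ) (P : ℕ → ℤ) (d : ℕ → ℝ) : Prop where
  q_zero : q 0 = 1
  q_one : q 1 = a 1
  a_pos : ∀ k, 1 ≤ a (k + 1)
  q_add_two : ∀ k, q (k + 2) = a (k + 2) * q (k + 1) + q k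
  d_pos : ∀ k, 0 < d k
  d_eq : ∀ k, d k = a (k + 2) * d (k + 1) + d (k + 2)
  mul_sub : ∀ k, q k * α - P k = (-1) ^ k * d k
  q_mul_d : ∀ k, q (k + 1) * d k + q k * d (k + 1) = 1
  det : ∀ k, (q k : ℤ) * P (k + 1) - q (k + 1) * P k = (-1) ^ k

section Existence

open GenContFract

theorem exists_get?_of_irrational {α : ℝ} (hα : Irrational α) (n : ℕ) :
    ∃ b : ℕ, 1 ≤ b ∧ (GenContFract.of α).s.get? n = some ⟨1, (b : ℝ)⟩ := by
  have hnt : ¬ (GenContFract.of α).Terminates := by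
    rw [terminates_iff_rat]
    rintro ⟨r, hr⟩
    exact hα ⟨r, hr.symm⟩
  have hn : (GenContFract.of α).s.get? n ≠ none := fun h => hnt ⟨n, h⟩
  obtain ⟨gp, hgp⟩ := Option.ne_none_iff_exists'.1 hn
  obtain ⟨h1, z, hz⟩ := of_partNum_eq_one_and_exists_int_partDen_eq hgp
  have hle : (1 : ℝ) ≤ gp.b := of_one_le_get?_partDen (partDen_eq_s_b hgp)
  have hz1 : (1 : ℤ) ≤ z := by rw [hz] at hle; exact_mod_cast hle
  refine ⟨z.toNat, by omega, ?_⟩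
  rw [hgp]
  congr 1
  have : ((z.toNat : ℕ) : ℝ) = (z : ℝ) := by
    have : ((z.toNat : ℕ) : ℤ) = z := Int.toNat_of_nonneg (by omega)
    exact_mod_cast this
  rw [this, ← hz, ← h1]

theorem neg_one_pow_mul_sub_convs_pos {α : ℝ} (hα : Irrational α) (n : ℕ)
    (hden : 0 < (GenContFract.of α).dens n) :
    0 < (-1) ^ n * (α - (GenContFract.of α).convs n) := by
  have hstream : ∃ ifp, IntFractPair.stream α n = some ifp := by
    rcases n with _ | n
    · exact ⟨_, rfl⟩
    · obtain ⟨b, -, hb⟩ := exists_get?_of_irrational hα n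
      obtain ⟨ifp, h, -⟩ := IntFractPair.exists_succ_get?_stream_of_gcf_of_get?_eq_some hb
      exact ⟨ifp, h⟩
  obtain ⟨ifp, hifp⟩ := hstream
  have hne : α - (GenContFract.of α).convs n ≠ 0 := by
    obtain ⟨r, hr⟩ := exists_rat_eq_nth_conv α n
    rw [hr, sub_ne_zero]
    exact fun h => hα ⟨r, h.symm⟩
  have hsub := sub_convs_eq hifp
  simp only at hsub
  have hfr : ifp.fr ≠ 0 := by
    intro h
    rw [if_pos h] at hsub
    exact hne hsub
  rw [if_neg hfr] at hsub
  have hfr0 : 0 < ifp.fr := lt_of_le_of_ne (IntFractPair.nth_stream_fr_nonneg hifp) hfr.symm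
  have hB : 0 < ((GenContFract.of α).contsAux (n + 1)).b := hden
  have hpB : 0 ≤ ((GenContFract.of α).contsAux n).b := zero_le_of_contsAux_b
  rw [hsub, mul_div_assoc', ← mul_pow]
  norm_num
  positivity

theorem exists_contFracData (I : ThreeIET) (hα : Irrational I.α) :
    ∃ (q a : ℕ → ℕ) (P : ℕ → ℤ) (d : ℕ → ℝ), ContFracData I.α q a P d ∧
      (∀ k, I.q k = q k) ∧ ∀ k, I.a (k + 1) = a (k + 1) := by
  choose b hb1 hb using exists_get?_of_irrational hα
  set g := GenContFract.of I.α with hg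
  let a : ℕ → ℕ := fun k => b (k - 1)
  let qp : ℕ → ℕ × ℕ := fun k => Nat.rec (1, b 0) (fun k x => (x.2, b (k + 1) * x.2 + x.1)) k
  let Pp : ℕ → ℤ × ℤ := fun k => Nat.rec (⌊I.α⌋, b 0 * ⌊I.α⌋ + 1)
    (fun k x => (x.2, b (k + 1) * x.2 + x.1)) k
  let q : ℕ → ℕ := fun k => (qp k).1
  let P : ℕ → ℤ := fun k => (Pp k).1
  have q2 : ∀ k, q (k + 2) = b (k + 1) * q (k + 1) + q k := fun k => rfl
  have P2 : ∀ k, P (k + 2) = b (k + 1) * P (k + 1) + P k := fun k => rfl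
  have hq : ∀ k, g.dens k = q k ∧ g.dens (k + 1) = q (k + 1) := by
    intro k
    induction k with
    | zero => exact ⟨by simp [q, qp], by rw [first_den_eq (hb 0)]; rfl⟩
    | succ k ih =>
      refine ⟨ih.2, ?_⟩
      rw [dens_recurrence (hb (k + 1)) ih.1 ih.2, q2]
      push_cast
      ring
  have hP : ∀ k, g.nums k = P k ∧ g.nums (k + 1) = P (k + 1) := by
    intro k
    induction k with
    | zero =>
      refine ⟨by simp [P, Pp, hg, of_h_eq_floor], ?_⟩
      rw [first_num_eq (hb 0), hg, of_h_eq_floor]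
      simp [P, Pp]
    | succ k ih =>
      refine ⟨ih.2, ?_⟩
      rw [nums_recurrence (hb (k + 1)) ih.1 ih.2, P2]
      push_cast
      ring
  have hqpos : ∀ k, 0 < q k ∧ 0 < q (k + 1) := by
    intro k
    induction k with
    | zero => exact ⟨one_pos, hb1 0⟩
    | succ k ih => exact ⟨ih.2, by rw [q2]; have := ih.1; omega⟩
  have hdet : ∀ k, (q k : ℤ) * P (k + 1) - q (k + 1) * P k = (-1) ^ k := by
    intro k
    induction k with
    | zero => simp [q, qp, P, Pp]
    | succ k ih =>
      rw [P2, q2]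
      push_cast
      rw [pow_succ]
      linear_combination -ih
  let d : ℕ → ℝ := fun k => (-1) ^ k * (q k * I.α - P k)
  have hd : ∀ k, 0 < d k := by
    intro k
    have hqk : (0 : ℝ) < q k := by exact_mod_cast (hqpos k).1
    have h := neg_one_pow_mul_sub_convs_pos hα k (by rw [← hg, (hq k).1]; exact hqk)
    rw [conv_eq_num_div_den, ← hg, (hq k).1, (hP k).1] at h
    have := mul_pos hqk h
    have e : (q k : ℝ) * ((-1) ^ k * (I.α - P k / q k)) = d k := by
      simp only [d]
      field_simp
    rwa [e] at this
  have hsq : ∀ k : ℕ, ((-1 : ℝ)) ^ k * (-1) ^ k = 1 := fun k => by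
    rw [← mul_pow]; norm_num
  refine ⟨q, a, P, d, ⟨rfl, rfl, fun k => hb1 k, q2, hd, fun k => ?_, fun k => ?_, fun k => ?_,
    hdet⟩, fun k => (hq k).1, fun k => ?_⟩
  · simp only [d, q2, P2, a, show k + 2 - 1 = k + 1 from rfl]
    push_cast
    ring
  · simp only [d]
    rw [← mul_assoc, hsq, one_mul]
  · have := congrArg (fun x : ℤ => (x : ℝ)) (hdet k)
    push_cast at this
    have h2 := hsq k
    simp only [d]
    rw [pow_succ]
    linear_combination (-1 : ℝ) ^ k * this + h2
  · simp [ThreeIET.a, partDen_eq_s_b (hb k), ← hg, a]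

end Existence

namespace ContFracData

variable {α : ℝ} {q a : ℕ → ℕ} {P : ℕ → ℤ} {d : ℕ → ℝ}

theorem q_pos (h : ContFracData α q a P d) (k : ℕ) : 0 < q k := by
  induction k using Nat.strong_induction_on with
  | _ k ih =>
    match k with
    | 0 => simp [h.q_zero]
    | 1 => rw [h.q_one]; exact h.a_pos 0
    | k + 2 => rw [h.q_add_two]; have := ih k (by omega); omega

theorem q_le_a_mul_q (h : ContFracData α q a P d) (k : ℕ) :
    q (k + 1) ≤ a (k + 2) * q (k + 1) :=
  Nat.le_mul_of_pos_left _ (h.a_pos (k + 1))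

theorem q_le_succ (h : ContFracData α q a P d) (k : ℕ) : q k ≤ q (k + 1) := by
  rcases k with _ | k
  · rw [h.q_zero]; exact h.q_pos 1
  · rw [h.q_add_two]
    have := h.q_le_a_mul_q k
    omega

theorem q_mono (h : ContFracData α q a P d) : Monotone q := monotone_nat_of_le_succ h.q_le_succ

theorem q_lt_succ (h : ContFracData α q a P d) {k : ℕ} (hk : 1 ≤ k) : q k < q (k + 1) := by
  obtain ⟨k, rfl⟩ := Nat.exists_eq_add_of_le' hk
  rw [h.q_add_two]
  have := h.q_le_a_mul_q k
  have := h.q_pos k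
  omega

theorem a_mul_q_le (h : ContFracData α q a P d) (k : ℕ) : a (k + 1) * q k ≤ q (k + 1) := by
  rcases k with _ | k
  · simp [h.q_zero, h.q_one]
  · rw [h.q_add_two]; exact Nat.le_add_right _ _

theorem a_mul_q_lt (h : ContFracData α q a P d) {k : ℕ} (hk : 1 ≤ k) :
    a (k + 1) * q k < q (k + 1) := by
  obtain ⟨k, rfl⟩ := Nat.exists_eq_add_of_le' hk
  rw [h.q_add_two]
  exact Nat.lt_add_of_pos_right (h.q_pos k)

theorem q_succ_le (h : ContFracData α q a P d) (k : ℕ) : q (k + 1) ≤ (a (k + 1) + 1) * q k := by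
  rcases k with _ | k
  · simp [h.q_zero, h.q_one]
  · rw [h.q_add_two, add_mul, one_mul]
    exact Nat.add_le_add_left (h.q_le_succ k) _

theorem two_mul_q_le (h : ContFracData α q a P d) (k : ℕ) : 2 * q k ≤ q (k + 2) := by
  rw [h.q_add_two]
  have := h.q_le_a_mul_q k
  have := h.q_le_succ k
  omega

theorem two_mul_q_lt (h : ContFracData α q a P d) {k : ℕ} (hk : 1 ≤ k) : 2 * q k < q (k + 2) := by
  rw [h.q_add_two]
  have := h.q_le_a_mul_q k
  have := h.q_lt_succ hk
  omega

theorem two_pow_mul_q_le (h : ContFracData α q a P d) (k n : ℕ) :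
    2 ^ n * q k ≤ q (k + 2 * n) := by
  induction n with
  | zero => simp
  | succ n ih =>
    have := h.two_mul_q_le (k + 2 * n)
    rw [pow_succ, show k + 2 * (n + 1) = k + 2 * n + 2 by ring]
    linarith

theorem le_q (h : ContFracData α q a P d) (k : ℕ) : k ≤ q k := by
  induction k with
  | zero => omega
  | succ k ih =>
    rcases Nat.eq_zero_or_pos k with rfl | hk
    · exact h.q_pos 1
    · have := h.q_lt_succ hk
      omega

theorem q_add_le (h : ContFracData α q a P d) {C : ℝ} (k n : ℕ)
    (hC : ∀ j, k < j → j ≤ k + n → (a j : ℝ) ≤ C) : (q (k + n) : ℝ) ≤ (C + 1) ^ n * q k := by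
  induction n with
  | zero => simp
  | succ n ih =>
    have h1 := ih fun j hj hj' => hC j hj (by omega)
    have h2 : (q (k + n + 1) : ℝ) ≤ (a (k + n + 1) + 1) * q (k + n) := by
      exact_mod_cast h.q_succ_le (k + n)
    have h3 := hC (k + n + 1) (by omega) (by omega)
    have h4 : (0 : ℝ) ≤ a (k + n + 1) := Nat.cast_nonneg _
    calc (q (k + (n + 1)) : ℝ) ≤ (a (k + n + 1) + 1) * q (k + n) := h2
      _ ≤ (C + 1) * ((C + 1) ^ n * q k) := by gcongr; linarith
      _ = _ := by ring

theorem d_succ_lt (h : ContFracData α q a P d) (k : ℕ) : d (k + 1) < d k := by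
  have h1 := h.d_eq k
  have h2 := h.d_pos (k + 2)
  have h3 := h.d_pos (k + 1)
  have h4 : (1 : ℝ) ≤ a (k + 2) := by exact_mod_cast h.a_pos (k + 1)
  nlinarith

theorem d_anti (h : ContFracData α q a P d) : Antitone d :=
  antitone_nat_of_succ_le fun k => (h.d_succ_lt k).le

theorem q_succ_mul_d_lt (h : ContFracData α q a P d) (k : ℕ) : q (k + 1) * d k < 1 := by
  have h1 := h.q_mul_d k
  have h2 := h.d_pos (k + 1)
  have h3 : (0 : ℝ) < q k := by exact_mod_cast h.q_pos k
  nlinarith [mul_pos h3 h2]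

theorem one_le_mul_q_mul_d (h : ContFracData α q a P d) (k : ℕ) :
    1 ≤ (a (k + 1) + 2) * (q k * d k) := by
  have h1 := h.q_mul_d k
  have h2 := h.d_pos k
  have h3 : (0 : ℝ) < q k := by exact_mod_cast h.q_pos k
  have h4 : (q (k + 1) : ℝ) ≤ (a (k + 1) + 1) * q k := by exact_mod_cast h.q_succ_le k
  have h5 := (h.d_succ_lt k).le
  nlinarith [mul_le_mul_of_nonneg_right h4 h2.le, mul_le_mul_of_nonneg_left h5 h3.le]

theorem coprime_q (h : ContFracData α q a P d) (k : ℕ) : Nat.Coprime (q k) (q (k + 1)) := by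
  have hdet := h.det k
  rw [← Nat.isCoprime_iff_coprime]
  rcases neg_one_pow_eq_or ℤ k with e | e <;> rw [e] at hdet
  · exact ⟨P (k + 1), -P k, by linarith⟩
  · exact ⟨-P (k + 1), P k, by linarith⟩

/-- The convergents are best approximations. -/
theorem d_le_abs (h : ContFracData α q a P d) (k : ℕ) {n m : ℤ} (hn : n ≠ 0)
    (hn' : |n| < q (k + 1)) : d k ≤ |n * α - m| := by
  have hdet := h.det k
  have hsq : ((-1 : ℤ)) ^ k * (-1) ^ k = 1 := by rw [← mul_pow]; norm_num
  set x : ℤ := (-1) ^ k * (n * P (k + 1) - q (k + 1) * m) with hx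
  set y : ℤ := (-1) ^ k * (q k * m - n * P k) with hy
  have hnx : n = x * q k + y * q (k + 1) := by
    rw [hx, hy]
    linear_combination (-n * (-1) ^ k) * hdet - n * hsq
  have hmx : m = x * P k + y * P (k + 1) := by
    rw [hx, hy]
    linear_combination (-m * (-1) ^ k) * hdet - m * hsq
  have hval : (n : ℝ) * α - m = (-1) ^ k * (x * d k - y * d (k + 1)) := by
    have h1 := h.mul_sub k
    have h2 := h.mul_sub (k + 1)
    have hn2 : (n : ℝ) = x * q k + y * q (k + 1) := by exact_mod_cast hnx
    have hm2 : (m : ℝ) = x * P k + y * P (k + 1) := by exact_mod_cast hmx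
    rw [hn2, hm2]
    rw [pow_succ] at h2
    linear_combination (x : ℝ) * h1 + y * h2
  have habs : |(n : ℝ) * α - m| = |x * d k - y * d (k + 1)| := by
    rw [hval, abs_mul, abs_pow, abs_neg, abs_one, one_pow, one_mul]
  rw [habs]
  have hd := h.d_pos k
  have hd' := h.d_pos (k + 1)
  have hqk : (0 : ℤ) < q k := by exact_mod_cast h.q_pos k
  have hqk' : (0 : ℤ) < q (k + 1) := by exact_mod_cast h.q_pos (k + 1)
  clear_value x y
  rw [abs_lt] at hn'
  rcases lt_trichotomy x 0 with hx0 | hx0 | hx0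
  · have hy0 : 0 ≤ y := by
      by_contra! hy0
      nlinarith
    have hx1 : (x : ℝ) ≤ -1 := by exact_mod_cast (by omega : x ≤ -1)
    have hy1 : (0 : ℝ) ≤ y := by exact_mod_cast hy0
    refine le_trans ?_ (neg_le_abs _)
    nlinarith [mul_nonneg hy1 hd'.le]
  · exfalso
    rw [hx0] at hnx
    have hy0 : y ≠ 0 := by
      rintro rfl
      simp at hnx
      exact hn hnx
    rcases lt_or_gt_of_ne hy0 with h0 | h0 <;> nlinarith
  · have hy0 : y ≤ 0 := by
      by_contra! hy0
      nlinarith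
    have hx1 : (1 : ℝ) ≤ x := by exact_mod_cast (by omega : 1 ≤ x)
    have hy1 : (y : ℝ) ≤ 0 := by exact_mod_cast hy0
    refine le_trans ?_ (le_abs_self _)
    nlinarith [mul_nonneg_of_nonpos_of_nonpos hy1 (neg_nonpos.2 hd'.le)]

end ContFracData

end

/-! ### Counting visits of a rotation orbit to an interval -/

/-- The number of `0 ≤ j < L` such that `x + j β` lies in `[0, z)` modulo `1`. -/
def hits (β z : ℝ) (L : ℕ) (x : ℝ) : ℤ :=
  ∑ j ∈ Finset.range L, (⌊x + j * β⌋ - ⌊x + j * β - z⌋)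

theorem floor_sub_floor_sub {s : ℝ} (hs0 : 0 ≤ s) (hs1 : s ≤ 1) (y : ℝ) :
    ⌊y⌋ - ⌊y - s⌋ = if Int.fract y < s then 1 else 0 := by
  have h0 := Int.fract_nonneg y
  have h1 := Int.fract_lt_one y
  have hy := Int.self_sub_floor y
  split_ifs with h
  · have : ⌊y - s⌋ = ⌊y⌋ - 1 := by
      rw [Int.floor_eq_iff]; push_cast; constructor <;> linarith
    omega
  · have : ⌊y - s⌋ = ⌊y⌋ := by
      rw [Int.floor_eq_iff]; constructor <;> linarith
    omega

theorem floor_sub_floor_add {s δ : ℝ} (hs0 : 0 ≤ s) (hsδ : s ≤ δ) (hδ : δ ≤ 1) (y : ℝ) :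
    ⌊y⌋ - ⌊y + δ - s⌋ =
      if s ≤ Int.fract (y + δ) ∧ Int.fract (y + δ) < δ then -1 else 0 := by
  have h1 := floor_sub_floor_sub hs0 (hsδ.trans hδ) (y + δ)
  have h2 := floor_sub_floor_sub (hs0.trans hsδ) hδ (y + δ)
  rw [add_sub_cancel_right] at h2
  split_ifs at h1 h2 ⊢ <;> first | omega | (exfalso; grind)

theorem hits_add_intCast (β z : ℝ) (L : ℕ) (x : ℝ) (n : ℤ) :
    hits β z L (x + n) = hits β z L x := by
  refine Finset.sum_congr rfl fun j _ => ?_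
  rw [show x + n + j * β = x + j * β + n by ring,
    show x + j * β + n - z = x + j * β - z + n by ring, Int.floor_add_intCast,
    Int.floor_add_intCast]
  ring

theorem hits_add (β z : ℝ) (L K : ℕ) (x : ℝ) :
    hits β z (L + K) x = hits β z L x + hits β z K (x + L * β) := by
  rw [hits, Finset.sum_range_add, hits, hits]
  congr 1
  refine Finset.sum_congr rfl fun j _ => ?_
  push_cast
  rw [show x + (L + j) * β = x + L * β + j * β by ring]

theorem hits_mul {β z δ : ℝ} {q : ℕ} {N : ℤ} (hN : q * β = N + δ) (p : ℕ) (x : ℝ) :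
    hits β z (p * q) x = ∑ r ∈ Finset.range p, hits β z q (x + r * δ) := by
  induction p with
  | zero => simp [hits]
  | succ p ih =>
    rw [Finset.sum_range_succ, ← ih, add_mul, one_mul, hits_add]
    congr 1
    rw [← hits_add_intCast β z q (x + p * δ) (p * N)]
    congr 1
    push_cast
    linear_combination (p : ℝ) * hN

theorem hits_neg (β z : ℝ) (L : ℕ) (x : ℝ) :
    hits (-β) z L (x + (L - 1) * β) = hits β z L x := by
  unfold hits
  rw [← Finset.sum_range_reflect]
  refine Finset.sum_congr rfl fun j hj => ?_
  have hj' := Finset.mem_range.1 hj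
  have : ((L - 1 - j : ℕ) : ℝ) = L - 1 - j := by
    rw [Nat.cast_sub (by omega), Nat.cast_sub (by omega)]; simp
  rw [this, show x + (L - 1) * β + (L - 1 - j) * -β = x + j * β by ring]

theorem measurable_hits (β z : ℝ) (L : ℕ) : Measurable (hits β z L) := by
  unfold hits
  fun_prop

theorem iterate_succ_rotation (α x : ℝ) (j : ℕ) :
    (rotation α)^[j + 1] x = Int.fract (x + (j + 1) * α) := by
  induction j with
  | zero => simp [rotation]
  | succ j ih =>
    rw [Function.iterate_succ_apply', ih, rotation, Int.fract_eq_fract]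
    refine ⟨-⌊x + (j + 1) * α⌋, ?_⟩
    have := Int.self_sub_floor (x + (j + 1) * α)
    push_cast
    linarith

theorem iterate_rotation (α : ℝ) {x : ℝ} (hx : x ∈ Set.Ico (0 : ℝ) 1) (j : ℕ) :
    (rotation α)^[j] x = Int.fract (x + j * α) := by
  rcases j with _ | j
  · simp [Int.fract_eq_self.2 hx]
  · rw [iterate_succ_rotation]
    push_cast
    rfl

theorem ThreeIET.ψ_eq_hits (I : ThreeIET) (L : ℕ) {x : ℝ} (hx : x ∈ Set.Ico (0 : ℝ) 1) :
    (I.ψ L x : ℤ) = hits I.α I.z L x := by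
  unfold ThreeIET.ψ hits
  push_cast
  refine Finset.sum_congr rfl fun j _ => ?_
  rw [ThreeIET.R, iterate_rotation _ hx, floor_sub_floor_sub I.z_pos.le I.z_lt_one.le]
  by_cases h : Int.fract (x + j * I.α) < I.z
  · rw [if_pos h, Set.indicator_of_mem (show _ ∈ I.J from ⟨Int.fract_nonneg _, h⟩)]; rfl
  · rw [if_neg h, Set.indicator_of_notMem (fun h' => h h'.2)]; rfl

/-- The visits of an orbit, up to the reversal of time. -/
theorem ThreeIET.exists_ψ_eq_hits (I : ThreeIET) (v L : ℕ) :
    ∃ b : ℝ, ∀ x ∈ Set.Ico (0 : ℝ) 1, (I.ψ L x : ℤ) = hits ((-1) ^ v * I.α) I.z L (x + b) := by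
  rcases neg_one_pow_eq_or ℝ v with e | e <;> rw [e]
  · exact ⟨0, fun x hx => by rw [I.ψ_eq_hits L hx, one_mul, add_zero]⟩
  · exact ⟨(L - 1) * I.α, fun x hx => by rw [I.ψ_eq_hits L hx, neg_one_mul, hits_neg]⟩

theorem sum_range_shift {M : Type*} [AddCommMonoid M] (G : ℕ → M) {h q : ℕ} (hq : h ≤ q) :
    ∑ j ∈ Finset.range q, G (j + h) =
      ∑ e ∈ Finset.range q, if h ≤ e then G e else G (e + q) := by
  have h1 : ∑ j ∈ Finset.range q, G (j + h) =
      ∑ e ∈ Finset.Ico h q, G e + ∑ e ∈ Finset.range h, G (e + q) := by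
    have := Finset.sum_Ico_add' G 0 q h
    rw [Finset.range_eq_Ico, this, ← Finset.sum_Ico_consecutive G (by omega : 0 + h ≤ q)
      (by omega : q ≤ q + h), Finset.range_eq_Ico, Finset.sum_Ico_add' G 0 h q]
    simp [add_comm]
  rw [h1, Finset.range_eq_Ico, Finset.range_eq_Ico,
    ← Finset.sum_Ico_consecutive _ (Nat.zero_le h) hq, add_comm]
  congr 1
  · refine Finset.sum_congr rfl fun e he => ?_
    rw [if_neg (by have := (Finset.mem_Ico.1 he).2; omega)]
  · refine Finset.sum_congr rfl fun e he => ?_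
    rw [if_pos (Finset.mem_Ico.1 he).1]

theorem hits_eq_sum {β z s δ : ℝ} {q h : ℕ} {N m : ℤ} (hN : q * β = N + δ) (hq : h ≤ q)
    (hz : z = -(h * β) + s + m) (x : ℝ) :
    hits β z q x = m * q - N * h + ∑ e ∈ Finset.range q,
      if h ≤ e then ⌊x + e * β⌋ - ⌊x + e * β - s⌋ else ⌊x + e * β⌋ - ⌊x + e * β + δ - s⌋ := by
  have h1 : ∀ j : ℕ, ⌊x + j * β - z⌋ = ⌊x + ((j + h : ℕ) : ℝ) * β - s⌋ - m := by
    intro j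
    rw [← Int.floor_sub_intCast, hz]
    congr 1
    push_cast
    ring
  have h2 : ∀ e : ℕ, ⌊x + ((e + q : ℕ) : ℝ) * β - s⌋ = ⌊x + e * β + δ - s⌋ + N := by
    intro e
    rw [← Int.floor_add_intCast]
    congr 1
    push_cast
    linear_combination hN
  unfold hits
  simp only [h1]
  rw [Finset.sum_sub_distrib, Finset.sum_sub_distrib,
    sum_range_shift (fun j => ⌊x + (j : ℝ) * β - s⌋) hq]
  simp only [h2]
  have h3 : ∀ e : ℕ, (if h ≤ e then ⌊x + e * β⌋ - ⌊x + e * β - s⌋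
        else ⌊x + e * β⌋ - ⌊x + e * β + δ - s⌋) =
      ⌊x + e * β⌋ - (if h ≤ e then ⌊x + e * β - s⌋ else ⌊x + e * β + δ - s⌋ + N) +
        if h ≤ e then 0 else N := by
    intro e; split_ifs <;> ring
  simp only [h3]
  rw [Finset.sum_add_distrib, Finset.sum_sub_distrib]
  have h4 : ∑ e ∈ Finset.range q, (if h ≤ e then 0 else N) = N * h := by
    rw [Finset.range_eq_Ico, ← Finset.sum_Ico_consecutive _ (Nat.zero_le h) hq,
      Finset.sum_congr rfl (fun e he => if_neg (by have := (Finset.mem_Ico.1 he).2; omega)),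
      Finset.sum_congr (s₁ := Finset.Ico h q) rfl (fun e he => if_pos (Finset.mem_Ico.1 he).1)]
    simp [mul_comm]
  rw [h4]
  simp
  ring

/-! ### Two values or three -/

theorem fract_mul_sub {β x : ℝ} {e e' : ℝ} (h : Int.fract (x + e' * β) ≤ Int.fract (x + e * β)) :
    Int.fract ((e - e') * β) = Int.fract (x + e * β) - Int.fract (x + e' * β) := by
  rw [Int.fract_eq_iff]
  refine ⟨by linarith, ?_, ⌊x + e * β⌋ - ⌊x + e' * β⌋, ?_⟩
  · have := Int.fract_lt_one (x + e * β)
    have := Int.fract_nonneg (x + e' * β)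
    linarith
  · have h1 := Int.self_sub_floor (x + e * β)
    have h2 := Int.self_sub_floor (x + e' * β)
    push_cast
    linarith

/-- If two orbit points differ by less than the error `δ`, they coincide. -/
theorem eq_of_fract_lt {β δ x : ℝ} {K : ℕ}
    (hK : ∀ e : ℤ, e ≠ 0 → |e| < K → δ ≤ Int.fract (e * β)) {e e' : ℤ} (he : |e - e'| < K)
    (h : Int.fract (x + e * β) < δ) (h' : Int.fract (x + e' * β) < δ) : e = e' := by
  by_contra hne
  rcases le_total (Int.fract (x + e' * β)) (Int.fract (x + e * β)) with hle | hle
  · have h1 := hK (e - e') (sub_ne_zero.2 hne) he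
    push_cast at h1
    rw [fract_mul_sub hle] at h1
    have := Int.fract_nonneg (x + e' * β)
    linarith
  · have h1 := hK (e' - e) (sub_ne_zero.2 (Ne.symm hne)) (by rwa [abs_sub_comm])
    push_cast at h1
    rw [fract_mul_sub hle] at h1
    have := Int.fract_nonneg (x + e * β)
    linarith

theorem hits_two_values {β z δ : ℝ} {q h : ℕ} {N : ℤ} (hN : q * β = N + δ) (hδ : 0 < δ)
    (hq : h < q) (hK : ∀ e : ℤ, e ≠ 0 → |e| < q → δ < Int.fract (e * β))
    (hmin : ∀ h' < q, Int.fract (z + h * β) ≤ Int.fract (z + (h' : ℕ) * β))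
    (hs : δ < Int.fract (z + h * β)) :
    ∃ u : ℤ, ∀ x, hits β z q x = u ∨ hits β z q x = u + 1 := by
  set s := Int.fract (z + h * β) with hsdef
  have hs1 : s < 1 := Int.fract_lt_one _
  have hz : z = -(h * β) + s + ⌊z + h * β⌋ := by
    have := Int.self_sub_floor (z + h * β)
    linarith
  refine ⟨⌊z + h * β⌋ * q - N * h, fun x => ?_⟩
  rw [hits_eq_sum hN hq.le hz]
  -- the `e`-th term is the indicator of `fract (x + e β) < σ e`
  set σ : ℕ → ℝ := fun e => if h ≤ e then s else s - δ with hσ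
  have hterm : ∀ e : ℕ, (if h ≤ e then ⌊x + e * β⌋ - ⌊x + e * β - s⌋
      else ⌊x + e * β⌋ - ⌊x + e * β + δ - s⌋) = if Int.fract (x + e * β) < σ e then 1 else 0 := by
    intro e
    by_cases he : h ≤ e
    · simp only [hσ, if_pos he]
      exact floor_sub_floor_sub (by linarith) hs1.le _
    · simp only [hσ, if_neg he]
      rw [show x + e * β + δ - s = x + e * β - (s - δ) by ring]
      exact floor_sub_floor_sub (by linarith) (by linarith) _
  simp only [hterm]
  -- a translate of `z` closer to `0` than `s` contradicts minimality
  have hno : ∀ (h' : ℤ) (y : ℝ) (j : ℤ), 0 ≤ h' → h' < q → 0 ≤ y → y < s →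
      z + h' * β = y + j → False := by
    intro h' y j h0 h1 hy0 hys hy
    obtain ⟨n, rfl⟩ := Int.eq_ofNat_of_zero_le h0
    have hn := hmin n (by exact_mod_cast h1)
    have : Int.fract (z + (n : ℝ) * β) = y := by
      rw [Int.fract_eq_iff]
      exact ⟨hy0, by linarith, j, by push_cast at hy; linarith⟩
    linarith
  have huniq : ∀ e < q, ∀ e' < q, Int.fract (x + e * β) < σ e → Int.fract (x + e' * β) < σ e' →
      Int.fract (x + e' * β) ≤ Int.fract (x + e * β) → e = e' := by
    intro e he e' he' h1 _ hle
    by_contra hne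
    have hfr := fract_mul_sub hle
    set y := Int.fract ((e - e') * β) with hy
    have hyδ : δ < y := by
      have := hK ((e : ℤ) - e') (by omega) (by rw [abs_lt]; omega)
      push_cast at this
      exact this
    have hyσ : y < σ e := by
      have := Int.fract_nonneg (x + e' * β)
      linarith
    have hyself := Int.self_sub_floor (((e : ℝ) - e') * β)
    rw [← hy] at hyself
    have hzself := Int.self_sub_floor (z + h * β)
    rw [← hsdef] at hzself
    by_cases he0 : h ≤ e
    · simp only [hσ, if_pos he0] at hyσ
      by_cases h0 : 0 ≤ (h : ℤ) - e + e'
      · refine hno (h - e + e') (s - y) (⌊z + h * β⌋ - ⌊((e : ℝ) - e') * β⌋) h0 (by omega)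
          (by linarith) (by linarith) ?_
        push_cast
        linarith
      · refine hno (h - e + e' + q) (s - y + δ) (⌊z + h * β⌋ - ⌊((e : ℝ) - e') * β⌋ + N)
          (by omega) (by omega) (by linarith) (by linarith) ?_
        push_cast
        linarith
    · simp only [hσ, if_neg he0] at hyσ
      by_cases h0 : (h : ℤ) - e + e' < q
      · refine hno (h - e + e') (s - y) (⌊z + h * β⌋ - ⌊((e : ℝ) - e') * β⌋) (by omega) h0
          (by linarith) (by linarith) ?_
        push_cast
        linarith
      · refine hno (h - e + e' - q) (s - y - δ) (⌊z + h * β⌋ - ⌊((e : ℝ) - e') * β⌋ - N)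
          (by omega) (by omega) (by linarith) (by linarith) ?_
        push_cast
        linarith
  by_cases hex : ∃ e < q, Int.fract (x + e * β) < σ e
  · right
    obtain ⟨e, he, hlt⟩ := hex
    rw [Finset.sum_eq_single_of_mem e (Finset.mem_range.2 he), if_pos hlt]
    intro e' he' hne
    rw [if_neg]
    intro hlt'
    rcases le_total (Int.fract (x + e' * β)) (Int.fract (x + e * β)) with hle | hle
    · exact hne (huniq e he e' (Finset.mem_range.1 he') hlt hlt' hle).symm
    · exact hne (huniq e' (Finset.mem_range.1 he') e he hlt' hlt hle)
  · left
    push Not at hex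
    rw [Finset.sum_eq_zero, add_zero]
    intro e he
    rw [if_neg (not_lt.2 (hex e (Finset.mem_range.1 he)))]

theorem measurableSet_fract_mem (b s₁ s₂ : ℝ) :
    MeasurableSet {x ∈ Set.Ico (0 : ℝ) 1 | Int.fract (x + b) ∈ Set.Ico s₁ s₂} :=
  measurableSet_Ico.inter
    ((measurable_fract.comp (measurable_id.add_const b)) measurableSet_Ico)

theorem volume_ne_top_of_subset_Ico {S : Set ℝ} (hS : S ⊆ Set.Ico 0 1) : volume S ≠ ⊤ :=
  ((measure_mono hS).trans_lt (measure_Ico_lt_top (a := (0 : ℝ)) (b := 1))).ne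

theorem volume_fract_mem (b : ℝ) {s₁ s₂ : ℝ} (h₁ : 0 ≤ s₁) (h₁₂ : s₁ ≤ s₂) (h₂ : s₂ ≤ 1) :
    volume.real {x ∈ Set.Ico (0 : ℝ) 1 | Int.fract (x + b) ∈ Set.Ico s₁ s₂} = s₂ - s₁ := by
  set G : ℝ → ℝ := fun y => (Set.Ico s₁ s₂).indicator 1 (Int.fract y) with hG
  have hper : Function.Periodic G 1 := fun y => by simp [hG]
  have key : ∀ c : ℝ, volume.real {x ∈ Set.Ico (0 : ℝ) 1 | Int.fract (x + c) ∈ Set.Ico s₁ s₂} =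
      ∫ x in (0 : ℝ)..1, G (x + c) := by
    intro c
    rw [intervalIntegral.integral_of_le zero_le_one, integral_Ioc_eq_integral_Ioo,
      ← integral_Ico_eq_integral_Ioo]
    have : ∀ x : ℝ, G (x + c) =
        {x : ℝ | Int.fract (x + c) ∈ Set.Ico s₁ s₂}.indicator (fun _ => (1 : ℝ)) x := fun x => rfl
    simp only [this]
    have hm : MeasurableSet {x : ℝ | Int.fract (x + c) ∈ Set.Ico s₁ s₂} :=
      (measurable_fract.comp (measurable_id.add_const c)) measurableSet_Ico
    rw [setIntegral_indicator hm]
    rw [setIntegral_const, smul_eq_mul, mul_one]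
    rfl
  have hzero : {x ∈ Set.Ico (0 : ℝ) 1 | Int.fract (x + 0) ∈ Set.Ico s₁ s₂} = Set.Ico s₁ s₂ := by
    ext x
    simp only [Set.mem_ofPred_eq, add_zero]
    constructor
    · rintro ⟨hx, h⟩
      rwa [Int.fract_eq_self.2 hx] at h
    · intro h
      have hx : x ∈ Set.Ico (0 : ℝ) 1 := ⟨h₁.trans h.1, h.2.trans_le h₂⟩
      exact ⟨hx, by rwa [Int.fract_eq_self.2 hx]⟩
  have h0 := key 0
  rw [hzero, Real.volume_real_Ico_of_le h₁₂] at h0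
  rw [key b, intervalIntegral.integral_comp_add_right, h0]
  simp only [add_zero]
  have := hper.intervalIntegral_add_eq b 0
  rw [zero_add] at this
  rw [zero_add, add_comm 1 b, this]

theorem hits_three_values {β z δ s : ℝ} {q h p : ℕ} {N m : ℤ} (hN : q * β = N + δ)
    (hδ1 : δ ≤ 1) (hq : h < q) (hz : z = -(h * β) + s + m) (hs0 : 0 ≤ s) (hsδ : s ≤ δ)
    (hK : ∀ e : ℤ, e ≠ 0 → |e| < (p * q : ℕ) → δ ≤ Int.fract (e * β)) :
    ∃ u : ℤ, (∀ x, |hits β z (p * q) x - u| ≤ 1) ∧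
      ∀ b, volume.real {x ∈ Set.Ico (0 : ℝ) 1 | hits β z (p * q) (x + b) = u + 1} =
          p * ((q - h) * s) ∧
        volume.real {x ∈ Set.Ico (0 : ℝ) 1 | hits β z (p * q) (x + b) = u - 1} =
          p * (h * (δ - s)) := by
  set E : ℕ × ℕ → ℤ := fun i => if h ≤ i.2 then i.2 + i.1 * q else i.2 + (i.1 + 1) * q with hE
  set lo : ℕ × ℕ → ℝ := fun i => if h ≤ i.2 then 0 else s with hlo
  set hi : ℕ × ℕ → ℝ := fun i => if h ≤ i.2 then s else δ with hhi
  set A : ℕ × ℕ → Set ℝ := fun i => {x | Int.fract (x + E i * β) ∈ Set.Ico (lo i) (hi i)} with hA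
  set ι := Finset.range p ×ˢ Finset.range q with hι
  have hhiδ : ∀ i, hi i ≤ δ := fun i => by simp only [hhi]; split_ifs <;> linarith
  have hEinj : ∀ i ∈ ι, ∀ j ∈ ι, E i = E j → i = j := by
    rintro ⟨r, e⟩ hi ⟨r', e'⟩ hj heq
    simp only [hι, Finset.mem_product, Finset.mem_range] at hi hj
    simp only [hE] at heq
    have hmod : ∀ (a b : ℕ) (c d : ℤ), a < q → b < q → (a : ℤ) + c * q = b + d * q →
        a = b ∧ c = d := by
      intro a b c d ha hb hab
      have hcd : c = d := by
        by_contra hne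
        rcases lt_or_gt_of_ne hne with hlt | hlt
        · nlinarith
        · nlinarith
      subst hcd
      exact ⟨by omega, rfl⟩
    split_ifs at heq with h1 h2 h2
    · obtain ⟨h3, h4⟩ := hmod _ _ _ _ hi.2 hj.2 heq
      ext <;> simp <;> omega
    · obtain ⟨h3, h4⟩ := hmod _ _ _ _ hi.2 hj.2 heq
      omega
    · obtain ⟨h3, h4⟩ := hmod _ _ _ _ hi.2 hj.2 heq
      omega
    · obtain ⟨h3, h4⟩ := hmod _ _ _ _ hi.2 hj.2 heq
      ext <;> simp <;> omega
  have hEbd : ∀ i ∈ ι, (h : ℤ) ≤ E i ∧ E i < (p * q : ℕ) + h := by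
    rintro ⟨r, e⟩ hi
    simp only [hι, Finset.mem_product, Finset.mem_range] at hi
    have hr : ((r : ℤ) + 1) * q ≤ p * q :=
      mul_le_mul_of_nonneg_right (by exact_mod_cast hi.1) (by positivity)
    have hr0 : (0 : ℤ) ≤ r * q := by positivity
    simp only [hE]
    push_cast
    split_ifs with h1
    · constructor
      · have : (h : ℤ) ≤ e := by exact_mod_cast h1
        linarith
      · have : (e : ℤ) < q := by exact_mod_cast hi.2
        linarith
    · constructor
      · have : (h : ℤ) < q := by exact_mod_cast hq
        nlinarith
      · have : (e : ℤ) < h := by exact_mod_cast not_le.1 h1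
        linarith
  have hdisj : ∀ i ∈ ι, ∀ j ∈ ι, ∀ x, x ∈ A i → x ∈ A j → i = j := by
    intro i hi j hj x hxi hxj
    refine hEinj i hi j hj (eq_of_fract_lt hK ?_ (hxi.2.trans_le (hhiδ i))
      (hxj.2.trans_le (hhiδ j)))
    have h1 := hEbd i hi
    have h2 := hEbd j hj
    rw [abs_lt]
    constructor <;> omega
  set c : ℕ × ℕ → ℤ := fun i => if h ≤ i.2 then 1 else -1 with hc
  classical
  have hsum : ∀ x, hits β z (p * q) x =
      p * (m * q - N * h) + ∑ i ∈ ι, if x ∈ A i then c i else 0 := by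
    intro x
    rw [hits_mul hN, hι, Finset.sum_product]
    simp only [hits_eq_sum hN hq.le hz]
    rw [Finset.sum_add_distrib]
    congr 1
    · rw [Finset.sum_const, Finset.card_range, nsmul_eq_mul]
    refine Finset.sum_congr rfl fun r _ => Finset.sum_congr rfl fun e _ => ?_
    by_cases he : h ≤ e
    · simp only [if_pos he, hA, hE, hlo, hhi, hc, Set.mem_Ico, Set.mem_ofPred_eq]
      rw [floor_sub_floor_sub hs0 (hsδ.trans hδ1)]
      have : Int.fract (x + r * δ + e * β) =
          Int.fract (x + (((e : ℤ) + r * q : ℤ) : ℝ) * β) := by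
        rw [Int.fract_eq_fract]
        exact ⟨-(r * N), by push_cast; linear_combination -(r : ℝ) * hN⟩
      rw [this]
      simp [Int.fract_nonneg]
    · simp only [if_neg he, hA, hE, hlo, hhi, hc, Set.mem_Ico, Set.mem_ofPred_eq]
      rw [floor_sub_floor_add hs0 hsδ hδ1]
      have : Int.fract (x + r * δ + e * β + δ) =
          Int.fract (x + (((e : ℤ) + (r + 1) * q : ℤ) : ℝ) * β) := by
        rw [Int.fract_eq_fract]
        exact ⟨-((r + 1) * N), by push_cast; linear_combination -((r : ℝ) + 1) * hN⟩
      rw [this]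
  set u : ℤ := p * (m * q - N * h) with hu
  have hval : ∀ x, (∃ i ∈ ι, x ∈ A i ∧ hits β z (p * q) x = u + c i) ∨
      ((∀ i ∈ ι, x ∉ A i) ∧ hits β z (p * q) x = u) := by
    intro x
    by_cases hex : ∃ i ∈ ι, x ∈ A i
    · left
      obtain ⟨i, hi, hx⟩ := hex
      refine ⟨i, hi, hx, ?_⟩
      rw [hsum, Finset.sum_eq_single_of_mem i hi, if_pos hx]
      intro j hj hne
      rw [if_neg]
      exact fun hxj => hne (hdisj j hj i hi x hxj hx)
    · right
      push Not at hex
      refine ⟨hex, ?_⟩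
      rw [hsum, Finset.sum_eq_zero, add_zero]
      exact fun i hi => if_neg (hex i hi)
  have hset : ∀ (b : ℝ) (σ : ℤ), σ ≠ 0 →
      {x ∈ Set.Ico (0 : ℝ) 1 | hits β z (p * q) (x + b) = u + σ} =
        ⋃ i ∈ ι.filter (fun i => c i = σ), {x ∈ Set.Ico (0 : ℝ) 1 |
          Int.fract (x + (b + E i * β)) ∈ Set.Ico (lo i) (hi i)} := by
    intro b σ hσ
    ext x
    simp only [Set.mem_ofPred_eq, Set.mem_iUnion, Finset.mem_filter, exists_prop, ← add_assoc]
    constructor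
    · rintro ⟨hx, hxu⟩
      rcases hval (x + b) with ⟨i, hi, hxi, hui⟩ | ⟨-, hui⟩
      · exact ⟨i, ⟨hi, by omega⟩, hx, hxi⟩
      · omega
    · rintro ⟨i, ⟨hi, hci⟩, hx, hxi⟩
      refine ⟨hx, ?_⟩
      rcases hval (x + b) with ⟨j, hj, hxj, huj⟩ | ⟨hno, -⟩
      · rw [huj, hdisj j hj i hi (x + b) hxj hxi, hci]
      · exact absurd hxi (hno i hi)
  have hvol : ∀ (b : ℝ) (σ : ℤ), σ ≠ 0 →
      volume.real {x ∈ Set.Ico (0 : ℝ) 1 | hits β z (p * q) (x + b) = u + σ} =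
        ∑ i ∈ ι.filter (fun i => c i = σ), (hi i - lo i) := by
    intro b σ hσ
    rw [hset b σ hσ, measureReal_biUnion_finset
      (h := fun i _ => volume_ne_top_of_subset_Ico fun x hx => hx.1)]
    · refine Finset.sum_congr rfl fun i _ => volume_fract_mem _ ?_ ?_ ((hhiδ i).trans hδ1)
      · simp only [hlo]; split_ifs <;> linarith
      · simp only [hlo, hhi]; split_ifs <;> linarith
    · intro i hi j hj hne
      simp only [Finset.coe_filter, Set.mem_ofPred_eq] at hi hj
      rw [Function.onFun, Set.disjoint_left]
      rintro x ⟨-, hxi⟩ ⟨-, hxj⟩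
      rw [← add_assoc] at hxi hxj
      exact hne (hdisj i hi.1 j hj.1 (x + b) hxi hxj)
    · exact fun i _ => measurableSet_fract_mem _ _ _
  refine ⟨u, fun x => ?_, fun b => ⟨?_, ?_⟩⟩
  · rcases hval x with ⟨i, -, -, hui⟩ | ⟨-, hui⟩ <;> rw [hui]
    · simp only [hc]; split_ifs <;> simp
    · simp
  · rw [hvol b 1 one_ne_zero]
    have hfil : ι.filter (fun i => c i = 1) = Finset.range p ×ˢ Finset.Ico h q := by
      ext ⟨r, e⟩
      simp only [hι, hc, Finset.mem_filter, Finset.mem_product, Finset.mem_range, Finset.mem_Ico]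
      by_cases he : h ≤ e <;> simp [he]
    rw [hfil, Finset.sum_congr rfl (g := fun _ => s)]
    · rw [Finset.sum_const, Finset.card_product, Finset.card_range, Nat.card_Ico, nsmul_eq_mul]
      push_cast [hq.le]
      ring
    · rintro ⟨r, e⟩ hre
      simp only [Finset.mem_product, Finset.mem_Ico] at hre
      simp [hhi, hlo, hre.2.1]
  · rw [sub_eq_add_neg, hvol b (-1) (by norm_num)]
    have hfil : ι.filter (fun i => c i = -1) = Finset.range p ×ˢ Finset.range h := by
      ext ⟨r, e⟩
      simp only [hι, hc, Finset.mem_filter, Finset.mem_product, Finset.mem_range]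
      by_cases he : h ≤ e
      · simp [he]
      · simp [he]
        omega
    rw [hfil, Finset.sum_congr rfl (g := fun _ => δ - s)]
    · rw [Finset.sum_const, Finset.card_product, Finset.card_range, Finset.card_range,
        nsmul_eq_mul]
      push_cast
      ring
    · rintro ⟨r, e⟩ hre
      simp only [Finset.mem_product, Finset.mem_range] at hre
      simp [hhi, hlo, not_le.2 hre.2]

theorem volume_hits_not_extreme_le {β z δ : ℝ} {q p : ℕ} {N u : ℤ} (hN : q * β = N + δ)
    (hδ0 : 0 ≤ δ) (hδ1 : δ ≤ 1) (hu : ∀ x, hits β z q x = u ∨ hits β z q x = u + 1) (b : ℝ) :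
    volume.real {x ∈ Set.Ico (0 : ℝ) 1 | hits β z (p * q) (x + b) ≠ p * u ∧
      hits β z (p * q) (x + b) ≠ p * u + p} ≤ 2 * (p * (q * δ)) := by
  have hjump : ∀ y : ℝ, ⌊y⌋ ≠ ⌊y + δ⌋ → Int.fract y ∈ Set.Ico (1 - δ) 1 := by
    intro y hy
    refine ⟨?_, Int.fract_lt_one y⟩
    by_contra! h
    apply hy
    symm
    rw [Int.floor_eq_iff]
    have := Int.self_sub_floor y
    have := Int.fract_nonneg y
    constructor <;> linarith
  set ι := Finset.range p ×ˢ Finset.range q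
  have hsub : {x ∈ Set.Ico (0 : ℝ) 1 | hits β z (p * q) (x + b) ≠ p * u ∧
      hits β z (p * q) (x + b) ≠ p * u + p} ⊆
      ⋃ i ∈ ι,
        ({x ∈ Set.Ico (0 : ℝ) 1 | Int.fract (x + (b + i.1 * δ + i.2 * β)) ∈ Set.Ico (1 - δ) 1} ∪
        {x ∈ Set.Ico (0 : ℝ) 1 |
          Int.fract (x + (b + i.1 * δ + i.2 * β - z)) ∈ Set.Ico (1 - δ) 1}) := by
    rintro x ⟨hx, h1, h2⟩
    have hex : ∃ r < p, hits β z q (x + b + r * δ) ≠ hits β z q (x + b + r * δ + δ) := by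
      by_contra! hall
      have hconst : ∀ r < p, hits β z q (x + b + r * δ) = hits β z q (x + b) := by
        intro r
        induction r with
        | zero => intro; simp
        | succ r ih =>
          intro hr
          rw [← ih (by omega), hall r (by omega)]
          congr 1
          push_cast
          ring
      have hval : hits β z (p * q) (x + b) = p * hits β z q (x + b) := by
        rw [hits_mul hN, Finset.sum_congr rfl fun r hr => hconst r (Finset.mem_range.1 hr)]
        simp
      rcases hu (x + b) with h | h
      · exact h1 (by rw [hval, h])
      · exact h2 (by rw [hval, h]; ring)
    obtain ⟨r, hr, hne⟩ := hex
    have hex2 : ∃ j < q, ⌊x + b + r * δ + j * β⌋ - ⌊x + b + r * δ + j * β - z⌋ ≠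
        ⌊x + b + r * δ + δ + j * β⌋ - ⌊x + b + r * δ + δ + j * β - z⌋ := by
      by_contra! hall
      exact hne (Finset.sum_congr rfl fun j hj => hall j (Finset.mem_range.1 hj))
    obtain ⟨j, hj, hne⟩ := hex2
    simp only [Set.mem_iUnion]
    refine ⟨(r, j), Finset.mem_product.2 ⟨Finset.mem_range.2 hr, Finset.mem_range.2 hj⟩, ?_⟩
    rcases ne_or_eq ⌊x + b + r * δ + j * β⌋ ⌊x + b + r * δ + j * β + δ⌋ with h3 | h3
    · left
      refine ⟨hx, ?_⟩
      have := hjump _ h3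
      rwa [show x + b + r * δ + j * β = x + (b + r * δ + j * β) by ring] at this
    · right
      refine ⟨hx, ?_⟩
      have h4 : ⌊x + b + r * δ + j * β - z⌋ ≠ ⌊x + b + r * δ + j * β - z + δ⌋ := by
        intro h4
        apply hne
        rw [h3, h4]
        congr 2 <;> ring
      have := hjump _ h4
      rwa [show x + b + r * δ + j * β - z = x + (b + r * δ + j * β - z) by ring] at this
  calc _ ≤ volume.real (⋃ i ∈ ι,
        ({x ∈ Set.Ico (0 : ℝ) 1 | Int.fract (x + (b + i.1 * δ + i.2 * β)) ∈ Set.Ico (1 - δ) 1} ∪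
        {x ∈ Set.Ico (0 : ℝ) 1 |
          Int.fract (x + (b + i.1 * δ + i.2 * β - z)) ∈ Set.Ico (1 - δ) 1})) := by
        refine measureReal_mono hsub (volume_ne_top_of_subset_Ico ?_)
        refine Set.iUnion₂_subset fun i _ => Set.union_subset (fun x hx => hx.1) fun x hx => hx.1
    _ ≤ ∑ i ∈ ι, volume.real
        ({x ∈ Set.Ico (0 : ℝ) 1 | Int.fract (x + (b + i.1 * δ + i.2 * β)) ∈ Set.Ico (1 - δ) 1} ∪
        {x ∈ Set.Ico (0 : ℝ) 1 |
          Int.fract (x + (b + i.1 * δ + i.2 * β - z)) ∈ Set.Ico (1 - δ) 1}) :=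
        measureReal_biUnion_finset_le _ _
    _ ≤ ∑ i ∈ ι, (δ + δ) := by
        refine Finset.sum_le_sum fun i _ => (measureReal_union_le _ _).trans ?_
        rw [volume_fract_mem _ (by linarith) (by linarith) le_rfl,
          volume_fract_mem _ (by linarith) (by linarith) le_rfl]
        linarith
    _ = 2 * (p * (q * δ)) := by
        rw [Finset.sum_const, Finset.card_product, Finset.card_range, Finset.card_range,
          nsmul_eq_mul]
        push_cast
        ring

section

/-- The set of points of `[0, 1)` at which the shifted visit count has the given property. -/
def hitsLevel (β z : ℝ) (L : ℕ) (b : ℝ) (p : ℤ → Prop) : Set ℝ :=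
  {x ∈ Set.Ico (0 : ℝ) 1 | p (hits β z L (x + b))}

theorem measurableSet_hitsLevel (β z : ℝ) (L : ℕ) (b : ℝ) (p : ℤ → Prop) :
    MeasurableSet (hitsLevel β z L b p) :=
  measurableSet_Ico.inter
    (((measurable_hits β z L).comp (measurable_id.add_const b))
      (MeasurableSet.of_discrete (s := {n | p n})))

theorem hitsLevel_subset (β z : ℝ) (L : ℕ) (b : ℝ) (p : ℤ → Prop) :
    hitsLevel β z L b p ⊆ Set.Ico 0 1 := fun _ hx => hx.1

theorem volume_hitsLevel_add_not (β z : ℝ) (L : ℕ) (b : ℝ) (p : ℤ → Prop) :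
    volume.real (hitsLevel β z L b p) + volume.real (hitsLevel β z L b fun n => ¬ p n) = 1 := by
  rw [← measureReal_union _ (measurableSet_hitsLevel _ _ _ _ _)
    (volume_ne_top_of_subset_Ico (hitsLevel_subset _ _ _ _ _))
    (volume_ne_top_of_subset_Ico (hitsLevel_subset _ _ _ _ _))]
  · have : hitsLevel β z L b p ∪ hitsLevel β z L b (fun n => ¬ p n) = Set.Ico 0 1 := by
      ext x
      simp only [hitsLevel, Set.mem_union, Set.mem_ofPred_eq]
      tauto
    rw [this, Real.volume_real_Ico_of_le zero_le_one, sub_zero]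
  · rw [Set.disjoint_left]
    exact fun x hx hx' => hx'.2 hx.2

theorem volume_hitsLevel_or_le (β z : ℝ) (L : ℕ) (b : ℝ) {p p₁ p₂ : ℤ → Prop}
    (h : ∀ x, p (hits β z L x) → p₁ (hits β z L x) ∨ p₂ (hits β z L x)) :
    volume.real (hitsLevel β z L b p) ≤
      volume.real (hitsLevel β z L b p₁) + volume.real (hitsLevel β z L b p₂) := by
  refine (measureReal_mono ?_ (volume_ne_top_of_subset_Ico ?_)).trans (measureReal_union_le _ _)
  · rintro x ⟨hx, hp⟩
    exact (h _ hp).imp (fun h' => ⟨hx, h'⟩) fun h' => ⟨hx, h'⟩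
  · exact Set.union_subset (hitsLevel_subset _ _ _ _ _) (hitsLevel_subset _ _ _ _ _)

theorem volume_hitsLevel_eq_zero (β z : ℝ) (L : ℕ) (b : ℝ) {p : ℤ → Prop}
    (h : ∀ x, ¬ p (hits β z L x)) : volume.real (hitsLevel β z L b p) = 0 := by
  have : hitsLevel β z L b p = ∅ := Set.eq_empty_of_forall_notMem fun x hx => h _ hx.2
  rw [this, measureReal_empty]

namespace ThreeIET

variable {I : ThreeIET} {β b : ℝ} {L : ℕ}

theorem A5_of_hitsLevel (hb : ∀ x ∈ Set.Ico (0 : ℝ) 1, (I.ψ L x : ℤ) = hits β I.z L (x + b))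
    {η chat : ℝ} (hc : 0 ≤ chat) (j : ℤ)
    (hj : chat < volume.real (hitsLevel β I.z L b fun n => n = j))
    (h : volume.real (hitsLevel β I.z L b fun n => n < j) < η * chat ∨
      volume.real (hitsLevel β I.z L b fun n => j < n) < η * chat) : I.A5 η chat L := by
  have hne : (hitsLevel β I.z L b fun n => n = j).Nonempty := by
    by_contra hempty
    rw [Set.not_nonempty_iff_eq_empty] at hempty
    rw [hempty, measureReal_empty] at hj
    linarith
  obtain ⟨x, hx, hxj⟩ := hne
  rw [← hb x hx] at hxj
  have key : ∀ (S : Set ℕ) (p : ℤ → Prop), (∀ n : ℕ, n ∈ S ↔ p n) →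
      I.ψPreimage L S = hitsLevel β I.z L b p := by
    intro S p hS
    ext y
    simp only [ψPreimage, hitsLevel, Set.mem_ofPred_eq]
    constructor
    · rintro ⟨hy, h⟩
      exact ⟨hy, by rw [← hb y hy]; exact (hS _).1 h⟩
    · rintro ⟨hy, h⟩
      exact ⟨hy, (hS _).2 (by rw [hb y hy]; exact h)⟩
  refine ⟨I.ψ L x, ?_⟩
  rw [key {I.ψ L x} (fun n => n = j) (fun n => by simp; omega),
    key (Set.Iio (I.ψ L x)) (fun n => n < j) (fun n => by simp; omega),
    key (Set.Ioi (I.ψ L x)) (fun n => j < n) (fun n => by simp; omega)]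
  exact h.imp (fun h' => ⟨hj, h'⟩) fun h' => ⟨hj, h'⟩

/-- Three values: the extreme ones either carry much mass, or at least one carries little. -/
theorem le_of_not_A5 (hb : ∀ x ∈ Set.Ico (0 : ℝ) 1, (I.ψ L x : ℤ) = hits β I.z L (x + b))
    {u : ℤ} (hu : ∀ x, |hits β I.z L x - u| ≤ 1) {η chat : ℝ} (hη : 0 < η) (hc : 0 < chat)
    (hc' : chat < 1 / 4) (hA : ¬ I.A5 η chat L) :
    (η * chat ≤ volume.real (hitsLevel β I.z L b fun n => n = u + 1) ∧
      volume.real (hitsLevel β I.z L b fun n => n = u + 1) ≤ chat) ∧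
    (η * chat ≤ volume.real (hitsLevel β I.z L b fun n => n = u - 1) ∧
      volume.real (hitsLevel β I.z L b fun n => n = u - 1) ≤ chat) := by
  have hηc : 0 < η * chat := mul_pos hη hc
  have hu' : ∀ x, u - 1 ≤ hits β I.z L x ∧ hits β I.z L x ≤ u + 1 := fun x => by
    have := abs_le.1 (hu x)
    omega
  have h1 : volume.real (hitsLevel β I.z L b fun n => n = u + 1) ≤ chat := by
    by_contra! h
    refine hA (A5_of_hitsLevel hb hc.le (u + 1) h (Or.inr ?_))
    rwa [volume_hitsLevel_eq_zero]
    exact fun x => not_lt.2 (hu' x).2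
  have h2 : volume.real (hitsLevel β I.z L b fun n => n = u - 1) ≤ chat := by
    by_contra! h
    refine hA (A5_of_hitsLevel hb hc.le (u - 1) h (Or.inl ?_))
    rwa [volume_hitsLevel_eq_zero]
    exact fun x => not_lt.2 (hu' x).1
  have h3 : chat < volume.real (hitsLevel β I.z L b fun n => n = u) := by
    have h4 := volume_hitsLevel_add_not β I.z L b fun n => n = u
    have h5 := volume_hitsLevel_or_le β I.z L b (p := fun n => ¬ n = u) (p₁ := fun n => n = u + 1)
      (p₂ := fun n => n = u - 1) (fun x hx => by have := hu' x; omega)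
    linarith
  have h4 : η * chat ≤ volume.real (hitsLevel β I.z L b fun n => u < n) := by
    by_contra! h
    exact hA (A5_of_hitsLevel hb hc.le u h3 (Or.inr h))
  have h5 : η * chat ≤ volume.real (hitsLevel β I.z L b fun n => n < u) := by
    by_contra! h
    exact hA (A5_of_hitsLevel hb hc.le u h3 (Or.inl h))
  have h6' : volume.real (hitsLevel β I.z L b fun n => u < n) ≤
      volume.real (hitsLevel β I.z L b fun n => n = u + 1) := by
    refine measureReal_mono ?_ (volume_ne_top_of_subset_Ico (hitsLevel_subset _ _ _ _ _))
    rintro x ⟨hx, hlt⟩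
    exact ⟨hx, by have := hu' (x + b); omega⟩
  have h7' : volume.real (hitsLevel β I.z L b fun n => n < u) ≤
      volume.real (hitsLevel β I.z L b fun n => n = u - 1) := by
    refine measureReal_mono ?_ (volume_ne_top_of_subset_Ico (hitsLevel_subset _ _ _ _ _))
    rintro x ⟨hx, hlt⟩
    exact ⟨hx, by have := hu' (x + b); omega⟩
  exact ⟨⟨h4.trans h6', h1⟩, h5.trans h7', h2⟩

/-- If the extreme values carry at least half of the mass, `A5` holds. -/
theorem A5_of_extremes (hb : ∀ x ∈ Set.Ico (0 : ℝ) 1, (I.ψ L x : ℤ) = hits β I.z L (x + b))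
    {u w : ℤ} (hu : ∀ x, u ≤ hits β I.z L x ∧ hits β I.z L x ≤ w)
    (hvol : volume.real (hitsLevel β I.z L b fun n => n ≠ u ∧ n ≠ w) ≤ 1 / 2) {η chat : ℝ}
    (hη : 0 < η) (hc : 0 < chat) (hc' : chat < 1 / 4) : I.A5 η chat L := by
  have hηc : 0 < η * chat := mul_pos hη hc
  have h1 := volume_hitsLevel_add_not β I.z L b fun n => n ≠ u ∧ n ≠ w
  have h2 := volume_hitsLevel_or_le β I.z L b (p := fun n => ¬ (n ≠ u ∧ n ≠ w))
    (p₁ := fun n => n = u) (p₂ := fun n => n = w) (fun x hx => by tauto)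
  by_cases h3 : chat < volume.real (hitsLevel β I.z L b fun n => n = u)
  · refine A5_of_hitsLevel hb hc.le u h3 (Or.inl ?_)
    rwa [volume_hitsLevel_eq_zero]
    exact fun x => not_lt.2 (hu x).1
  · refine A5_of_hitsLevel hb hc.le w (by linarith) (Or.inr ?_)
    rwa [volume_hitsLevel_eq_zero]
    exact fun x => not_lt.2 (hu x).2

end ThreeIET

namespace ContFracData

variable {α : ℝ} {q a : ℕ → ℕ} {P : ℕ → ℤ} {d : ℕ → ℝ}

theorem q_mul_eq (H : ContFracData α q a P d) (v : ℕ) :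
    (q v : ℝ) * ((-1) ^ v * α) = (((-1) ^ v * P v : ℤ) : ℝ) + d v := by
  have h1 := H.mul_sub v
  have h2 : ((-1 : ℝ)) ^ v * (-1) ^ v = 1 := by rw [← mul_pow]; norm_num
  push_cast
  linear_combination (-1 : ℝ) ^ v * h1 + d v * h2

theorem d_le_fract (H : ContFracData α q a P d) (v k : ℕ) {e : ℤ} (he : e ≠ 0)
    (hlt : |e| < q (v + 1)) : d v ≤ Int.fract (e * ((-1) ^ k * α)) := by
  have h1 := Int.self_sub_floor (e * ((-1) ^ k * α))
  have h2 := Int.fract_nonneg (e * ((-1) ^ k * α))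
  rcases neg_one_pow_eq_or ℝ k with e1 | e1
  · rw [e1, one_mul] at h1 h2 ⊢
    have := H.d_le_abs v (m := ⌊e * α⌋) he hlt
    rwa [h1, abs_of_nonneg h2] at this
  · rw [e1, neg_one_mul] at h1 h2 ⊢
    have := H.d_le_abs v (n := -e) (m := ⌊e * -α⌋) (neg_ne_zero.2 he) (by rwa [abs_neg])
    push_cast at this
    rwa [show -(e : ℝ) * α = e * -α by ring, h1, abs_of_nonneg h2] at this

theorem d_lt_one (H : ContFracData α q a P d) (v : ℕ) : d v < 1 := by
  have h1 := H.q_succ_mul_d_lt v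
  have h2 : (1 : ℝ) ≤ q (v + 1) := by exact_mod_cast H.q_pos (v + 1)
  have h3 := H.d_pos v
  nlinarith

end ContFracData

/-- At the scale of a convergent, either `A5` holds or the marked points are related by a short
orbit segment, and then the failure of `A5` for `p` blocks controls `p`. -/
theorem A5_dichotomy (I : ThreeIET) {q a : ℕ → ℕ} {P : ℕ → ℤ} {d : ℕ → ℝ}
    (H : ContFracData I.α q a P d) (v : ℕ) (hv : 1 ≤ v) :
    (∀ p : ℕ, (p = 1 ∨ p * (q v * d v) ≤ 1 / 4) →
      (∀ x ∈ Set.Ico (0 : ℝ) 1, ∀ y ∈ Set.Ico (0 : ℝ) 1,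
        (I.ψ (p * q v) x : ℤ) - I.ψ (p * q v) y ≤ p) ∧
      ∀ η chat : ℝ, 0 < η → 0 < chat → chat < 1 / 4 → I.A5 η chat (p * q v)) ∨
    ∃ (h : ℕ) (s : ℝ) (m : ℤ), h < q v ∧ 0 ≤ s ∧ s ≤ d v ∧
      I.z = -(h * ((-1) ^ v * I.α)) + s + m ∧
      ∀ p : ℕ, p * q v ≤ q (v + 1) →
        (∀ x ∈ Set.Ico (0 : ℝ) 1, ∀ y ∈ Set.Ico (0 : ℝ) 1,
          (I.ψ (p * q v) x : ℤ) - I.ψ (p * q v) y ≤ 2) ∧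
        ∀ η chat : ℝ, 0 < η → 0 < chat → chat < 1 / 4 → ¬ I.A5 η chat (p * q v) →
          (η * chat ≤ p * ((q v - h) * s) ∧ p * ((q v - h) * s) ≤ chat) ∧
          (η * chat ≤ p * (h * (d v - s)) ∧ p * (h * (d v - s)) ≤ chat) := by
  set β := (-1) ^ v * I.α with hβ
  have hN := H.q_mul_eq v
  rw [← hβ] at hN
  have hq0 : 0 < q v := H.q_pos v
  obtain ⟨h, hh, hmin⟩ := Finset.exists_min_image (Finset.range (q v))
    (fun h : ℕ => Int.fract (I.z + h * β)) ⟨0, Finset.mem_range.2 hq0⟩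
  have hh := Finset.mem_range.1 hh
  have hK : ∀ p : ℕ, p * q v ≤ q (v + 1) → ∀ e : ℤ, e ≠ 0 → |e| < (p * q v : ℕ) →
      d v ≤ Int.fract (e * β) := fun p hp e he hlt =>
    H.d_le_fract v v he (lt_of_lt_of_le hlt (by exact_mod_cast hp))
  rcases lt_or_ge (d v) (Int.fract (I.z + h * β)) with hs | hs
  · left
    have hK1 : ∀ e : ℤ, e ≠ 0 → |e| < q v → d v < Int.fract (e * β) := by
      intro e he hlt
      obtain ⟨w, rfl⟩ := Nat.exists_eq_add_of_le' hv
      exact (H.d_succ_lt w).trans_le (H.d_le_fract w _ he hlt)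
    obtain ⟨u, hu⟩ := hits_two_values hN (H.d_pos v) hh hK1
      (fun h' hh' => hmin h' (Finset.mem_range.2 hh')) hs
    intro p hp
    have hbd : ∀ x, p * u ≤ hits β I.z (p * q v) x ∧ hits β I.z (p * q v) x ≤ p * u + p := by
      intro x
      rw [hits_mul hN]
      constructor
      · calc (p * u : ℤ) = ∑ r ∈ Finset.range p, u := by simp
          _ ≤ _ := Finset.sum_le_sum fun r _ => by rcases hu (x + r * d v) with h | h <;> omega
      · calc _ ≤ ∑ r ∈ Finset.range p, (u + 1) :=
              Finset.sum_le_sum fun r _ => by rcases hu (x + r * d v) with h | h <;> omega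
          _ = (p * u + p : ℤ) := by simp; ring
    obtain ⟨b, hb⟩ := I.exists_ψ_eq_hits v (p * q v)
    rw [← hβ] at hb
    refine ⟨fun x hx y hy => ?_, fun η chat hη hc hc' =>
      ThreeIET.A5_of_extremes hb hbd ?_ hη hc hc'⟩
    · rw [hb x hx, hb y hy]
      have h1 := hbd (x + b)
      have h2 := hbd (y + b)
      omega
    · rcases hp with rfl | hp
      · rw [volume_hitsLevel_eq_zero]
        · norm_num
        · intro x
          have := hu x
          rw [one_mul]
          push_cast
          omega
      · have h1 := volume_hits_not_extreme_le (p := p) hN (H.d_pos v).le (H.d_lt_one v).le hu b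
        unfold hitsLevel
        linarith
  · right
    have hz : I.z = -(h * β) + Int.fract (I.z + h * β) + ⌊I.z + h * β⌋ := by
      have := Int.self_sub_floor (I.z + h * β)
      linarith
    refine ⟨h, _, _, hh, Int.fract_nonneg _, hs, hz, fun p hp => ?_⟩
    obtain ⟨u, hu, hvol⟩ := hits_three_values (p := p) hN (H.d_lt_one v).le hh hz
      (Int.fract_nonneg _) hs (hK p hp)
    obtain ⟨b, hb⟩ := I.exists_ψ_eq_hits v (p * q v)
    rw [← hβ] at hb
    refine ⟨fun x hx y hy => ?_, fun η chat hη hc hc' hA => ?_⟩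
    · rw [hb x hx, hb y hy]
      have h1 := abs_le.1 (hu (x + b))
      have h2 := abs_le.1 (hu (y + b))
      omega
    · have := ThreeIET.le_of_not_A5 hb hu hη hc hc' hA
      unfold hitsLevel at this
      rwa [(hvol b).1, (hvol b).2] at this

end

section

/-! ### Counting -/

/-- A finite set whose parts of diameter less than `r` have at most `n` elements. -/
theorem card_le_of_bins {ι : Type*} (A : Finset ι) (f : ι → ℝ) {Y r : ℝ} (hr : 0 < r)
    (n : ℕ) (hY : 0 ≤ Y) (hf : ∀ i ∈ A, 0 ≤ f i ∧ f i ≤ Y)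
    (hn : ∀ B ⊆ A, (∀ i ∈ B, ∀ j ∈ B, f j - f i < r) → B.card ≤ n) :
    (A.card : ℝ) ≤ n * (Y / r + 1) := by
  classical
  have h1 : A.card ≤ n * (A.image fun i => ⌊f i / r⌋₊).card := by
    refine Finset.card_le_mul_card_image A n fun b _ => hn _ (Finset.filter_subset _ _) ?_
    intro i hi j hj
    rw [Finset.mem_filter] at hi hj
    have hi1 := Nat.floor_le (div_nonneg (hf i hi.1).1 hr.le)
    have hj1 := Nat.lt_floor_add_one (f j / r)
    rw [hi.2] at hi1
    rw [hj.2] at hj1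
    rw [le_div_iff₀ hr] at hi1
    rw [div_lt_iff₀ hr] at hj1
    linarith
  have h2 : (A.image fun i => ⌊f i / r⌋₊).card ≤ ⌊Y / r⌋₊ + 1 := by
    rw [← Finset.card_range (⌊Y / r⌋₊ + 1)]
    refine Finset.card_le_card fun b hb => ?_
    obtain ⟨i, hi, rfl⟩ := Finset.mem_image.1 hb
    refine Finset.mem_range.2 (Nat.lt_succ_of_le (Nat.floor_le_floor ?_))
    exact div_le_div_of_nonneg_right (hf i hi).2 hr.le
  have h3 : (A.card : ℝ) ≤ n * (⌊Y / r⌋₊ + 1) := by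
    exact_mod_cast h1.trans (Nat.mul_le_mul_left n h2)
  refine h3.trans (mul_le_mul_of_nonneg_left ?_ (Nat.cast_nonneg n))
  have := Nat.floor_le (div_nonneg hY hr.le)
  linarith

namespace ContFracData

variable {α : ℝ} {q a : ℕ → ℕ} {P : ℕ → ℤ} {d : ℕ → ℝ}

theorem q_cast_pos (H : ContFracData α q a P d) (k : ℕ) : (0 : ℝ) < q k := by
  exact_mod_cast H.q_pos k

theorem one_le_q_cast (H : ContFracData α q a P d) (k : ℕ) : (1 : ℝ) ≤ q k := by
  exact_mod_cast H.q_pos k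

theorem q_cast_mono (H : ContFracData α q a P d) {k l : ℕ} (h : k ≤ l) : (q k : ℝ) ≤ q l := by
  exact_mod_cast H.q_mono h

theorem lt_of_q_cast_lt (H : ContFracData α q a P d) {k l : ℕ} (h : (q k : ℝ) < q l) : k < l := by
  by_contra! hle
  exact absurd h (not_lt.2 (H.q_cast_mono hle))

/-- Indices with denominators in a bounded ratio. -/
theorem card_le_of_ratio (H : ContFracData α q a P d) {R : ℝ} {N : ℕ} (hR : R < 2 ^ N)
    (B : Finset ℕ) (hB : ∀ i ∈ B, ∀ j ∈ B, (q j : ℝ) ≤ R * q i) : B.card ≤ 2 * N := by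
  rcases B.eq_empty_or_nonempty with rfl | hne
  · simp
  set i₀ := B.min' hne with hi₀
  have hmem : i₀ ∈ B := B.min'_mem hne
  have hsub : B ⊆ Finset.Ico i₀ (i₀ + 2 * N) := by
    intro j hj
    rw [Finset.mem_Ico]
    refine ⟨B.min'_le j hj, ?_⟩
    by_contra! hle
    have h1 := hB i₀ hmem j hj
    have h2 : (2 : ℝ) ^ N * q i₀ ≤ q (i₀ + 2 * N) := by exact_mod_cast H.two_pow_mul_q_le i₀ N
    have h3 := H.q_cast_mono hle
    have h4 := mul_lt_mul_of_pos_right hR (H.q_cast_pos i₀)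
    linarith
  have := Finset.card_le_card hsub
  rwa [Nat.card_Ico, Nat.add_sub_cancel_left] at this

/-- Few indices are followed closely by a large partial quotient. -/
theorem card_big_quotient_le (H : ContFracData α q a P d) {C X : ℝ} (hC : 1 < C) (hX : 1 ≤ X)
    (w : ℕ) (A : Finset ℕ) (hA : ∀ k ∈ A, (q k : ℝ) ≤ X ∧ ∃ j, k < j ∧ j ≤ k + w ∧ C < a j) :
    (A.card : ℝ) ≤ w * (Real.log X / Real.log C + 1) := by
  refine card_le_of_bins A (fun k => Real.log (q k)) (Real.log_pos hC) w (Real.log_nonneg hX)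
    (fun k hk => ⟨Real.log_nonneg (H.one_le_q_cast k),
      Real.log_le_log (H.q_cast_pos k) (hA k hk).1⟩) fun B hB hdiam => ?_
  rcases B.eq_empty_or_nonempty with rfl | hne
  · simp
  set i₀ := B.min' hne with hi₀
  have hmem : i₀ ∈ B := B.min'_mem hne
  obtain ⟨-, j, hj, hjw, haj⟩ := hA i₀ (hB hmem)
  have hsub : B ⊆ Finset.Ico i₀ j := by
    intro k hk
    rw [Finset.mem_Ico]
    refine ⟨B.min'_le k hk, ?_⟩
    by_contra! hle
    have h1 := hdiam i₀ hmem k hk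
    rw [sub_lt_iff_lt_add, ← Real.log_mul (by positivity) (H.q_cast_pos i₀).ne'] at h1
    have h2 := (Real.log_lt_log_iff (H.q_cast_pos k)
      (mul_pos (by linarith) (H.q_cast_pos i₀))).1 h1
    obtain ⟨j, rfl⟩ := Nat.exists_eq_add_of_le' (by omega : 1 ≤ j)
    have h3 : (a (j + 1) : ℝ) * q j ≤ q (j + 1) := by exact_mod_cast H.a_mul_q_le j
    have h4 := H.q_cast_mono hle
    have h5 := H.q_cast_mono (by omega : i₀ ≤ j)
    have h6 : C * q i₀ ≤ a (j + 1) * q j :=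
      mul_le_mul haj.le h5 (H.q_cast_pos _).le (Nat.cast_nonneg _)
    linarith
  have := Finset.card_le_card hsub
  rw [Nat.card_Ico] at this
  omega

theorem exists_q_le_lt (H : ContFracData α q a P d) {x : ℝ} (hx : 1 ≤ x) :
    ∃ k, (q k : ℝ) ≤ x ∧ x < q (k + 1) := by
  have hex : ∃ k, x < q (k + 1) := by
    obtain ⟨n, hn⟩ := exists_nat_gt x
    refine ⟨n, hn.trans_le ?_⟩
    exact_mod_cast (H.le_q n).trans (H.q_le_succ n)
  refine ⟨Nat.find hex, ?_, Nat.find_spec hex⟩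
  rcases hk : Nat.find hex with _ | k
  · rw [H.q_zero]; simpa using hx
  · have := Nat.find_min hex (by omega : k < Nat.find hex)
    exact not_lt.1 this

/-! ### The choice of the times -/

/-- `p * q v` is a time allowed by `A9`. -/
def Admissible (a : ℕ → ℕ) (v p : ℕ) : Prop := p = 1 ∨ 1 ≤ p ∧ 4 < a (v + 1) ∧ 4 * p ≤ a (v + 1)

theorem Admissible.one_le {v p : ℕ} (h : Admissible a v p) : 1 ≤ p := by
  rcases h with rfl | h
  · exact le_rfl
  · exact h.1

/-- Of two consecutive multiples of a denominator, one is not of the form `q j / c`. -/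
theorem exists_ne_of_mul (H : ContFracData α q a P d) {c : ℝ} {κ p v : ℕ} (hκ : 1 ≤ κ)
    (hp : 1 ≤ p) (hpκ : p < q κ) (h : (q κ : ℝ) < c * (p * q v)) :
    (∀ j, c * (p * q v) ≠ q j) ∨ ∀ j, c * ((p + 1 : ℕ) * q v) ≠ q j := by
  by_contra! hcon
  obtain ⟨⟨j, hj⟩, j', hj'⟩ := hcon
  have hjκ : κ < j := H.lt_of_q_cast_lt (hj ▸ h)
  have heq : (p + 1) * q j = p * q j' := by
    have : ((p + 1 : ℕ) : ℝ) * q j = p * q j' := by rw [← hj, ← hj']; ring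
    exact_mod_cast this
  have hqj := H.q_pos j
  have hlt : q j < q j' := by
    by_contra! hle
    have := Nat.mul_le_mul_left p hle
    rw [← heq] at this
    nlinarith
  have hjj' : j < j' := by
    by_contra! hle
    exact absurd hlt (not_lt.2 (H.q_mono hle))
  rcases Nat.eq_or_lt_of_le (Nat.succ_le_of_lt hjj') with h1 | h1
  · subst h1
    have hdvd : q j ∣ p * q (j + 1) := ⟨p + 1, by rw [mul_comm (q j)]; exact heq.symm⟩
    have h2 := Nat.le_of_dvd hp ((H.coprime_q j).dvd_of_dvd_mul_right hdvd)
    have h3 := H.q_mono hjκ.le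
    omega
  · have h2 := H.two_mul_q_lt (by omega : 1 ≤ j)
    have h3 := H.q_mono (by omega : j + 2 ≤ j')
    have h4 := Nat.mul_le_mul_left p (h2.le.trans h3)
    nlinarith

theorem exists_ne_of_succ (H : ContFracData α q a P d) {c : ℝ} (hc1 : c < 1) (v : ℕ) :
    (∀ j, c * ((1 : ℕ) * q v) ≠ q j) ∨ ∀ j, c * ((1 : ℕ) * q (v + 1)) ≠ q j := by
  by_contra! hcon
  obtain ⟨⟨j, hj⟩, j', hj'⟩ := hcon
  rw [Nat.cast_one, one_mul] at hj hj'
  have heq : q j' * q v = q j * q (v + 1) := by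
    have : (q j' : ℝ) * q v = q j * q (v + 1) := by rw [← hj, ← hj']; ring
    exact_mod_cast this
  have hdvd : q v ∣ q j * q (v + 1) := ⟨q j', by rw [mul_comm (q v)]; exact heq.symm⟩
  have h1 : (q v : ℝ) ≤ q j := by
    exact_mod_cast Nat.le_of_dvd (H.q_pos j) ((H.coprime_q v).dvd_of_dvd_mul_right hdvd)
  have h2 := mul_lt_of_lt_one_left (H.q_cast_pos v) hc1
  linarith

theorem exists_admissible (H : ContFracData α q a P d) {c : ℝ} (hc0 : 0 < c) (hc1 : c < 1)
    {κ : ℕ} (hκ : 1 ≤ κ) (hcκ : 576 / c < q κ) :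
    ∃ v p : ℕ, κ ≤ v ∧ Admissible a v p ∧ (q κ : ℝ) < c * (p * q v) ∧
      c * (p * q v) < 576 * q κ ∧ ∀ j, c * (p * q v) ≠ q j := by
  set x : ℝ := q κ / c with hx
  have hκx : (q κ : ℝ) < x := by
    rw [hx, lt_div_iff₀ hc0]
    exact mul_lt_of_lt_one_right (H.q_cast_pos κ) hc1
  have hxc : x * c = q κ := by rw [hx]; field_simp
  have hx0 : 0 < x := (H.q_cast_pos κ).trans hκx
  obtain ⟨v, hv1, hv2⟩ := H.exists_q_le_lt ((H.one_le_q_cast κ).trans hκx.le)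
  have hκv : κ ≤ v := by
    have := H.lt_of_q_cast_lt (hκx.trans hv2)
    omega
  have hlo : ∀ y : ℝ, x < y → (q κ : ℝ) < c * y := fun y hy => by
    rw [← hxc, mul_comm]; exact mul_lt_mul_of_pos_left hy hc0
  have hhi : ∀ y : ℝ, y < 576 * x → c * y < 576 * q κ := fun y hy => by
    rw [← hxc, ← mul_assoc, mul_comm]; exact mul_lt_mul_of_pos_right hy hc0
  have hsmall : ∀ p u : ℕ, κ ≤ u → (p : ℝ) * q u < 576 * x → p < q κ := by
    intro p u hu hpu
    have h1 := H.q_cast_mono hu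
    have h2 : (p : ℝ) * q κ < 576 / c * q κ := by
      calc (p : ℝ) * q κ ≤ p * q u := by gcongr
        _ < 576 * x := hpu
        _ = 576 / c * q κ := by rw [hx]; ring
    have h3 := lt_of_mul_lt_mul_right h2 (H.q_cast_pos κ).le
    exact_mod_cast h3.trans hcκ
  rcases lt_or_ge ((q (v + 2) : ℝ)) (576 * x) with h576 | h576
  · have hmono := H.q_cast_mono (by omega : v + 1 ≤ v + 2)
    rcases H.exists_ne_of_succ hc1 (v + 1) with h | h
    · refine ⟨v + 1, 1, by omega, Or.inl rfl, hlo _ ?_, hhi _ ?_, h⟩ <;> push_cast <;> linarith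
    · refine ⟨v + 2, 1, by omega, Or.inl rfl, hlo _ ?_, hhi _ ?_, h⟩ <;> push_cast <;> linarith
  rcases lt_or_ge ((q (v + 1) : ℝ)) (24 * x) with h24 | h24
  · have ha : 8 ≤ a (v + 2) := by
      have h1 : (q (v + 2) : ℝ) ≤ (a (v + 2) + 1) * q (v + 1) := by
        exact_mod_cast H.q_succ_le (v + 1)
      by_contra! hlt
      have h2 : (a (v + 2) : ℝ) + 1 ≤ 8 := by exact_mod_cast hlt
      have h3 := H.q_cast_pos (v + 1)
      nlinarith
    rcases H.exists_ne_of_mul (c := c) (p := 1) (v := v + 1) hκ le_rfl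
      (hsmall 1 (v + 1) (by omega) (by push_cast; linarith))
      (hlo _ (by push_cast; linarith)) with h | h
    · refine ⟨v + 1, 1, by omega, Or.inl rfl, hlo _ ?_, hhi _ ?_, h⟩ <;> push_cast <;> linarith
    · refine ⟨v + 1, 2, by omega, Or.inr ⟨by omega, ?_, ?_⟩, hlo _ ?_, hhi _ ?_, h⟩
      · change 4 < a (v + 2); omega
      · change 4 * 2 ≤ a (v + 2); omega
      · push_cast; linarith
      · push_cast; linarith
  · set p := ⌊x / q v⌋₊ + 1 with hp
    have hqv := H.q_cast_pos v
    have hp1 : x < p * q v := by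
      have := Nat.lt_floor_add_one (x / q v)
      rw [div_lt_iff₀ hqv] at this
      rw [hp]
      push_cast
      exact this
    have hp2 : (p : ℝ) * q v ≤ x + q v := by
      have := Nat.floor_le (div_nonneg hx0.le hqv.le)
      rw [le_div_iff₀ hqv] at this
      rw [hp]
      push_cast
      linarith
    have ha : 4 * (p + 1) ≤ a (v + 1) := by
      have h1 : (q (v + 1) : ℝ) ≤ (a (v + 1) + 1) * q v := by exact_mod_cast H.q_succ_le v
      have h2 : 8 * ((p : ℝ) + 1) * q v ≤ (a (v + 1) + 1) * q v := by linarith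
      have h3 : 8 * ((p : ℝ) + 1) ≤ a (v + 1) + 1 := le_of_mul_le_mul_right h2 hqv
      have h4 : 8 * (p + 1) ≤ a (v + 1) + 1 := by exact_mod_cast h3
      omega
    rcases H.exists_ne_of_mul (c := c) (p := p) (v := v) hκ (by omega)
      (hsmall p v hκv (by linarith)) (hlo _ hp1) with h | h
    · exact ⟨v, p, hκv, Or.inr ⟨by omega, by omega, by omega⟩, hlo _ hp1, hhi _ (by linarith), h⟩
    · refine ⟨v, p + 1, hκv, Or.inr ⟨by omega, by omega, by omega⟩, hlo _ ?_, hhi _ ?_, h⟩ <;>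
        push_cast <;> linarith

/-- The index determined by a number that is not a denominator. -/
theorem exists_index (H : ContFracData α q a P d) {κ : ℕ} {y : ℝ} (h1 : (q κ : ℝ) < y)
    (h2 : y < 576 * q κ) (hne : ∀ j, y ≠ q j) :
    ∃ k, κ + 1 ≤ k ∧ k ≤ κ + 20 ∧ (q (k - 1) : ℝ) < y ∧ y < q k := by
  obtain ⟨k, hk1, hk2⟩ := H.exists_q_le_lt ((H.one_le_q_cast κ).trans h1.le)
  have h3 := H.lt_of_q_cast_lt (h1.trans hk2)
  have h4 : (2 : ℝ) ^ 10 * q κ ≤ q (κ + 2 * 10) := by exact_mod_cast H.two_pow_mul_q_le κ 10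
  have h5 : k < κ + 2 * 10 := by
    refine H.lt_of_q_cast_lt ?_
    calc (q k : ℝ) ≤ y := hk1
      _ < 576 * q κ := h2
      _ ≤ 2 ^ 10 * q κ := mul_le_mul_of_nonneg_right (by norm_num) (H.q_cast_pos κ).le
      _ ≤ _ := h4
  exact ⟨k + 1, by omega, by omega, lt_of_le_of_ne hk1 (hne k).symm, hk2⟩

theorem Admissible.mul_q_lt (H : ContFracData α q a P d) {v p : ℕ} (hv : 1 ≤ v)
    (h : Admissible a v p) : p * q v < q (v + 1) := by
  rcases h with rfl | ⟨-, -, h⟩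
  · rw [one_mul]; exact H.q_lt_succ hv
  · exact (Nat.mul_le_mul_right (q v) (by omega : p ≤ a (v + 1))).trans_lt (H.a_mul_q_lt hv)

theorem Admissible.quarter (H : ContFracData α q a P d) {v p : ℕ} (h : Admissible a v p) :
    p = 1 ∨ p * (q v * d v) ≤ 1 / 4 := by
  rcases h with rfl | ⟨-, -, h⟩
  · exact Or.inl rfl
  · right
    have h1 : (4 * p : ℝ) ≤ a (v + 1) := by exact_mod_cast h
    have h2 : (a (v + 1) : ℝ) * q v ≤ q (v + 1) := by exact_mod_cast H.a_mul_q_le v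
    have h3 := H.q_succ_mul_d_lt v
    have h4 := H.d_pos v
    have h5 : (4 * p : ℝ) * q v ≤ q (v + 1) :=
      (mul_le_mul_of_nonneg_right h1 (H.q_cast_pos v).le).trans h2
    nlinarith [mul_le_mul_of_nonneg_right h5 h4.le]

end ContFracData

/-! ### Thick indices -/

/-- `q k` is comparable to `exp t` for some thick time `t`. -/
def IsThickIndex (I : ThreeIET) (q : ℕ → ℕ) (ε : ℝ) (k : ℕ) : Prop :=
  ∃ t, IsThick I ε t ∧ ε * Real.exp t ≤ q k ∧ ε * q k ≤ Real.exp t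

theorem IsThick.mono {I : ThreeIET} {ε ε' t : ℝ} (h : IsThick I ε t) (hle : ε' ≤ ε) :
    IsThick I ε' t :=
  ⟨fun m n hmn => hle.trans (h.1 m n hmn), fun m n => hle.trans (h.2 m n)⟩

theorem IsThick.exists_index {I : ThreeIET} {q a : ℕ → ℕ} {P : ℕ → ℤ} {d : ℕ → ℝ}
    (H : ContFracData I.α q a P d) {ε t : ℝ} (hε1 : ε ≤ 1) (ht : 0 ≤ t)
    (h : IsThick I ε t) : ∃ k, ε * Real.exp t ≤ q k ∧ ε * q k ≤ Real.exp t := by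
  obtain ⟨k, hk1, hk2⟩ := H.exists_q_le_lt (Real.one_le_exp ht)
  have h1 := h.1 (P k) (q k) (Or.inr (by exact_mod_cast (H.q_pos k).ne'))
  have h2 : |(P k : ℝ) - ((q k : ℤ) : ℝ) * I.α| = d k := by
    rw [abs_sub_comm, Int.cast_natCast, H.mul_sub k, abs_mul, abs_pow, abs_neg, abs_one, one_pow,
      one_mul, abs_of_pos (H.d_pos k)]
  rw [h2, Int.cast_natCast, abs_of_pos (H.q_cast_pos k)] at h1
  have hexp := Real.exp_pos t
  rcases le_max_iff.1 h1 with h3 | h3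
  · refine ⟨k + 1, ?_, ?_⟩
    · exact (mul_le_of_le_one_left hexp.le hε1).trans hk2.le
    · have h4 := H.q_succ_mul_d_lt k
      have h5 := H.q_cast_pos (k + 1)
      calc ε * q (k + 1) ≤ Real.exp t * d k * q (k + 1) := by gcongr
        _ = Real.exp t * (q (k + 1) * d k) := by ring
        _ ≤ Real.exp t * 1 := by gcongr
        _ = _ := mul_one _
  · refine ⟨k, ?_, (mul_le_of_le_one_left (H.q_cast_pos k).le hε1).trans hk1⟩
    rw [Real.exp_neg, inv_mul_eq_div, le_div_iff₀ hexp] at h3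
    exact h3

theorem exists_many_thick_indices {I : ThreeIET} {q a : ℕ → ℕ} {P : ℕ → ℤ} {d : ℕ → ℝ}
    (H : ContFracData I.α q a P d) {ε δ : ℝ} (hε : 0 < ε) (hε1 : ε < 1) (hδ : 0 < δ)
    (h : ∀ T₀ : ℝ, ∃ S > T₀, δ * S ≤ volume.real {t ∈ Set.Ioc 0 S | IsThick I ε t}) :
    ∃ δ' > 0, ∀ T₀ : ℝ, ∃ X ≥ 1, T₀ < Real.log X ∧ ∃ F : Finset ℕ,
      (∀ k ∈ F, IsThickIndex I q ε k ∧ (q k : ℝ) ≤ X) ∧ δ' * Real.log X ≤ F.card := by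
  classical
  set b := Real.log (1 / ε) with hb
  have hb0 : 0 < b := Real.log_pos (by rw [lt_div_iff₀ hε]; linarith)
  have hb' : Real.log ε = -b := by rw [hb, one_div, Real.log_inv, neg_neg]
  refine ⟨δ / (4 * b), by positivity, fun T₀ => ?_⟩
  obtain ⟨S, hS, hvol⟩ := h (max T₀ b)
  have hSb : b < S := (le_max_right _ _).trans_lt hS
  have hS0 : 0 < S := hb0.trans hSb
  set X := Real.exp S / ε with hX
  have hX1 : 1 ≤ X := by
    rw [hX, le_div_iff₀ hε]
    have := Real.one_le_exp hS0.le
    linarith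
  have hlogX : Real.log X = S + b := by
    rw [hX, Real.log_div (Real.exp_pos S).ne' hε.ne', Real.log_exp, hb']
    ring
  set F := (Finset.range (⌊X⌋₊ + 1)).filter fun k => IsThickIndex I q ε k ∧ (q k : ℝ) ≤ X with hF
  refine ⟨X, hX1, ?_, F, fun k hk => (Finset.mem_filter.1 hk).2, ?_⟩
  · rw [hlogX]
    have := (le_max_left _ _).trans_lt hS
    linarith
  have hsub : {t ∈ Set.Ioc 0 S | IsThick I ε t} ⊆
      ⋃ k ∈ F, Set.Icc (Real.log (q k) - b) (Real.log (q k) + b) := by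
    rintro t ⟨⟨ht0, htS⟩, hthick⟩
    obtain ⟨k, hk1, hk2⟩ := hthick.exists_index H hε1.le ht0.le
    have hkX : (q k : ℝ) ≤ X := by
      rw [hX, le_div_iff₀ hε, mul_comm]
      exact hk2.trans (Real.exp_le_exp.2 htS)
    have hkF : k ∈ F := by
      refine Finset.mem_filter.2 ⟨Finset.mem_range.2 (Nat.lt_succ_of_le ?_), ⟨t, hthick, hk1, hk2⟩,
        hkX⟩
      exact Nat.le_floor ((Nat.cast_le.2 (H.le_q k)).trans hkX)
    refine Set.mem_iUnion₂.2 ⟨k, hkF, ?_, ?_⟩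
    · have := Real.log_le_log (mul_pos hε (H.q_cast_pos k)) hk2
      rw [Real.log_exp, Real.log_mul hε.ne' (H.q_cast_pos k).ne', hb'] at this
      linarith
    · have := Real.log_le_log (mul_pos hε (Real.exp_pos t)) hk1
      rw [Real.log_mul hε.ne' (Real.exp_pos t).ne', Real.log_exp, hb'] at this
      linarith
  have hbound : volume.real {t ∈ Set.Ioc 0 S | IsThick I ε t} ≤ F.card * (2 * b) := by
    refine (measureReal_mono hsub ?_).trans ((measureReal_biUnion_finset_le _ _).trans ?_)
    · exact ((F.finite_toSet.isCompact_biUnion fun k _ => isCompact_Icc).measure_lt_top).ne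
    · rw [Finset.sum_congr rfl fun k _ => Real.volume_real_Icc_of_le
        (by linarith : Real.log (q k) - b ≤ Real.log (q k) + b)]
      rw [Finset.sum_congr rfl fun k _ =>
        (by ring : Real.log (q k) + b - (Real.log (q k) - b) = 2 * b)]
      rw [Finset.sum_const, nsmul_eq_mul]
  rw [hlogX, div_mul_eq_mul_div, div_le_iff₀ (by positivity)]
  nlinarith [hvol.trans hbound, mul_lt_mul_of_pos_left hSb hδ]

end

section

variable {I : ThreeIET} {q a : ℕ → ℕ} {P : ℕ → ℤ} {d : ℕ → ℝ}

/-! ### Failures of `A5` are rare -/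

/-- A failure of `A5` at a scale without large partial quotient comes from a short path between the
marked points. -/
theorem exists_short_path_of_not_A5 (H : ContFracData I.α q a P d) {v p : ℕ} (hv : 1 ≤ v)
    (hp : ContFracData.Admissible a v p) {r η chat : ℝ} (hr : 1 ≤ r)
    (hc : chat = 1 / (4 * r * (r + 2))) (hη : 0 < η) (har : (a (v + 1) : ℝ) ≤ r)
    (hA : ¬ I.A5 η chat (p * q v)) :
    ∃ n m : ℤ, 2 * r * |(n : ℝ)| ≤ q v ∧ 2 * r * |n * I.α + m + I.z| ≤ d v ∧
      η * chat ≤ p * q v * |n * I.α + m + I.z| ∧ p * q v * |n * I.α + m + I.z| ≤ 2 * chat := by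
  have hr0 : 0 < r := by linarith
  have hc0 : 0 < chat := by rw [hc]; positivity
  have hc1 : chat < 1 / 4 := by
    rw [hc]
    apply one_div_lt_one_div_of_lt <;> nlinarith
  have hq := H.q_cast_pos v
  have hd := H.d_pos v
  have hp1 : (1 : ℝ) ≤ p := by exact_mod_cast hp.one_le
  rcases A5_dichotomy I H v hv with h | ⟨h, s, m, hh, hs0, hsd, hz, hA5⟩
  · exact absurd ((h p (hp.quarter H)).2 η chat hη hc0 hc1) hA
  obtain ⟨⟨h1, h2⟩, h3, h4⟩ := (hA5 p (hp.mul_q_lt H hv).le).2 η chat hη hc0 hc1 hA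
  have hh' : (h : ℝ) < q v := by exact_mod_cast hh
  have hh0 : (0 : ℝ) ≤ h := Nat.cast_nonneg h
  -- `chat` is small compared with `q v * d v`
  have hcq : 4 * r * chat ≤ q v * d v := by
    have h5 := H.one_le_mul_q_mul_d v
    have h6 : (a (v + 1) + 2) * (q v * d v) ≤ (r + 2) * (q v * d v) := by gcongr
    have h7 : 4 * r * chat = 1 / (r + 2) := by rw [hc]; field_simp
    rw [h7, div_le_iff₀ (by linarith)]
    linarith
  have h2' : (q v - h) * s ≤ chat := by
    refine le_trans ?_ h2
    exact le_mul_of_one_le_left (mul_nonneg (by linarith) hs0) hp1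
  have h4' : h * (d v - s) ≤ chat := by
    refine le_trans ?_ h4
    exact le_mul_of_one_le_left (mul_nonneg hh0 (by linarith)) hp1
  have hsq : ((-1 : ℝ)) ^ v * (-1) ^ v = 1 := by rw [← mul_pow]; norm_num
  have habs : ∀ n : ℤ, |(((-1) ^ v * n : ℤ) : ℝ)| = |(n : ℝ)| := fun n => by
    push_cast
    rw [abs_mul, abs_pow, abs_neg, abs_one, one_pow, one_mul]
  -- the elementary estimate behind both cases
  have small : ∀ x y X Y : ℝ, 0 ≤ x → 0 ≤ y → 0 < X → 0 < Y → 2 * x ≤ X → (X - x) * y ≤ chat →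
      x * (Y - y) ≤ chat → 4 * r * chat ≤ X * Y →
      2 * r * y ≤ Y ∧ 2 * r * x ≤ X := by
    intro x y X Y hx hy hX hY hxX h5 h6 h7
    have h8 : X * y ≤ 2 * chat := by
      have := mul_nonneg (sub_nonneg.2 hxX) hy
      linarith
    have h9 : 2 * r * y ≤ Y := by
      have := mul_le_mul_of_nonneg_left h8 (show 0 ≤ 2 * r by linarith)
      exact le_of_mul_le_mul_left (by linarith) hX
    have h10 : 2 * y ≤ Y := by
      have := mul_nonneg (sub_nonneg.2 hr) hy
      linarith
    have h11 : Y * x ≤ 2 * chat := by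
      have := mul_nonneg hx (sub_nonneg.2 h10)
      linarith
    refine ⟨h9, ?_⟩
    have := mul_le_mul_of_nonneg_left h11 (show 0 ≤ 2 * r by linarith)
    exact le_of_mul_le_mul_left (by linarith) hY
  rcases le_total (2 * (h : ℝ)) (q v) with hhalf | hhalf
  · -- the path is short because `h` is small
    obtain ⟨hs, hhr⟩ := small h s (q v) (d v) hh0 hs0 hq hd hhalf h2' h4' hcq
    have hval : (((-1) ^ v * (h : ℤ) : ℤ) : ℝ) * I.α + ((-m : ℤ) : ℝ) + I.z = s := by
      push_cast
      linear_combination hz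
    refine ⟨(-1) ^ v * h, -m, ?_, ?_, ?_, ?_⟩
    · rw [habs, Int.cast_natCast, abs_of_nonneg hh0]; exact hhr
    · rw [hval, abs_of_nonneg hs0]; exact hs
    · rw [hval, abs_of_nonneg hs0]
      refine h1.trans ?_
      rw [mul_assoc]
      gcongr
      linarith
    · rw [hval, abs_of_nonneg hs0]
      have h5 := mul_nonneg (mul_nonneg (zero_le_one.trans hp1) (sub_nonneg.2 hhalf)) hs0
      linarith
  · -- the path is short because `q v - h` is small
    have hs' : 0 ≤ d v - s := sub_nonneg.2 hsd
    obtain ⟨hs, hhr⟩ := small (q v - h) (d v - s) (q v) (d v) (by linarith) hs' hq hd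
      (by linarith) (by linarith) (by linarith) hcq
    have hN := H.q_mul_eq v
    have hval : (((-1) ^ v * ((h : ℤ) - q v) : ℤ) : ℝ) * I.α +
        ((-m + (-1) ^ v * P v : ℤ) : ℝ) + I.z = -(d v - s) := by
      push_cast at hN ⊢
      linear_combination hz - hN
    refine ⟨(-1) ^ v * (h - q v), -m + (-1) ^ v * P v, ?_, ?_, ?_, ?_⟩
    · rw [habs]
      push_cast
      rw [abs_sub_comm, abs_of_pos (by linarith)]
      exact hhr
    · rw [hval, abs_neg, abs_of_nonneg hs']; exact hs
    · rw [hval, abs_neg, abs_of_nonneg hs']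
      refine h3.trans ?_
      rw [mul_assoc]
      gcongr
    · rw [hval, abs_neg, abs_of_nonneg hs']
      have h5 := mul_nonneg (mul_nonneg (zero_le_one.trans hp1) (sub_nonneg.2 hhalf)) hs'
      linarith

/-- Two failures of `A5` at nearby scales have nearby times. -/
theorem time_le_of_not_A5 (H : ContFracData I.α q a P d) {v p v' p' : ℕ} (hv : 1 ≤ v)
    (hv' : 1 ≤ v') (hp : ContFracData.Admissible a v p) (hp' : ContFracData.Admissible a v' p')
    {r η chat : ℝ} (hr : 1 < r) (hc : chat = 1 / (4 * r * (r + 2))) (hη : 0 < η)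
    (htype : r < a (v + 1) ↔ r < a (v' + 1)) (h1 : (q v' : ℝ) < r * q v)
    (h2 : (q v : ℝ) < r * q v') (hA : ¬ I.A5 η chat (p * q v))
    (hA' : ¬ I.A5 η chat (p' * q v')) : (p' * q v' : ℝ) ≤ 2 / η * (p * q v) := by
  have hr0 : 0 < r := by linarith
  have hc0 : 0 < chat := by rw [hc]; positivity
  have hc1 : chat < 1 / 4 := by
    rw [hc]
    apply one_div_lt_one_div_of_lt <;> nlinarith
  by_cases hbig : r < a (v + 1)
  · have key : ∀ u u' : ℕ, r < a (u + 1) → (q u' : ℝ) < r * q u → u' ≤ u := by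
      intro u u' hu h
      by_contra! hlt
      have h3 := H.q_cast_mono (Nat.succ_le_of_lt hlt)
      have h4 : (a (u + 1) : ℝ) * q u ≤ q (u + 1) := by exact_mod_cast H.a_mul_q_le u
      have h5 := mul_lt_mul_of_pos_right hu (H.q_cast_pos u)
      simp only [Nat.succ_eq_add_one] at h3
      linarith
    have hvv : v' = v := le_antisymm (key v v' hbig h1) (key v' v (htype.1 hbig) h2)
    subst hvv
    rcases A5_dichotomy I H v' hv with h | ⟨h, s, m, -, -, -, -, hA5⟩
    · exact absurd ((h p (hp.quarter H)).2 η chat hη hc0 hc1) hA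
    obtain ⟨⟨h3, -⟩, -⟩ := (hA5 p (hp.mul_q_lt H hv).le).2 η chat hη hc0 hc1 hA
    obtain ⟨⟨-, h4⟩, -⟩ := (hA5 p' (hp'.mul_q_lt H hv').le).2 η chat hη hc0 hc1 hA'
    set U := (q v' - h) * s with hU
    have hU0 : 0 < U := by
      have : 0 < p * U := (mul_pos hη hc0).trans_le h3
      exact pos_of_mul_pos_right this (Nat.cast_nonneg p)
    have h5 : (p' : ℝ) ≤ 1 / η * p := by
      rw [one_div, inv_mul_eq_div, le_div_iff₀ hη]
      refine le_of_mul_le_mul_right ?_ hU0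
      nlinarith
    have h6 : 1 / η * p ≤ 2 / η * p := by gcongr; norm_num
    rw [← mul_assoc]
    exact mul_le_mul_of_nonneg_right (h5.trans h6) (H.q_cast_pos v').le
  · have hsmall : (a (v + 1) : ℝ) ≤ r := not_lt.1 hbig
    have hsmall' : (a (v' + 1) : ℝ) ≤ r := not_lt.1 fun h => hbig (htype.2 h)
    obtain ⟨n, m, hn1, hn2, hn3, -⟩ :=
      exists_short_path_of_not_A5 H hv hp hr.le hc hη hsmall hA
    obtain ⟨n', m', hn1', hn2', -, hn4'⟩ :=
      exists_short_path_of_not_A5 H hv' hp' hr.le hc hη hsmall' hA'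
    have hqv := H.q_cast_pos v
    have hqv' := H.q_cast_pos v'
    set e := n * I.α + m + I.z with he
    set e' := n' * I.α + m' + I.z with he'
    have hdiff : |((n - n' : ℤ) : ℝ) * I.α - ((m' - m : ℤ) : ℝ)| ≤ |e| + |e'| := by
      have : ((n - n' : ℤ) : ℝ) * I.α - ((m' - m : ℤ) : ℝ) = e - e' := by
        rw [he, he']; push_cast; ring
      rw [this]
      exact abs_sub _ _
    have hnn : n = n' := by
      by_contra hne
      have key : ∀ u : ℕ, (q v : ℝ) < r * q u → (q v' : ℝ) < r * q u → d v ≤ d u → d v' ≤ d u →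
          False := by
        intro u hu hu' hdu hdu'
        have h3 : |n - n'| < q (u + 1) := by
          have h4 : |((n - n' : ℤ) : ℝ)| ≤ |(n : ℝ)| + |(n' : ℝ)| := by
            push_cast; exact abs_sub _ _
          have h5 : 2 * r * |((n - n' : ℤ) : ℝ)| < 2 * r * q u := by nlinarith
          have h6 : |((n - n' : ℤ) : ℝ)| < q u := lt_of_mul_lt_mul_left h5 (by linarith)
          have h7 : |n - n'| < (q u : ℤ) := by exact_mod_cast h6
          exact h7.trans_le (by exact_mod_cast H.q_le_succ u)
        have h8 := H.d_le_abs u (m := m' - m) (sub_ne_zero.2 hne) h3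
        have h9 := H.d_pos u
        nlinarith [abs_nonneg e, abs_nonneg e']
      rcases le_total v v' with hle | hle
      · refine key v ?_ h1 le_rfl (H.d_anti hle)
        exact lt_mul_of_one_lt_left hqv hr
      · refine key v' h2 ?_ (H.d_anti hle) le_rfl
        exact lt_mul_of_one_lt_left hqv' hr
    have hmm : m = m' := by
      subst hnn
      have h3 : |((m' - m : ℤ) : ℝ)| < 1 := by
        rw [sub_self, Int.cast_zero, zero_mul, zero_sub, abs_neg] at hdiff
        have := H.d_lt_one v
        have := H.d_lt_one v'
        nlinarith [abs_nonneg e, abs_nonneg e']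
      have h4 : |m' - m| < 1 := by exact_mod_cast h3
      have := Int.abs_lt_one_iff.1 h4
      omega
    have hee : e' = e := by rw [he, he', hnn, hmm]
    rw [hee] at hn4'
    have he0 : 0 < |e| := by
      have : 0 < p * q v * |e| := (mul_pos hη hc0).trans_le hn3
      exact pos_of_mul_pos_right this (by positivity)
    rw [div_mul_eq_mul_div, le_div_iff₀ hη]
    refine le_of_mul_le_mul_right ?_ he0
    nlinarith

/-- The number of indices whose times violate `A5`. -/
theorem card_not_A5_le (H : ContFracData I.α q a P d) {r η chat c X Q : ℝ} {N w : ℕ} (hr : 1 < r)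
    (hc : chat = 1 / (4 * r * (r + 2))) (hη : 0 < η) (hc0 : 0 < c)
    (hQ : 1 ≤ Q) (hN : 1152 / η * Q < 2 ^ N) (hX : 1 ≤ X) (hcX : c ≤ 1) (v p : ℕ → ℕ)
    (A : Finset ℕ) (hv : ∀ k ∈ A, 1 ≤ v k) (hp : ∀ k ∈ A, ContFracData.Admissible a (v k) (p k))
    (hlow : ∀ k ∈ A, (q (k + w) : ℝ) < c * (p k * q (v k)))
    (hup : ∀ k ∈ A, c * (p k * q (v k)) < 576 * q (k + w))
    (hw : ∀ k ∈ A, (q (k + w) : ℝ) ≤ Q * q k) (hqX : ∀ k ∈ A, (q k : ℝ) ≤ X)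
    (hA : ∀ k ∈ A, ¬ I.A5 η chat (p k * q (v k))) :
    (A.card : ℝ) ≤ 2 * ((2 * N : ℕ) * (Real.log (576 * Q * X / c) / Real.log r + 1)) := by
  classical
  have hQ0 : 0 < Q := by linarith
  have hY : 1 ≤ 576 * Q * X / c := by
    rw [le_div_iff₀ hc0]
    nlinarith [mul_le_mul hQ hX zero_le_one hQ0.le]
  have main : ∀ B ⊆ A, (∀ k ∈ B, ∀ k' ∈ B, (r < a (v k + 1) ↔ r < a (v k' + 1))) →
      (B.card : ℝ) ≤ (2 * N : ℕ) * (Real.log (576 * Q * X / c) / Real.log r + 1) := by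
    intro B hB htype
    refine card_le_of_bins B (fun k => Real.log (q (v k))) (Real.log_pos hr) (2 * N)
      (Real.log_nonneg hY) (fun k hk => ⟨Real.log_nonneg (H.one_le_q_cast _), ?_⟩)
      fun B' hB' hdiam => H.card_le_of_ratio hN B' fun i hi j hj => ?_
    · refine Real.log_le_log (H.q_cast_pos _) ?_
      rw [le_div_iff₀ hc0, mul_comm]
      have h1 := hup k (hB hk)
      have h2 := hw k (hB hk)
      have h3 := hqX k (hB hk)
      have h4 : (1 : ℝ) ≤ p k := by exact_mod_cast (hp k (hB hk)).one_le
      calc c * q (v k) ≤ c * (p k * q (v k)) := by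
            gcongr
            exact le_mul_of_one_le_left (H.q_cast_pos _).le h4
        _ ≤ 576 * q (k + w) := h1.le
        _ ≤ 576 * (Q * X) := by
            have := mul_le_mul_of_nonneg_left h3 hQ0.le
            linarith
        _ = _ := by ring
    · have hratio : ∀ i ∈ B', ∀ j ∈ B', (q (v j) : ℝ) < r * q (v i) := by
        intro i hi j hj
        have h1 := hdiam i hi j hj
        rw [sub_lt_iff_lt_add, ← Real.log_mul (by positivity) (H.q_cast_pos _).ne'] at h1
        exact (Real.log_lt_log_iff (H.q_cast_pos _) (mul_pos (by linarith) (H.q_cast_pos _))).1 h1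
      have hiA := hB (hB' hi)
      have hjA := hB (hB' hj)
      have h1 := time_le_of_not_A5 H (hv i hiA) (hv j hjA) (hp i hiA) (hp j hjA) hr hc hη
        (htype i (hB' hi) j (hB' hj)) (hratio i hi j hj) (hratio j hj i hi) (hA i hiA) (hA j hjA)
      have h2 : (q j : ℝ) ≤ q (j + w) := H.q_cast_mono (by omega)
      calc (q j : ℝ) ≤ c * (p j * q (v j)) := h2.trans (hlow j hjA).le
        _ ≤ c * (2 / η * (p i * q (v i))) := by gcongr
        _ = 2 / η * (c * (p i * q (v i))) := by ring
        _ ≤ 2 / η * (576 * (Q * q i)) := by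
            have := hup i hiA
            have := hw i hiA
            exact mul_le_mul_of_nonneg_left (by linarith) (by positivity)
        _ = 1152 / η * Q * q i := by ring
  have h1 := main (A.filter fun k => r < a (v k + 1)) (Finset.filter_subset _ _) (by
    intro k hk k' hk'
    simp only [Finset.mem_filter] at hk hk'
    tauto)
  have h2 := main (A.filter fun k => ¬ r < a (v k + 1)) (Finset.filter_subset _ _) (by
    intro k hk k' hk'
    simp only [Finset.mem_filter] at hk hk'
    tauto)
  have h3 := Finset.card_filter_add_card_filter_not (s := A) (fun k => r < (a (v k + 1) : ℝ))
  have h4 : (A.card : ℝ) = (A.filter fun k => r < (a (v k + 1) : ℝ)).card +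
      (A.filter fun k => ¬ r < (a (v k + 1) : ℝ)).card := by
    exact_mod_cast h3.symm
  rw [h4]
  linarith

end

section

variable {I : ThreeIET} {q a : ℕ → ℕ} {P : ℕ → ℤ} {d : ℕ → ℝ}

/-! ### Vertical trajectories between the marked points -/

/-- At a thick index, paths between the marked points with small horizontal part are long. -/
theorem IsThickIndex.le_of_abs_le (H : ContFracData I.α q a P d) {ε : ℝ} (hε : 0 < ε) {k k' w : ℕ}
    (hk : IsThickIndex I q ε k) (hw : 1 / ε ^ 2 ≤ 2 ^ w) (hkk : k + 2 * w ≤ k') {m n : ℤ}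
    (hm : |I.z + m - n * I.α| ≤ d k') : ε ^ 2 * q k ≤ |(n : ℝ)| := by
  obtain ⟨t, ht, h1, h2⟩ := hk
  have hexp := Real.exp_pos t
  have hqk := H.q_cast_pos k
  have h3 : (2 : ℝ) ^ w * q k ≤ q (k' + 1) := by
    have h4 : (2 : ℝ) ^ w * q k ≤ q (k + 2 * w) := by exact_mod_cast H.two_pow_mul_q_le k w
    exact h4.trans (H.q_cast_mono (by omega))
  have h5 : Real.exp t ≤ ε * q (k' + 1) := by
    have h6 : 1 ≤ ε ^ 2 * 2 ^ w := by
      rwa [div_le_iff₀' (by positivity)] at hw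
    have h7 : (q k : ℝ) ≤ ε ^ 2 * q (k' + 1) := by
      have h8 := mul_le_mul_of_nonneg_right h6 hqk.le
      have h9 := mul_le_mul_of_nonneg_left h3 (sq_nonneg ε)
      linarith
    refine le_of_mul_le_mul_left (h1.trans (h7.trans_eq ?_)) hε
    ring
  have h6 : Real.exp t * |I.z + m - n * I.α| < ε := by
    have h7 := H.q_succ_mul_d_lt k'
    have h8 := H.d_pos k'
    calc Real.exp t * |I.z + m - n * I.α| ≤ Real.exp t * d k' := by gcongr
      _ ≤ ε * q (k' + 1) * d k' := by gcongr
      _ = ε * (q (k' + 1) * d k') := by ring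
      _ < ε * 1 := by gcongr
      _ = ε := mul_one ε
  rcases le_max_iff.1 (ht.2 m n) with h | h
  · exact absurd h (not_le.2 h6)
  · rw [Real.exp_neg, inv_mul_eq_div, le_div_iff₀ hexp] at h
    have h7 := mul_le_mul_of_nonneg_left h2 hε.le
    linarith

theorem abs_apply_le_of_norm_toLp_le {v : Fin 2 → ℝ} {ρ : ℝ} (h : ‖WithLp.toLp 2 v‖ ≤ ρ)
    (i : Fin 2) : |v i| ≤ ρ := by
  have := PiLp.norm_apply_le (p := 2) (WithLp.toLp 2 v) i
  exact this.trans h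

theorem IsThickIndex.verticalGap (H : ContFracData I.α q a P d) {ε : ℝ} (hε : 0 < ε) {k k' w : ℕ}
    (hk : IsThickIndex I q ε k) (hw : 1 / ε ^ 2 ≤ 2 ^ w) (hkk : k + 2 * w ≤ k')
    (hq : 2 / ε ^ 2 ≤ q k) {ρ : ℝ} (hρ : ρ ≤ d k') :
    VerticalGap I.frame ρ (ε ^ 2 * q k / 2) := by
  have hq' : 2 ≤ ε ^ 2 * q k := by rwa [div_le_iff₀' (by positivity)] at hq
  have key : ∀ (m n : ℤ) (τ : ℝ), |I.z + m - n * I.α| ≤ ρ → |(n : ℝ)| ≤ |τ| + ρ →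
      ε ^ 2 * q k / 2 ≤ |τ| := by
    intro m n τ h1 h2
    have h3 := hk.le_of_abs_le H hε hw hkk (h1.trans hρ)
    have h4 := H.d_lt_one k'
    linarith
  rintro τ (⟨v, ⟨n, rfl⟩, h⟩ | ⟨v, ⟨n, rfl⟩, h⟩)
  · have h0 := abs_apply_le_of_norm_toLp_le h 0
    have h1 := abs_apply_le_of_norm_toLp_le h 1
    simp [ThreeIET.frame, Frame.basis, Frame.p₁, Frame.p₂, dotProduct,
      Fin.sum_univ_two] at h0 h1
    refine key (n 0) (n 1) τ ?_ ?_
    · rw [← abs_neg]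
      convert h0 using 2
      ring
    · have := abs_sub_abs_le_abs_sub (n 1 : ℝ) τ
      rw [abs_sub_comm] at this
      linarith
  · have h0 := abs_apply_le_of_norm_toLp_le h 0
    have h1 := abs_apply_le_of_norm_toLp_le h 1
    simp [ThreeIET.frame, Frame.basis, Frame.p₁, Frame.p₂, dotProduct,
      Fin.sum_univ_two] at h0 h1
    refine key (-n 0) (-n 1) τ ?_ ?_
    · convert h0 using 2
      push_cast
      ring
    · have := abs_sub_abs_le_abs_sub (n 1 : ℝ) τ
      rw [abs_sub_comm] at this
      push_cast
      rw [abs_neg]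
      linarith

/-! ### Rigidity times -/

theorem circleDist_fract_le (β x : ℝ) (N : ℤ) (h0 : 0 ≤ x) (h1 : x ≤ 1) :
    |circleDist (Int.fract (x + β)) x| ≤ |β - N| := by
  set u := Int.fract (x + β) with hu
  have hu0 : 0 ≤ u := Int.fract_nonneg _
  have hu1 : u < 1 := Int.fract_lt_one _
  have hy : |u - x| ≤ 1 := by rw [abs_le]; constructor <;> linarith
  have hnn : 0 ≤ circleDist u x := le_min (abs_nonneg _) (by linarith)
  rw [abs_of_nonneg hnn]
  have hβ : β - N = (u - x) + ((⌊x + β⌋ - N : ℤ) : ℝ) := by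
    rw [hu, Int.fract]; push_cast; ring
  by_cases hj : ⌊x + β⌋ - N = 0
  · rw [hβ, hj, Int.cast_zero, add_zero]
    exact min_le_left _ _
  · refine (min_le_right _ _).trans ?_
    have h2 : (1 : ℝ) ≤ |((⌊x + β⌋ - N : ℤ) : ℝ)| := by exact_mod_cast Int.one_le_abs hj
    have h3 := abs_sub_abs_le_abs_sub ((⌊x + β⌋ - N : ℤ) : ℝ) (-(u - x))
    rw [abs_neg, sub_neg_eq_add, add_comm _ (u - x), ← hβ] at h3
    linarith

theorem abs_integral_circleDist_le (I : ThreeIET) {L : ℕ} (hL : 1 ≤ L) (N : ℤ) :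
    |∫ x in (0 : ℝ)..1, circleDist (I.R^[L] x) x| ≤ |L * I.α - N| := by
  have h := intervalIntegral.norm_integral_le_of_norm_le_const (a := (0 : ℝ)) (b := 1)
    (f := fun x => circleDist (I.R^[L] x) x) (C := |L * I.α - N|) fun x hx => by
      rw [Set.uIoc_of_le zero_le_one] at hx
      obtain ⟨j, rfl⟩ := Nat.exists_eq_add_of_le' hL
      rw [Real.norm_eq_abs, ThreeIET.R, iterate_succ_rotation]
      have := circleDist_fract_le ((j + 1) * I.α) x N hx.1.le hx.2
      push_cast
      exact this
  simpa using h

theorem ContFracData.abs_integral_circleDist_le (H : ContFracData I.α q a P d) {v p : ℕ}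
    (hp : 1 ≤ p) (hle : p * q v ≤ q (v + 1)) :
    |∫ x in (0 : ℝ)..1, circleDist (I.R^[p * q v] x) x| ≤ 1 / q v := by
  have hq := H.q_cast_pos v
  have h1 := MarkedTorus.abs_integral_circleDist_le I (L := p * q v)
    (Nat.mul_pos hp (H.q_pos v)) (p * P v)
  refine h1.trans ?_
  have h2 : ((p * q v : ℕ) : ℝ) * I.α - ((p * P v : ℤ) : ℝ) = p * ((-1) ^ v * d v) := by
    rw [← H.mul_sub v]; push_cast; ring
  rw [h2, abs_mul, abs_mul, abs_pow, abs_neg, abs_one, one_pow, one_mul, Nat.abs_cast,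
    abs_of_pos (H.d_pos v), le_div_iff₀ hq]
  have h3 := H.q_succ_mul_d_lt v
  have h4 : (p * q v : ℝ) ≤ q (v + 1) := by exact_mod_cast hle
  have h5 := mul_le_mul_of_nonneg_right h4 (H.d_pos v).le
  linarith

/-! ### The conditions at a single time -/

/-- The conditions (A0)-(A9) for one pair of values of the sequences, (A6) up to an error `e`. -/
structure ConditionsAt (I : ThreeIET) (C₁ C₂ C₃ C₄ : ℝ) (ℓ : ℕ) (η chat c : ℝ) (kc : ℕ) (e : ℝ)
    (L k : ℕ) : Prop where
  A0 : I.q (k - 1) < c * L ∧ c * L < I.q k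
  A1 : I.a k < C₁
  A2 : I.a (k + 1) < C₂
  A3 : I.a (k + 2) < C₃
  A4 : VerticalGap I.frame (distInt (I.q k * I.α)) (I.q k / C₄)
  A5 : I.A5 η chat L
  A6 : |∫ x in (0 : ℝ)..1, circleDist (I.R^[L] x) x| ≤ e
  A7 : I.q (k + ℓ) < L
  A8 : ∀ j ∈ I.ψ L '' Set.Ico 0 1, ∀ j' ∈ I.ψ L '' Set.Ico 0 1, (j : ℤ) - j' < kc
  A9 : I.A9 L

theorem exists_conditions {C₁ C₂ C₃ C₄ : ℝ} {ℓ : ℕ} {η chat c : ℝ} {kc : ℕ}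
    (h : ∀ N : ℕ, ∃ L k, N < L ∧ N < k ∧
      ConditionsAt I C₁ C₂ C₃ C₄ ℓ η chat c kc (1 / ((N : ℝ) + 1)) L k) :
    ∃ L k : ℕ → ℕ, I.Conditions C₁ C₂ C₃ C₄ ℓ η chat c kc L k := by
  choose f g hf hg hfg using h
  obtain ⟨n, hn⟩ : ∃ n : ℕ → ℕ, ∀ i, n (i + 1) = f (n i) + g (n i) :=
    ⟨fun i => Nat.rec 0 (fun _ m => f m + g m) i, fun _ => rfl⟩
  have hi : ∀ i, i ≤ n i := by
    intro i
    induction i with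
    | zero => exact Nat.zero_le _
    | succ i ih =>
      have := hf (n i)
      rw [hn]
      omega
  refine ⟨fun i => f (n i), fun i => g (n i), ?_⟩
  refine
    { L_strictMono := strictMono_nat_of_lt_succ fun i => ?_
      k_strictMono := strictMono_nat_of_lt_succ fun i => ?_
      k_pos := fun i => (Nat.zero_le _).trans_lt (hg _)
      A0 := fun i => (hfg _).A0
      A1 := fun i => (hfg _).A1
      A2 := fun i => (hfg _).A2
      A3 := fun i => (hfg _).A3
      A4 := fun i => (hfg _).A4
      A5 := fun i => (hfg _).A5
      A6 := ?_
      A7 := fun i => (hfg _).A7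
      A8 := fun i => (hfg _).A8
      A9 := fun i => (hfg _).A9 }
  · have := hf (n (i + 1))
    have := hn i
    show f (n i) < f (n (i + 1))
    omega
  · have := hg (n (i + 1))
    have := hn i
    show g (n i) < g (n (i + 1))
    omega
  · refine squeeze_zero_norm (fun i => ?_) tendsto_one_div_add_atTop_nhds_zero_nat
    rw [Real.norm_eq_abs]
    refine (hfg (n i)).A6.trans ?_
    have : (i : ℝ) ≤ n i := by exact_mod_cast hi i
    gcongr

theorem distInt_le (x : ℝ) (N : ℤ) : distInt x ≤ |x - N| := round_le x N

theorem ContFracData.distInt_le (H : ContFracData I.α q a P d) (k : ℕ) :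
    distInt (q k * I.α) ≤ d k := by
  refine (MarkedTorus.distInt_le _ (P k)).trans ?_
  rw [H.mul_sub, abs_mul, abs_pow, abs_neg, abs_one, one_pow, one_mul, abs_of_pos (H.d_pos k)]

theorem ContFracData.Admissible.ψ_sub_le (H : ContFracData I.α q a P d) {v p : ℕ} (hv : 1 ≤ v)
    (hp : Admissible a v p) {x y : ℝ} (hx : x ∈ Set.Ico (0 : ℝ) 1) (hy : y ∈ Set.Ico (0 : ℝ) 1) :
    (I.ψ (p * q v) x : ℤ) - I.ψ (p * q v) y ≤ p + 1 := by
  have := hp.one_le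
  rcases A5_dichotomy I H v hv with h | ⟨_, _, _, -, -, -, -, h⟩
  · have := (h p (hp.quarter H)).1 x hx y hy
    omega
  · have := (h p (hp.mul_q_lt H hv).le).1 x hx y hy
    omega

theorem ContFracData.Admissible.A9 (H : ContFracData I.α q a P d) (hq : ∀ k, I.q k = q k)
    (ha : ∀ k, I.a (k + 1) = a (k + 1)) {v p : ℕ} (hv : 1 ≤ v) (hp : Admissible a v p) :
    I.A9 (p * q v) := by
  refine ⟨v, ?_, ?_, ?_⟩
  · rw [hq]
    exact_mod_cast Nat.le_mul_of_pos_left _ hp.one_le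
  · rw [hq]
    exact_mod_cast hp.mul_q_lt H hv
  · rcases hp with rfl | ⟨-, h4, hpa⟩
    · left; rw [hq, one_mul]
    · right
      rw [ha, hq]
      refine ⟨by exact_mod_cast h4, p, Nat.le_floor ?_, by push_cast; ring⟩
      have : (4 * p : ℝ) ≤ a (v + 1) := by exact_mod_cast hpa
      linarith

theorem exists_conditionsAt (H : ContFracData I.α q a P d) (hq : ∀ k, I.q k = q k)
    (ha : ∀ k, I.a (k + 1) = a (k + 1)) {ε : ℝ} (hε : 0 < ε) {k w ℓ : ℕ}
    (hk : IsThickIndex I q ε k) (hw : 1 / ε ^ 2 ≤ 2 ^ w) (hqk : 2 / ε ^ 2 ≤ q k)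
    {C D c η chat : ℝ} (hC0 : 0 < C)
    (hC : ∀ j, k < j → j ≤ k + (2 * w + 22) → (a j : ℝ) ≤ C)
    (hD : ∀ j, k < j → j ≤ k + (2 * w + 22 + ℓ) → (a j : ℝ) ≤ D) (hc0 : 0 < c)
    (hcD : c * (D + 1) ^ (2 * w + 20 + ℓ) ≤ 1) {v p : ℕ} (hv : 1 ≤ v) (hkv : k + 2 * w ≤ v)
    (hp : ContFracData.Admissible a v p) (h1 : (q (k + 2 * w) : ℝ) < c * (p * q v))
    (h2 : c * (p * q v) < 576 * q (k + 2 * w)) (hne : ∀ j, c * (p * q v) ≠ q j)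
    (hA5 : I.A5 η chat (p * q v)) :
    ∃ k', k + 1 ≤ k' ∧ ConditionsAt I (C + 1) (C + 1) (C + 1) (2 * (C + 1) ^ (2 * w + 20) / ε ^ 2)
      ℓ η chat c (⌈576 / c⌉₊ + 2) (1 / q v) (p * q v) k' := by
  obtain ⟨k', hk1, hk2, hk3, hk4⟩ := H.exists_index h1 h2 hne
  have hqv := H.q_cast_pos v
  have hC' : ∀ j, k < j → j ≤ k + (2 * w + 22) → I.a j < C + 1 := by
    intro j hj1 hj2
    obtain ⟨i, rfl⟩ := Nat.exists_eq_add_of_lt hj1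
    rw [ha]
    have := hC _ hj1 hj2
    linarith
  refine ⟨k', by omega, ?_⟩
  refine
    { A0 := ?_
      A1 := hC' _ (by omega) (by omega)
      A2 := hC' _ (by omega) (by omega)
      A3 := hC' _ (by omega) (by omega)
      A4 := ?_
      A5 := hA5
      A6 := H.abs_integral_circleDist_le hp.one_le (hp.mul_q_lt H hv).le
      A7 := ?_
      A8 := ?_
      A9 := hp.A9 H hq ha hv }
  · rw [hq, hq]
    push_cast
    exact ⟨hk3, hk4⟩
  · rw [hq]
    intro τ hτ
    refine le_trans ?_ (hk.verticalGap H hε hw (k' := k') (by omega) hqk (H.distInt_le k') τ hτ)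
    have h3 := H.q_add_le k (2 * w + 20) fun j hj1 hj2 => hC j hj1 (by omega)
    have h4 : (q k' : ℝ) ≤ q (k + (2 * w + 20)) := H.q_cast_mono (by omega)
    rw [div_le_iff₀ (by positivity)]
    calc (q k' : ℝ) ≤ (C + 1) ^ (2 * w + 20) * q k := h4.trans h3
      _ = ε ^ 2 * q k / 2 * (2 * (C + 1) ^ (2 * w + 20) / ε ^ 2) := by field_simp
  · rw [hq]
    push_cast
    have h3 := H.q_add_le k (2 * w + 20 + ℓ) fun j hj1 hj2 => hD j hj1 (by omega)
    have h4 : (q (k' + ℓ) : ℝ) ≤ q (k + (2 * w + 20 + ℓ)) := H.q_cast_mono (by omega)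
    have h5 : (q k : ℝ) ≤ q (k + 2 * w) := H.q_cast_mono (by omega)
    have h6 := mul_le_mul_of_nonneg_right hcD (H.q_cast_pos k).le
    have h7 := mul_le_mul_of_nonneg_left (h4.trans h3) hc0.le
    exact lt_of_mul_lt_mul_left (by linarith) hc0.le
  · rintro _ ⟨x, hx, rfl⟩ _ ⟨y, hy, rfl⟩
    have h3 := hp.ψ_sub_le H hv hx hy
    have h4 : (p : ℝ) ≤ 576 / c := by
      rw [le_div_iff₀ hc0]
      have h5 : (q (k + 2 * w) : ℝ) ≤ q v := H.q_cast_mono hkv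
      exact le_of_mul_le_mul_right (by linarith) hqv
    have h5 : p ≤ ⌈576 / c⌉₊ := by exact_mod_cast h4.trans (Nat.le_ceil _)
    push_cast
    omega

/-! ### Good indices are not rare -/

theorem exists_good_index (H : ContFracData I.α q a P d) {ε δ : ℝ} (hδ : 0 < δ)
    (hF : ∀ T₀ : ℝ, ∃ X ≥ (1 : ℝ), T₀ < Real.log X ∧
      ∃ F : Finset ℕ, (∀ k ∈ F, IsThickIndex I q ε k ∧ (q k : ℝ) ≤ X) ∧ δ * Real.log X ≤ F.card)
    {w u u' M : ℕ} {C D r η chat c : ℝ} (hC : 1 < C) (hCu : 8 * u ≤ δ * Real.log C)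
    (hD : 1 < D) (hDu : 8 * u' ≤ δ * Real.log D) (hr : 1 < r) (hrM : 32 * M ≤ δ * Real.log r)
    (hwu : w ≤ u) (hchat : chat = 1 / (4 * r * (r + 2))) (hη : 0 < η)
    (hM : 1152 / η * (C + 1) ^ w < 2 ^ M) (hc0 : 0 < c) (hc1 : c < 1) (N : ℕ) :
    ∃ k, N < k ∧ IsThickIndex I q ε k ∧ (∀ j, k < j → j ≤ k + u → (a j : ℝ) ≤ C) ∧
      (∀ j, k < j → j ≤ k + u' → (a j : ℝ) ≤ D) ∧
      ∃ v p, k + w ≤ v ∧ ContFracData.Admissible a v p ∧ (q (k + w) : ℝ) < c * (p * q v) ∧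
        c * (p * q v) < 576 * q (k + w) ∧ (∀ j, c * (p * q v) ≠ q j) ∧
        I.A5 η chat (p * q v) := by
  classical
  by_contra! hcon
  set N₀ := N + ⌈576 / c⌉₊ + 1 with hN₀
  have hvp : ∀ k, ∃ v p, N₀ ≤ k → k + w ≤ v ∧ ContFracData.Admissible a v p ∧
      (q (k + w) : ℝ) < c * (p * q v) ∧ c * (p * q v) < 576 * q (k + w) ∧
      ∀ j, c * (p * q v) ≠ q j := by
    intro k
    by_cases hk : N₀ ≤ k
    · have h1 : 576 / c < (q (k + w) : ℝ) := by
        have h2 := H.le_q (k + w)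
        have h3 : ⌈576 / c⌉₊ < q (k + w) := by omega
        exact (Nat.le_ceil _).trans_lt (by exact_mod_cast h3)
      obtain ⟨v, p, h⟩ := H.exists_admissible hc0 hc1 (κ := k + w) (by omega) h1
      exact ⟨v, p, fun _ => h⟩
    · exact ⟨0, 0, fun h => absurd h hk⟩
  choose v p hvp using hvp
  set Q := (C + 1) ^ w with hQ
  have hQ1 : 1 ≤ Q := one_le_pow₀ (by linarith)
  have hlogC := Real.log_pos hC
  have hlogD := Real.log_pos hD
  have hlogr := Real.log_pos hr
  have hB0 : 1 ≤ 576 * Q / c := by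
    rw [le_div_iff₀ hc0]; linarith
  have hB := Real.log_nonneg hB0
  set B := Real.log (576 * Q / c) with hBdef
  set K : ℝ := N₀ + u + u' + 4 * M * (B / Real.log r + 1) with hK
  have hK0 : 0 ≤ K := by positivity
  obtain ⟨X, hX, hT, F, hF1, hF2⟩ := hF (2 * K / δ)
  have hX0 : 0 < X := by linarith
  set bigC : ℕ → Prop := fun k => ∃ j, k < j ∧ j ≤ k + u ∧ C < a j with hbigC
  set bigD : ℕ → Prop := fun k => ∃ j, k < j ∧ j ≤ k + u' ∧ D < a j with hbigD
  set bad : ℕ → Prop := fun k => N₀ ≤ k ∧ ¬ bigC k ∧ ¬ I.A5 η chat (p k * q (v k)) with hbad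
  have hsub : F ⊆ Finset.range N₀ ∪ (F.filter bigC ∪ (F.filter bigD ∪ F.filter bad)) := by
    intro k hk
    simp only [Finset.mem_union, Finset.mem_filter, Finset.mem_range]
    by_contra hnot
    simp only [hk, true_and, not_or, not_lt] at hnot
    obtain ⟨hkN, hkC, hkD, hkb⟩ := hnot
    have hA : I.A5 η chat (p k * q (v k)) := by
      by_contra hA
      exact hkb ⟨hkN, hkC, hA⟩
    simp only [hbigC, hbigD, not_exists, not_and, not_lt] at hkC hkD
    obtain ⟨h1, h2, h3, h4, h5⟩ := hvp k hkN
    exact hcon k (by omega) (hF1 k hk).1 hkC hkD (v k) (p k) h1 h2 h3 h4 h5 hA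
  have hcard : (F.card : ℝ) ≤ N₀ + ((F.filter bigC).card + ((F.filter bigD).card +
      (F.filter bad).card)) := by
    have h1 := Finset.card_le_card hsub
    have h2 := Finset.card_union_le (Finset.range N₀)
      (F.filter bigC ∪ (F.filter bigD ∪ F.filter bad))
    have h3 := Finset.card_union_le (F.filter bigC) (F.filter bigD ∪ F.filter bad)
    have h4 := Finset.card_union_le (F.filter bigD) (F.filter bad)
    rw [Finset.card_range] at h2
    exact_mod_cast (by omega : F.card ≤ N₀ + ((F.filter bigC).card + ((F.filter bigD).card +
      (F.filter bad).card)))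
  have hcardC := H.card_big_quotient_le hC hX u (F.filter bigC) fun k hk => by
    rw [Finset.mem_filter] at hk
    exact ⟨(hF1 k hk.1).2, hk.2⟩
  have hcardD := H.card_big_quotient_le hD hX u' (F.filter bigD) fun k hk => by
    rw [Finset.mem_filter] at hk
    exact ⟨(hF1 k hk.1).2, hk.2⟩
  have hmem : ∀ k ∈ F.filter bad, k ∈ F ∧ N₀ ≤ k ∧ ¬ bigC k ∧ ¬ I.A5 η chat (p k * q (v k)) :=
    fun k hk => Finset.mem_filter.1 hk
  have hcardb := card_not_A5_le H hr hchat hη hc0 hQ1 hM hX hc1.le v p (F.filter bad) (w := w)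
    (fun k hk => by have := (hvp k (hmem k hk).2.1).1; have := (hmem k hk).2.1; omega)
    (fun k hk => (hvp k (hmem k hk).2.1).2.1) (fun k hk => (hvp k (hmem k hk).2.1).2.2.1)
    (fun k hk => (hvp k (hmem k hk).2.1).2.2.2.1)
    (fun k hk => H.q_add_le k w fun j hj1 hj2 => by
      have h := (hmem k hk).2.2.1
      simp only [hbigC, not_exists, not_and, not_lt] at h
      exact h j hj1 (by omega))
    (fun k hk => (hF1 k (hmem k hk).1).2) (fun k hk => (hmem k hk).2.2.2)
  have hlogY : Real.log (576 * Q * X / c) = B + Real.log X := by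
    rw [hBdef, ← Real.log_mul (by positivity) hX0.ne']
    congr 1
    ring
  rw [hlogY] at hcardb
  have hlogX := Real.log_nonneg hX
  set Y := Real.log X with hY
  have hfrac : ∀ {n l : ℝ}, 0 < l → 8 * n ≤ δ * l → n * (Y / l) ≤ δ / 8 * Y := by
    intro n l hl h
    rw [← mul_div_assoc, div_le_iff₀ hl]
    have := mul_le_mul_of_nonneg_right h hlogX
    linarith
  have e1 := hfrac hlogC hCu
  have e2 := hfrac hlogD hDu
  have e3 := hfrac (n := 4 * M) hlogr (by linarith)
  rw [add_div] at hcardb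
  push_cast at hcardb
  rw [div_lt_iff₀ hδ] at hT
  linarith

/-! ### The main argument -/

theorem satisfiesAssumptions_of_thick_indices (H : ContFracData I.α q a P d)
    (hq : ∀ k, I.q k = q k) (ha : ∀ k, I.a (k + 1) = a (k + 1)) {ε δ : ℝ} (hε : 0 < ε)
    (hε1 : ε < 1) (hδ : 0 < δ)
    (hF : ∀ T₀ : ℝ, ∃ X ≥ (1 : ℝ), T₀ < Real.log X ∧ ∃ F : Finset ℕ,
      (∀ k ∈ F, IsThickIndex I q ε k ∧ (q k : ℝ) ≤ X) ∧ δ * Real.log X ≤ F.card) :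
    I.SatisfiesAssumptions := by
  have hbase : ∀ n : ℕ, ∃ C : ℝ, 1 < C ∧ 8 * n ≤ δ * Real.log C := by
    intro n
    refine ⟨Real.exp (8 * n / δ + 1), Real.one_lt_exp_iff.2 (by positivity), ?_⟩
    rw [Real.log_exp, mul_add, mul_div_cancel₀ _ hδ.ne']
    linarith
  obtain ⟨w, hw⟩ := pow_unbounded_of_one_lt (1 / ε ^ 2) one_lt_two
  obtain ⟨C, hC, hCu⟩ := hbase (2 * w + 22)
  choose D hD hDu using fun ℓ : ℕ => hbase (2 * w + 22 + ℓ)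
  choose M hM using fun η : ℝ =>
    pow_unbounded_of_one_lt (1152 / η * (C + 1) ^ (2 * w)) one_lt_two
  choose r hr hrM using fun η : ℝ => hbase (4 * M η)
  have hr0 : ∀ η, 0 < r η := fun η => zero_lt_one.trans (hr η)
  have hC4 : 1 < 2 * (C + 1) ^ (2 * w + 20) / ε ^ 2 := by
    rw [lt_div_iff₀ (by positivity)]
    have h1 : ε ^ 2 < 1 := pow_lt_one₀ hε.le hε1 two_ne_zero
    have h2 : 1 ≤ (C + 1) ^ (2 * w + 20) := one_le_pow₀ (by linarith)
    linarith
  refine ⟨C + 1, C + 1, C + 1, 2 * (C + 1) ^ (2 * w + 20) / ε ^ 2, by linarith, by linarith,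
    by linarith, hC4, 1, fun η => 1 / (4 * r η * (r η + 2)),
    fun ℓ => 1 / (D ℓ + 1) ^ (2 * w + 20 + ℓ), fun c => ⌈576 / c⌉₊ + 2, one_pos,
    fun η _ => by have := hr0 η; positivity,
    fun ℓ => by have := hD ℓ; positivity, ?_⟩
  intro ℓ η hη _ c hc hcℓ
  have hD1 := hD ℓ
  have hpow : 1 ≤ (D ℓ + 1) ^ (2 * w + 20 + ℓ) := one_le_pow₀ (by linarith)
  rw [lt_div_iff₀ (by linarith)] at hcℓ
  have hc1 : c < 1 := (le_mul_of_one_le_right hc.le hpow).trans_lt hcℓ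
  refine exists_conditions fun N => ?_
  obtain ⟨k, hkN, hk, hkC, hkD, v, p, hkv, hp, h1, h2, h3, h4⟩ :=
    exists_good_index H hδ hF hC hCu hD1 (hDu ℓ) (hr η)
      (by have := hrM η; push_cast at this; linarith) (show 2 * w ≤ 2 * w + 22 by omega) rfl hη
      (hM η) hc hc1 (N + ⌈2 / ε ^ 2⌉₊)
  have hqk : 2 / ε ^ 2 ≤ (q k : ℝ) := by
    have h5 := H.le_q k
    exact (Nat.le_ceil _).trans (by exact_mod_cast (by omega : ⌈2 / ε ^ 2⌉₊ ≤ q k))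
  obtain ⟨k', hk', hcond⟩ := exists_conditionsAt H hq ha hε hk hw.le hqk (by linarith)
    hkC hkD hc hcℓ.le (by omega) hkv hp h1 h2 h3 h4
  have hvq := H.le_q v
  refine ⟨p * q v, k', ?_, by omega, hcond.A0, hcond.A1, hcond.A2, hcond.A3, hcond.A4, hcond.A5,
    hcond.A6.trans ?_, hcond.A7, hcond.A8, hcond.A9⟩
  · have := Nat.le_mul_of_pos_left (q v) hp.one_le
    omega
  · have : ((N + 1 : ℕ) : ℝ) ≤ q v := by exact_mod_cast (by omega : N + 1 ≤ q v)
    push_cast at this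
    gcongr

theorem exists_isThick_gt {ε δ : ℝ} (hδ : 0 < δ)
    (h : ∀ T₀ : ℝ, ∃ S > T₀, δ * S ≤ volume.real {t | t ∈ Set.Ioc 0 S ∧ IsThick I ε t}) (T₀ : ℝ) :
    ∃ t > T₀, IsThick I ε t := by
  by_contra! hcon
  obtain ⟨S, hS, hle⟩ := h (|T₀| / δ)
  have h1 : volume.real {t | t ∈ Set.Ioc 0 S ∧ IsThick I ε t} ≤ volume.real (Set.Ioc 0 |T₀|) := by
    refine measureReal_mono (fun t ht => ⟨ht.1.1, ?_⟩) (by simp)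
    by_contra! hlt
    exact hcon t ((le_abs_self T₀).trans_lt hlt) ht.2
  rw [Real.volume_real_Ioc_of_le (abs_nonneg _), sub_zero] at h1
  rw [gt_iff_lt, div_lt_iff₀ hδ] at hS
  linarith

end

end MarkedTorus

end

theorem proposition1p5 (I : MarkedTorus.ThreeIET) (X : MarkedTorus.M12) (hX : X = I.torus)
    (hν : ∃ ν : MeasureTheory.Measure MarkedTorus.M12,
      MeasureTheory.IsFiniteMeasureOnCompacts ν ∧ MarkedTorus.IsWeakStarLimit X ν ∧ ν ≠ 0) :
    I.SatisfiesAssumptions := by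
  subst hX
  obtain ⟨ν, hfin, hlim, hne⟩ := hν
  obtain ⟨ε₀, hε₀, δ, hδ, hrec⟩ := MarkedTorus.exists_recurrence hlim hne
  set ε := min ε₀ (1 / 2) with hεdef
  have hε : 0 < ε := lt_min hε₀ (by norm_num)
  have hε1 : ε < 1 := (min_le_right _ _).trans_lt (by norm_num)
  have hthick : ∀ T₀ : ℝ, ∃ S > T₀,
      δ * S ≤ volume.real {t | t ∈ Set.Ioc 0 S ∧ MarkedTorus.IsThick I ε t} := by
    intro T₀
    obtain ⟨S, hS, hle⟩ := hrec T₀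
    refine ⟨S, hS, hle.trans (measureReal_mono (fun t ht => ⟨ht.1, ?_⟩) ?_)⟩
    · exact (MarkedTorus.isThick_of_le_systole I ht.2).mono (min_le_left _ _)
    · exact measure_ne_top_of_subset (fun t ht => ht.1) measure_Ioc_lt_top.ne
  have hirr := MarkedTorus.irrational_of_isThick I hε (MarkedTorus.exists_isThick_gt hδ hthick)
  obtain ⟨q, a, P, d, H, hq, ha⟩ := MarkedTorus.exists_contFracData I hirr
  obtain ⟨δ', hδ', hF⟩ := MarkedTorus.exists_many_thick_indices H hε hε1 hδ hthick
  exact MarkedTorus.satisfiesAssumptions_of_thick_indices H hq ha hε hε1 hδ' hF
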